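/- Let $n\ge 1$ and let $\nu>\frac{n-1}{2}$ be real. Let $J=\mathrm{Sym}(n,\mathbb R)$ be the space of real symmetric $n\times n$ matrices, $\Omega\subset J$ the cone of positive definite matrices, $d\mu_\nu(x)=\det(x)^{\nu-\frac{n+1}{2}}\,dx$ on $\Omega$, $L^2_\nu(\Omega)=L^2(\Omega,d\mu_\nu)$, and let $T(\Omega)=\Omega+iJ\subset\mathrm{Sym}(n,\mathbb C)$. For $f\in L^2_\nu(\Omega)$ let $$\mathcal L_\nu f(z)=\int_\Omega e^{-\operatorname{tr}(zx)}f(x)\,d\mu_\nu(x),\qquad z\in T(\Omega).$$ Let $G\cong \mathrm{Sp}(n,\mathbb R)$ be the group acting on $T(\Omega)$ by $g\cdot z=(Az+B)(Cz+D)^{-1}$, $g=\begin{pmatrix}A&B\\ C&D\end{pmatrix}$, whose Lie algebra is $$\mathfrak g=\left\{\begin{pmatrix}a&ib\\-ic&-a^t\end{pmatrix}\ :\ a,b,c\ \text{real},\ b=b^t,\ c=c^t\right\},\qquad \mathfrak g_{\mathbb C}=\mathfrak{sp}(n,\mathbb C).$$ For $X\in\mathfrak g$, $t\in\mathbb R$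 and $F$ on $T(\Omega)$ put $$\pi_\nu(\exp tX)F(z)=\det(C_tz+D_t)^{-\nu}\,F(\exp(-tX)\cdot z),$$ where $(C_t\ D_t)$ is the lower block row of $\exp(-tX)$ and $\det(C_tz+D_t)^{-\nu}$ is the branch that is continuous in $t$ with value $1$ at $t=0$; put $\lambda_\nu(\exp tX)=\mathcal L_\nu^{-1}\,\pi_\nu(\exp tX)\,\mathcal L_\nu$ on $L^2_\nu(\Omega)$. A vector $f\in L^2_\nu(\Omega)$ is called smooth if $t\mapsto\lambda_\nu(\exp tX)f\in L^2_\nu(\Omega)$ is a smooth curve for every $X\in\mathfrak g$. For such $f$ let $\lambda_\nu(X)f=\frac{d}{dt}\big|_{t=0}\lambda_\nu(\exp tX)f$ (derivative in $L^2_\nu(\Omega)$) for $X\in\mathfrak g$, and extend complex linearly to $X\in\mathfrak g_{\mathbb C}$. For $f:\Omega\to\mathbb C$ let $D_{ij}f$ be the derivative of $f$ in the direction $\frac12(E_{ij}+E_{ji})$, and let $\nabla=(D_{ij})_{i,j}$, a symmetric matrix of differential operators, so that $\operatorname{tr}(\nabla f(x)\,u)=D_uf(x)$ for $u\in J$. In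 an expression such as $\operatorname{tr}[x\nabla a\nabla]f(x)=\sum_{i,j,k,l}x_{ji}\,a_{kl}\,D_{ik}D_{lj}f(x)$ the derivatives act on $f$ only. **Theorem.** Let $f\in L^2_\nu(\Omega)$ be a smooth vector. Then $f$ is (after modification on a null set) a $C^\infty$ function on $\Omega$, and for almost every $x\in\Omega$: 1. $\lambda_\nu(X)f(x)=\operatorname{tr}\big[bx+(xa-ax-\nu b)\nabla-x\nabla b\nabla\big]f(x)$ for $X=\begin{pmatrix}a&b\\ b&a\end{pmatrix}\in\mathfrak k_{\mathbb C}$, that is, for complex $a=-a^t$, $b=b^t$; 2. $\lambda_\nu(X)f(x)=\operatorname{tr}\big[\nu a+ax+(ax+xa+\nu a)\nabla+x\nabla a\nabla\big]f(x)$ for $X=\begin{pmatrix}a&a\\-a&-a\end{pmatrix}\in\mathfrak p^+$, that is, for complex $a=a^t$; 3. $\lambda_\nu(X)f(x)=\operatorname{tr}\big[\nu a-ax+(ax+xa-\nu a)\nabla-x\nabla a\nabla\big]f(x)$ for $X=\begin{pmatrix}a&-a\\ a&-a\end{pmatrix}\in\mathfrak p^-$, that is, for complex $a=a^t$. -/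

import Mathlib

open MeasureTheory Matrix
open scoped ContDiff

noncomputable section

namespace SymCone

/-- Complex `n × n` matrices. -/
abbrev CMat (n : ℕ) := Matrix (Fin n) (Fin n) ℂ

/-- Complex `2n × 2n` matrices, in `n × n` blocks. -/
abbrev CMat2 (n : ℕ) := Matrix (Fin n ⊕ Fin n) (Fin n ⊕ Fin n) ℂ

/-! ### The space of real symmetric matrices and the cone -/

/-- The space `J = Sym(n, ℝ)`. A symmetric matrix `x` is stored through its independent entries,
i.e. as a function on unordered pairs of indices; `mat x` is the matrix itself. As a finite product
of copies of `ℝ` this type carries Lebesgue measure `dx = ∏_{i ≤ j} dx_{ij}`. -/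
abbrev SymMat (n : ℕ) := Sym2 (Fin n) → ℝ

/-- The symmetric matrix with entries `x s(i, j)`. -/
def mat {n : ℕ} (x : SymMat n) : Matrix (Fin n) (Fin n) ℝ := Matrix.of fun i j => x s(i, j)

/-- The same matrix with complex entries. -/
def cmat {n : ℕ} (x : SymMat n) : CMat n := (mat x).map (fun r : ℝ => (r : ℂ))

/-- The symmetric part `(M + Mᵀ)/2` of a real matrix, as an element of `SymMat n`. -/
def symPart {n : ℕ} (M : Matrix (Fin n) (Fin n) ℝ) : SymMat n :=
  fun p => Sym2.lift ⟨fun i j => (M i j + M j i) / 2, fun i j => by ring⟩ p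

theorem mat_symPart {n : ℕ} (M : Matrix (Fin n) (Fin n) ℝ) :
    mat (symPart M) = (1 / 2 : ℝ) • (M + Mᵀ) := by
  ext i j
  simp [mat, symPart]
  ring

theorem mat_transpose {n : ℕ} (x : SymMat n) : (mat x)ᵀ = mat x := by
  ext i j
  simp [mat, Sym2.eq_swap]

/-- `mat` identifies `SymMat n` with the symmetric matrices. -/
theorem existsUnique_mat {n : ℕ} (M : Matrix (Fin n) (Fin n) ℝ) (h : Mᵀ = M) :
    ∃! x : SymMat n, mat x = M := by
  refine ⟨symPart M, ?_, ?_⟩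
  · show mat (symPart M) = M
    rw [mat_symPart, h, ← two_smul ℝ M, smul_smul]
    norm_num
  · rintro y rfl
    ext p
    induction p using Sym2.ind with
    | _ i j =>
      have : y s(j, i) = y s(i, j) := by rw [Sym2.eq_swap]
      simp [symPart, mat, this]

/-- The cone `Ω` of positive definite matrices. -/
def cone (n : ℕ) : Set (SymMat n) := {x | (mat x).PosDef}

/-- The measure `dμ_ν(x) = det(x)^(ν - (n+1)/2) dx` on `Ω`. -/
def mu (n : ℕ) (ν : ℝ) : Measure (SymMat n) :=
  (volume.restrict (cone n)).withDensity
    fun x => ENNReal.ofReal ((mat x).det ^ (ν - ((n : ℝ) + 1) / 2))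

/-- The Hilbert space `L²_ν(Ω) = L²(Ω, dμ_ν)`. -/
abbrev L2 (n : ℕ) (ν : ℝ) := Lp ℂ 2 (mu n ν)

/-! ### The tube domain, the group action and the Lie algebra -/

/-- The tube `T(Ω) = Ω + iJ`: complex symmetric matrices with positive definite real part. -/
def tube (n : ℕ) : Set (CMat n) := {z | zᵀ = z ∧ (z.map Complex.re).PosDef}

/-- The Lie algebra `𝔤 ≅ 𝔰𝔭(n, ℝ)` of the group `G ≅ Sp(n, ℝ)` acting on `T(Ω)` by linear
fractional transformations: block matrices `(a, ib; -ic, -aᵗ)` with `a, b, c` real and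
`b, c` symmetric. -/
def gReal (n : ℕ) : Set (CMat2 n) :=
  {X | ∃ a b c : Matrix (Fin n) (Fin n) ℝ, bᵀ = b ∧ cᵀ = c ∧
    X = fromBlocks (a.map (fun r : ℝ => (r : ℂ))) (Complex.I • b.map (fun r : ℝ => (r : ℂ)))
      (-(Complex.I • c.map (fun r : ℝ => (r : ℂ)))) (-(aᵀ.map (fun r : ℝ => (r : ℂ))))}

/-- `Cz + D` for `g = (A, B; C, D)`; the complex Jacobian of `z ↦ g · z` is
`J(g, z) = det(Cz + D)^(-(n+1))`. -/
def denom {n : ℕ} (g : CMat2 n) (z : CMat n) : CMat n := g.toBlocks₂₁ * z + g.toBlocks₂₂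

/-- The linear fractional action `g · z = (Az + B)(Cz + D)⁻¹`. -/
def act {n : ℕ} (g : CMat2 n) (z : CMat n) : CMat n :=
  (g.toBlocks₁₁ * z + g.toBlocks₁₂) * (denom g z)⁻¹

/-- The matrix `exp(-tX)`. -/
def expNeg {n : ℕ} (X : CMat2 n) (t : ℝ) : CMat2 n := NormedSpace.exp (-((t : ℂ) • X))

/-- `ℓ` is the continuous logarithm, starting at `0`, of `t ↦ det(C_t z + D_t)`, where
`(C_t, D_t)` is the lower block row of `exp(-tX)`. For `z ∈ T(Ω)` and `X ∈ 𝔤` there is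
exactly one; it describes the lift of `t ↦ exp(-tX)` to the universal covering group. -/
def IsLogDenom {n : ℕ} (X : CMat2 n) (z : CMat n) (l : ℝ → ℂ) : Prop :=
  Continuous l ∧ l 0 = 0 ∧ ∀ t, Complex.exp (l t) = (denom (expNeg X t) z).det

/-- The continuous branch of `log det(C_t z + D_t)`. -/
def logDenom {n : ℕ} (X : CMat2 n) (z : CMat n) : ℝ → ℂ := Classical.epsilon (IsLogDenom X z)

/-- `π_ν(exp tX)F(z) = J(exp(-tX), z)^(ν/(n+1)) F(exp(-tX) · z)`, where `exp tX` is taken in the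
universal covering group, so that `J^(ν/(n+1)) = det(C_t z + D_t)^(-ν)` is the branch that
is continuous in `t` and equal to `1` at `t = 0`. -/
def piExp {n : ℕ} (ν : ℝ) (X : CMat2 n) (t : ℝ) (F : CMat n → ℂ) (z : CMat n) : ℂ :=
  Complex.exp (-(ν : ℂ) * logDenom X z t) * F (act (expNeg X t) z)

/-! ### The Laplace transform and the representation `λ_ν = 𝓛_ν⁻¹ π_ν 𝓛_ν` -/

/-- The Laplace transform `𝓛_ν f(z) = ∫_Ω e^{-(z|x)} f(x) dμ_ν(x)`, `(z|x) = tr(zx)`. -/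
def laplace {n : ℕ} {ν : ℝ} (f : L2 n ν) (z : CMat n) : ℂ :=
  ∫ x, Complex.exp (-(z * cmat x).trace) * f x ∂(mu n ν)

/-- `u(t) = λ_ν(exp tX) f` for all `t`, that is, `𝓛_ν (u t) = π_ν(exp tX) (𝓛_ν f)` on `T(Ω)`.
As `𝓛_ν` is injective, `u` is determined by this. -/
def IsOrbit {n : ℕ} {ν : ℝ} (X : CMat2 n) (f : L2 n ν) (u : ℝ → L2 n ν) : Prop :=
  ∀ t : ℝ, Set.EqOn (laplace (u t)) (piExp ν X t (laplace f)) (tube n)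

/-- Smooth vectors `L²_ν(Ω)^∞`: the curve `t ↦ λ_ν(exp tX) f` in the Hilbert space `L²_ν(Ω)` is
smooth for every `X ∈ 𝔤`. -/
def IsSmoothVector {n : ℕ} {ν : ℝ} (f : L2 n ν) : Prop :=
  ∀ X ∈ gReal n, ∃ u : ℝ → L2 n ν, IsOrbit X f u ∧ ContDiff ℝ ∞ u

/-- The curve `t ↦ λ_ν(exp tX) f`. -/
def orbit {n : ℕ} {ν : ℝ} (X : CMat2 n) (f : L2 n ν) : ℝ → L2 n ν :=
  Classical.epsilon (IsOrbit X f)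

/-- The derived representation of `𝔤`: `λ_ν(X) f = d/dt λ_ν(exp tX) f` at `t = 0`, in `L²_ν(Ω)`. -/
def lamReal {n : ℕ} {ν : ℝ} (X : CMat2 n) (f : L2 n ν) : L2 n ν := deriv (orbit X f) 0

/-- The `𝔤`-part `X₁` of `X = X₁ + i X₂ ∈ 𝔤_ℂ`, `X₁, X₂ ∈ 𝔤`. -/
def partOne {n : ℕ} (X : CMat2 n) : CMat2 n :=
  fromBlocks (X.toBlocks₁₁.map fun w => (w.re : ℂ)) (X.toBlocks₁₂.map fun w => Complex.I * w.im)
    (X.toBlocks₂₁.map fun w => Complex.I * w.im) (X.toBlocks₂₂.map fun w => (w.re : ℂ))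

/-- The `𝔤`-part `X₂` of `X = X₁ + i X₂ ∈ 𝔤_ℂ`, `X₁, X₂ ∈ 𝔤`. -/
def partTwo {n : ℕ} (X : CMat2 n) : CMat2 n :=
  fromBlocks (X.toBlocks₁₁.map fun w => (w.im : ℂ)) (X.toBlocks₁₂.map fun w => -Complex.I * w.re)
    (X.toBlocks₂₁.map fun w => -Complex.I * w.re) (X.toBlocks₂₂.map fun w => (w.im : ℂ))

theorem partOne_add_partTwo {n : ℕ} (X : CMat2 n) : partOne X + Complex.I • partTwo X = X := by
  ext i j
  rcases i with i | i <;> rcases j with j | j <;>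
    simp [partOne, partTwo, toBlocks₁₁, toBlocks₁₂, toBlocks₂₁, toBlocks₂₂, Complex.ext_iff]

theorem partOne_mem {n : ℕ} (a b c : CMat n) (hb : bᵀ = b) (hc : cᵀ = c) :
    partOne (fromBlocks a b c (-aᵀ)) ∈ gReal n := by
  refine ⟨a.map Complex.re, b.map Complex.im, -c.map Complex.im, ?_, ?_, ?_⟩
  · rw [← transpose_map, hb]
  · rw [transpose_neg, ← transpose_map, hc]
  · ext i j
    rcases i with i | i <;> rcases j with j | j <;> simp [partOne]

theorem partTwo_mem {n : ℕ} (a b c : CMat n) (hb : bᵀ = b) (hc : cᵀ = c) :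
    partTwo (fromBlocks a b c (-aᵀ)) ∈ gReal n := by
  refine ⟨a.map Complex.im, -b.map Complex.re, c.map Complex.re, ?_, ?_, ?_⟩
  · rw [transpose_neg, ← transpose_map, hb]
  · rw [← transpose_map, hc]
  · ext i j
    rcases i with i | i <;> rcases j with j | j <;> simp [partTwo]

/-- The derived representation of `𝔤_ℂ = 𝔰𝔭(n, ℂ)`, the complex linear extension:
`λ_ν(X₁ + i X₂) f = λ_ν(X₁) f + i λ_ν(X₂) f`. -/
def lam {n : ℕ} {ν : ℝ} (X : CMat2 n) (f : L2 n ν) : L2 n ν :=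
  lamReal (partOne X) f + Complex.I • lamReal (partTwo X) f

/-! ### Differential operators -/

/-- `D_{ij} f(x)`: the derivative of `f` at `x` in the direction `(E_{ij} + E_{ji})/2`. -/
def D {n : ℕ} (i j : Fin n) (f : SymMat n → ℂ) (x : SymMat n) : ℂ :=
  fderiv ℝ f x (symPart (Matrix.single i j 1))

/-- The gradient `∇f(x)`, the symmetric matrix with entries `D_{ij} f(x)`; it is characterized by
`tr(∇f(x) u) = D_u f(x)`. -/
def grad {n : ℕ} (f : SymMat n → ℂ) (x : SymMat n) : CMat n := Matrix.of fun i j => D i j f x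

/-- `∇` applied from the left to a matrix valued function: `(∇M)_{ij} = ∑_k D_{ik} M_{kj}`. -/
def nabla {n : ℕ} (M : SymMat n → CMat n) (x : SymMat n) : CMat n :=
  Matrix.of fun i j => ∑ k, D i k (fun y => M y k j) x

theorem symPart_sum {n : ℕ} (u : SymMat n) :
    ∑ i, ∑ j, mat u j i • symPart (Matrix.single i j (1 : ℝ)) = u := by
  ext p
  induction p using Sym2.ind with
  | _ k l =>
    have h : u s(l, k) = u s(k, l) := by rw [Sym2.eq_swap]
    simp [symPart, mat, Finset.sum_apply, Matrix.single_apply, ite_and, add_div, mul_add,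
      Finset.sum_add_distrib, ite_div, h]
    ring

theorem trace_grad_mul {n : ℕ} (f : SymMat n → ℂ) (x u : SymMat n) :
    (grad f x * cmat u).trace = fderiv ℝ f x u := by
  conv_rhs => rw [← symPart_sum u]
  simp [Matrix.trace, Matrix.mul_apply, grad, cmat, D, mul_comm]

end SymCone

end

open SymCone

/-!
Every element of `𝔤_ℂ` in the theorem is a block matrix `X = (a, b; c, -aᵗ)` with `b`, `c`
symmetric, and the three formulas are instances of one: `λ_ν(X)` is the differential operator
`diffOp = tr[νa + bx + (xa + aᵗx - νc)∇ - x∇c∇]`.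

*Weak form.* For a test function `ψ` one has `∫ ψ λ_ν(X)f dμ_ν = ∫ (dualOp ψ) f dμ_ν`
(`integral_test_mul_deriv_orbit`), `dualOp` being the transposed operator. By Fourier inversion
`ψ` is a superposition of exponentials `e^{-tr(zx)}` with `z = 1 + iy` (`exists_synth`), so that it
suffices to compare Laplace transforms at these points. There the derivative at `t = 0` of
`π_ν(exp tX) 𝓛_ν f (z)`, with its cocycle `det(Cz + D)^(-ν)` and the flow `exp(-tX)·z`, is the
Laplace integral of `f` multiplied by a polynomial symbol in `z` and `x` (`hasDerivAt_piExp`);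
multiplying `e^{-tr(zx)}` by this symbol is applying `dualOp` to it (`synth_symbol`). The same
superposition shows that `𝓛_ν` is injective, so that orbits are unique. All integrals converge
because `e^{-δ tr x}` is integrable for `μ_ν` when `ν > (n - 1)/2` (`integrable_exp_neg_trace`),
by induction on `n`, splitting off one row and column of the matrix.

*Regularity.* Only the block diagonal elements `(α, 0; 0, -αᵗ)` are used. They act on `T(Ω)`
linearly, and the weak form says that `d/dt` along their orbits is transposed to the first order
operator `transOp`, whose principal part is, up to sign, the vector field `xα + αᵗx`. Given a frequency
`ξ₀ ≠ 0`, take `α` to be the symmetric matrix of `ξ₀`: since `tr(α(xα + αx)) = 2 tr(αxα) > 0`, the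
phase of the Fourier transform is not stationary along this field for frequencies near the
direction of `ξ₀`. Integrating by parts repeatedly, each step moving a derivative on to the smooth
orbit, shows that the Fourier transform of a localized smooth vector decays rapidly
(`oscillation_decay`, `fourier_decay`). By Fourier inversion the vector has a smooth representative
(`exists_smooth_representative`).

*Transposition.* With a smooth representative at hand, `dualOp` may be transposed back. Its
terms, apart from `ν tr(c∇)`, are built from the entries of `x∇`, and with respect to `μ_ν` the
transpose of `∑_j x_{ij} D_{jk}` is `-(∑_j x_{ij} D_{jk} + ν δ_{ik})` (`integral_mul_euler`); the
`ν` combines the divergence of the vector field with the logarithmic derivative of the density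
`det(x)^(ν - (n+1)/2)`. Two applications turn `dualOp` into `diffOp` (`integral_mul_dualOp`).
-/

open scoped FourierTransform

noncomputable section

namespace SymCone

/-! ### Coordinates on the cone -/

theorem mat_apply {n : ℕ} (x : SymMat n) (i j : Fin n) : mat x i j = x s(i, j) := rfl

theorem cmat_apply {n : ℕ} (x : SymMat n) (i j : Fin n) : cmat x i j = (x s(i, j) : ℂ) := rfl

theorem trace_mat {n : ℕ} (x : SymMat n) : (mat x).trace = ∑ i, x s(i, i) := rfl

theorem trace_mul_cmat {n : ℕ} (z : CMat n) (x : SymMat n) :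
    (z * cmat x).trace = ∑ i, ∑ j, z i j * (x s(i, j) : ℂ) := by
  simp only [Matrix.trace, Matrix.diag, Matrix.mul_apply, cmat_apply]
  refine Finset.sum_congr rfl fun i _ => Finset.sum_congr rfl fun j _ => ?_
  rw [Sym2.eq_swap]

/-- The quadratic form of a symmetric matrix, written out in entries. -/
theorem mem_cone_iff {n : ℕ} (x : SymMat n) :
    x ∈ cone n ↔ ∀ v : Fin n → ℝ, v ≠ 0 → 0 < ∑ i, ∑ j, v i * x s(i, j) * v j := by
  have key : ∀ v : Fin n → ℝ, star v ⬝ᵥ (mat x).mulVec v = ∑ i, ∑ j, v i * x s(i, j) * v j := by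
    intro v
    simp [dotProduct, Matrix.mulVec, mat_apply, Finset.mul_sum, mul_assoc]
  rw [cone, Set.mem_ofPred_eq, Matrix.posDef_iff_dotProduct_mulVec]
  constructor
  · rintro ⟨-, h⟩ v hv
    rw [← key]; exact h hv
  · intro h
    refine ⟨?_, fun v hv => ?_⟩
    · rw [Matrix.IsHermitian, Matrix.conjTranspose_eq_transpose_of_trivial, mat_transpose]
    · rw [key]; exact h v hv

theorem isOpen_cone (n : ℕ) : IsOpen (cone n) := by
  have h1 : cone n = {x : SymMat n | ∀ v ∈ Metric.sphere (0 : Fin n → ℝ) 1,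
      0 < ∑ i, ∑ j, v i * x s(i, j) * v j} := by
    ext x
    rw [mem_cone_iff]
    constructor
    · intro h v hv
      refine h v ?_
      rintro rfl
      simp at hv
    · intro h v hv
      have hv' : 0 < ‖v‖ := norm_pos_iff.2 hv
      have := h (‖v‖⁻¹ • v) (by
        rw [mem_sphere_zero_iff_norm, norm_smul, norm_inv, norm_norm, inv_mul_cancel₀ hv'.ne'])
      have e : ∑ i, ∑ j, (‖v‖⁻¹ • v) i * x s(i, j) * (‖v‖⁻¹ • v) j
          = ‖v‖⁻¹ ^ 2 * ∑ i, ∑ j, v i * x s(i, j) * v j := by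
        simp only [Finset.mul_sum, Pi.smul_apply, smul_eq_mul]
        refine Finset.sum_congr rfl fun i _ => Finset.sum_congr rfl fun j _ => ?_
        ring
      rw [e] at this
      exact pos_of_mul_pos_right this (by positivity)
  rw [h1, isOpen_iff_eventually]
  intro x hx
  refine IsCompact.eventually_forall_of_forall_eventually (isCompact_sphere _ _) fun v hv => ?_
  have hc : Continuous fun q : SymMat n × (Fin n → ℝ) =>
      ∑ i, ∑ j, q.2 i * q.1 s(i, j) * q.2 j := by fun_prop
  exact hc.continuousAt.eventually (lt_mem_nhds (hx v hv))

theorem measurableSet_cone (n : ℕ) : MeasurableSet (cone n) := (isOpen_cone n).measurableSet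

theorem diag_pos_of_mem_cone {n : ℕ} {x : SymMat n} (hx : x ∈ cone n) (i : Fin n) :
    0 < x s(i, i) := Matrix.PosDef.diag_pos (A := mat x) hx

theorem two_mul_abs_le_of_mem_cone {n : ℕ} {x : SymMat n} (hx : x ∈ cone n) {i j : Fin n}
    (hij : i ≠ j) : 2 * |x s(i, j)| ≤ x s(i, i) + x s(j, j) := by
  have hq := (mem_cone_iff x).1 hx
  have key : ∀ ε : ℝ, 0 < x s(i, i) + 2 * ε * x s(i, j) + ε ^ 2 * x s(j, j) := by
    intro ε
    have h := hq (Pi.single i 1 + ε • Pi.single j 1) (by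
      intro h
      have := congrFun h i
      simp [hij] at this)
    have e : ∑ k, ∑ l, (Pi.single i 1 + ε • Pi.single j 1 : Fin n → ℝ) k * x s(k, l) *
        (Pi.single i 1 + ε • Pi.single j 1 : Fin n → ℝ) l
        = x s(i, i) + 2 * ε * x s(i, j) + ε ^ 2 * x s(j, j) := by
      have : x s(j, i) = x s(i, j) := by rw [Sym2.eq_swap]
      simp [add_mul, mul_add, Finset.sum_add_distrib, Pi.single_apply, this]
      ring
    rwa [e] at h
  have h1 := key 1
  have h2 := key (-1)
  rw [← abs_two, ← abs_mul, abs_le]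
  constructor <;> nlinarith

theorem abs_le_trace_of_mem_cone {n : ℕ} {x : SymMat n} (hx : x ∈ cone n) (p : Sym2 (Fin n)) :
    |x p| ≤ (mat x).trace := by
  induction p using Sym2.ind with
  | _ i j =>
    have hle : ∀ k, x s(k, k) ≤ (mat x).trace := fun k => by
      rw [trace_mat]
      exact Finset.single_le_sum (f := fun i => x s(i, i))
        (fun i _ => (diag_pos_of_mem_cone hx i).le) (Finset.mem_univ k)
    by_cases hij : i = j
    · subst hij
      rw [abs_of_pos (diag_pos_of_mem_cone hx i)]
      exact hle i
    · have := two_mul_abs_le_of_mem_cone hx hij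
      linarith [hle i, hle j]

theorem trace_nonneg_of_mem_cone {n : ℕ} {x : SymMat n} (hx : x ∈ cone n) :
    0 ≤ (mat x).trace := by
  rw [trace_mat]
  exact Finset.sum_nonneg fun i _ => (diag_pos_of_mem_cone hx i).le

theorem norm_le_trace_of_mem_cone {n : ℕ} {x : SymMat n} (hx : x ∈ cone n) :
    ‖x‖ ≤ (mat x).trace :=
  (pi_norm_le_iff_of_nonneg (trace_nonneg_of_mem_cone hx)).2 fun p =>
    abs_le_trace_of_mem_cone hx p

theorem det_pos_of_mem_cone {n : ℕ} {x : SymMat n} (hx : x ∈ cone n) : 0 < (mat x).det :=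
  Matrix.PosDef.det_pos (A := mat x) hx

theorem contDiff_det_mat (n : ℕ) : ContDiff ℝ ∞ fun x : SymMat n => (mat x).det := by
  simp only [Matrix.det_apply, mat_apply]
  fun_prop

theorem continuous_trace_mat (n : ℕ) : Continuous fun x : SymMat n => (mat x).trace := by
  simp only [trace_mat]; fun_prop

theorem measurable_det_mat (n : ℕ) : Measurable fun x : SymMat n => (mat x).det :=
  (contDiff_det_mat n).continuous.measurable

theorem continuous_trace_mul_cmat {n : ℕ} (z : CMat n) :
    Continuous fun x : SymMat n => (z * cmat x).trace := by
  simp only [trace_mul_cmat]; fun_prop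

/-- `tr(z x)` is controlled by the largest entry of `z` and the norm of `x`. -/
theorem norm_trace_mul_cmat_le {n : ℕ} (z : CMat n) (x : SymMat n) {r : ℝ}
    (hz : ∀ i j, ‖z i j‖ ≤ r) : ‖(z * cmat x).trace‖ ≤ (n : ℝ) ^ 2 * r * ‖x‖ := by
  rw [trace_mul_cmat]
  have h : ∀ i j, ‖z i j * (x s(i, j) : ℂ)‖ ≤ r * ‖x‖ := fun i j => by
    rw [norm_mul, Complex.norm_real]
    exact mul_le_mul (hz i j) (norm_le_pi_norm x _) (norm_nonneg _)
      ((norm_nonneg _).trans (hz i j))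
  calc ‖∑ i, ∑ j, z i j * (x s(i, j) : ℂ)‖ ≤ ∑ i : Fin n, ∑ j : Fin n, r * ‖x‖ :=
        (norm_sum_le _ _).trans (Finset.sum_le_sum fun i _ =>
          (norm_sum_le _ _).trans (Finset.sum_le_sum fun j _ => h i j))
    _ = (n : ℝ) ^ 2 * r * ‖x‖ := by simp; ring

/-! ### Integrability of the exponentials -/

/-- Splitting a pair of indices in `{0, …, n}` according to whether it contains `0`. -/
def splitPair (n : ℕ) : (Sym2 (Fin n) ⊕ Fin n) ⊕ Unit → Sym2 (Fin (n + 1))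
  | .inl (.inl p) => p.map Fin.succ
  | .inl (.inr i) => s(0, i.succ)
  | .inr _ => s(0, 0)

theorem splitPair_bijective (n : ℕ) : Function.Bijective (splitPair n) := by
  constructor
  · rintro ((p | i) | u) ((q | j) | v) h
    · simp only [splitPair] at h
      rw [Sym2.map.injective (Fin.succ_injective n) h]
    · exfalso
      induction p using Sym2.ind with
      | _ a b => simp [splitPair, Fin.succ_ne_zero] at h
    · exfalso
      induction p using Sym2.ind with
      | _ a b => simp [splitPair, Fin.succ_ne_zero] at h
    · exfalso
      induction q using Sym2.ind with
      | _ a b => simp [splitPair, (Fin.succ_ne_zero _).symm] at h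
    · simpa [splitPair] using h
    · simp [splitPair, Fin.succ_ne_zero] at h
    · exfalso
      induction q using Sym2.ind with
      | _ a b => simp [splitPair, (Fin.succ_ne_zero _).symm] at h
    · simp [splitPair, (Fin.succ_ne_zero _).symm] at h
    · rfl
  · intro p
    induction p using Sym2.ind with
    | _ a b =>
      refine Fin.cases ?_ (fun i => ?_) a <;> refine Fin.cases ?_ (fun j => ?_) b
      · exact ⟨.inr (), rfl⟩
      · exact ⟨.inl (.inr j), rfl⟩
      · exact ⟨.inl (.inr i), Sym2.eq_swap⟩
      · exact ⟨.inl (.inl s(i, j)), rfl⟩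

/-- The symmetric matrix of size `n + 1` with lower right block `q.1.1` and first row
`(q.2, q.1.2)`. -/
def border (n : ℕ) (q : (SymMat n × (Fin n → ℝ)) × ℝ) : SymMat (n + 1) := fun p =>
  Sum.elim (Sum.elim q.1.1 q.1.2) (fun _ => q.2)
    ((Equiv.ofBijective _ (splitPair_bijective n)).symm p)

theorem border_splitPair {n : ℕ} (q : (SymMat n × (Fin n → ℝ)) × ℝ) (i) :
    border n q (splitPair n i) = Sum.elim (Sum.elim q.1.1 q.1.2) (fun _ => q.2) i := by
  rw [border]
  congr 1
  exact (Equiv.ofBijective _ (splitPair_bijective n)).symm_apply_apply i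

theorem border_zero_zero {n : ℕ} (q : (SymMat n × (Fin n → ℝ)) × ℝ) :
    border n q s(0, 0) = q.2 := border_splitPair q (.inr ())

theorem border_zero_succ {n : ℕ} (q : (SymMat n × (Fin n → ℝ)) × ℝ) (i : Fin n) :
    border n q s(0, i.succ) = q.1.2 i := border_splitPair q (.inl (.inr i))

theorem border_succ_succ {n : ℕ} (q : (SymMat n × (Fin n → ℝ)) × ℝ) (i j : Fin n) :
    border n q s(i.succ, j.succ) = q.1.1 s(i, j) := border_splitPair q (.inl (.inl s(i, j)))

theorem measurePreserving_border (n : ℕ) : MeasurePreserving (border n) := by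
  have h1 := volume_measurePreserving_sumPiEquivProdPi_symm
    (fun _ : Sym2 (Fin n) ⊕ Fin n => ℝ)
  have h2 := (volume_preserving_funUnique Unit ℝ).symm
  have h3 := volume_measurePreserving_sumPiEquivProdPi_symm
    (fun _ : (Sym2 (Fin n) ⊕ Fin n) ⊕ Unit => ℝ)
  have h4 := volume_measurePreserving_piCongrLeft (fun _ : Sym2 (Fin (n + 1)) => ℝ)
    (Equiv.ofBijective _ (splitPair_bijective n))
  have h := h4.comp (h3.comp (h1.prod h2))
  suffices e : border n = (MeasurableEquiv.piCongrLeft (fun _ : Sym2 (Fin (n + 1)) => ℝ)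
      (Equiv.ofBijective _ (splitPair_bijective n))) ∘
      (MeasurableEquiv.sumPiEquivProdPi fun _ : (Sym2 (Fin n) ⊕ Fin n) ⊕ Unit => ℝ).symm ∘
      Prod.map (MeasurableEquiv.sumPiEquivProdPi fun _ : Sym2 (Fin n) ⊕ Fin n => ℝ).symm
        (MeasurableEquiv.funUnique Unit ℝ).symm by
    rw [e]; exact h
  funext q
  funext p
  obtain ⟨i, rfl⟩ := (splitPair_bijective n).2 p
  rw [border_splitPair]
  have : splitPair n i = Equiv.ofBijective _ (splitPair_bijective n) i := rfl
  rw [Function.comp_apply, this, MeasurableEquiv.piCongrLeft_apply_apply]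
  rcases i with (p | j) | u <;> rfl

/-- The determinant of a bordered matrix is an affine function of its corner entry. -/
theorem det_border {n : ℕ} (x : SymMat n) (y : Fin n → ℝ) (r : ℝ) :
    (mat (border n ((x, y), r))).det
      = r * (mat x).det + (mat (border n ((x, y), 0))).det := by
  rw [Matrix.det_succ_row_zero, Matrix.det_succ_row_zero (mat (border n ((x, y), 0))),
    Fin.sum_univ_succ, Fin.sum_univ_succ]
  have h0 : ∀ r, (mat (border n ((x, y), r))).submatrix Fin.succ (Fin.succAbove 0) = mat x := by
    intro r; ext i j
    simp [mat_apply, border_succ_succ]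
  have h1 : ∀ j : Fin n, (mat (border n ((x, y), r))).submatrix Fin.succ (Fin.succAbove j.succ)
      = (mat (border n ((x, y), 0))).submatrix Fin.succ (Fin.succAbove j.succ) := by
    intro j; ext k l
    simp only [submatrix_apply, mat_apply]
    refine Fin.cases ?_ (fun m => ?_) (j.succ.succAbove l)
    · rw [Sym2.eq_swap, border_zero_succ, border_zero_succ]
    · rw [border_succ_succ, border_succ_succ]
  simp only [h0, h1, mat_apply, border_zero_zero, border_zero_succ]
  simp

theorem trace_border {n : ℕ} (x : SymMat n) (y : Fin n → ℝ) (r : ℝ) :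
    (mat (border n ((x, y), r))).trace = r + (mat x).trace := by
  simp [trace_mat, Fin.sum_univ_succ, border_zero_zero, border_succ_succ]

theorem mem_cone_of_border {n : ℕ} {x : SymMat n} {y : Fin n → ℝ} {r : ℝ}
    (h : border n ((x, y), r) ∈ cone (n + 1)) : x ∈ cone n := by
  rw [mem_cone_iff] at h ⊢
  intro v hv
  have := h (Fin.cons 0 v) (by
    intro h0
    apply hv
    funext i
    simpa using congrFun h0 i.succ)
  simpa [Fin.sum_univ_succ, border_succ_succ] using this

theorem integrable_exp_neg_mul_abs {c : ℝ} (hc : 0 < c) :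
    Integrable fun y : ℝ => Real.exp (-(c * |y|)) := by
  rw [← integrableOn_univ, ← Set.Iic_union_Ioi (a := (0 : ℝ))]
  refine IntegrableOn.union ?_ ?_
  · refine (integrableOn_exp_mul_Iic hc 0).congr_fun (fun y hy => ?_) measurableSet_Iic
    simp only
    rw [abs_of_nonpos hy]; ring_nf
  · refine (integrableOn_exp_mul_Ioi (neg_lt_zero.2 hc) 0).congr_fun (fun y hy => ?_)
      measurableSet_Ioi
    simp only
    rw [abs_of_pos hy]; ring_nf

theorem lintegral_rpow_mul_exp_lt_top {s δ : ℝ} (hs : -1 < s) (hδ : 0 < δ) :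
    ∫⁻ r in Set.Ioi (0 : ℝ), ENNReal.ofReal (r ^ s * Real.exp (-(δ * r))) < ⊤ := by
  have h := integrableOn_rpow_mul_exp_neg_mul_rpow hs one_pos hδ
  simp only [Real.rpow_one] at h
  have := h.lintegral_lt_top
  simpa only [neg_mul] using this

/-- Only the part `r > max t 0` of the half line contributes, and there the integrand decreases
when `t` is moved to `0`; this makes the bound uniform in `t`. -/
theorem lintegral_shifted_le {s δ : ℝ} (hs : s ≤ 0) (hδ : 0 < δ) (t : ℝ) :
    ∫⁻ r in Set.Ioi (max t 0), ENNReal.ofReal ((r - t) ^ s * Real.exp (-(δ * r)))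
      ≤ ∫⁻ r in Set.Ioi (0 : ℝ), ENNReal.ofReal (r ^ s * Real.exp (-(δ * r))) := by
  rw [← lintegral_indicator measurableSet_Ioi, ← lintegral_indicator measurableSet_Ioi,
    ← lintegral_sub_right_eq_self
      ((Set.Ioi (0 : ℝ)).indicator fun r => ENNReal.ofReal (r ^ s * Real.exp (-(δ * r))))
      (max t 0)]
  refine lintegral_mono fun r => ?_
  by_cases hr : max t 0 < r
  · have hr' : 0 < r - max t 0 := sub_pos.2 hr
    rw [Set.indicator_of_mem (Set.mem_Ioi.2 hr), Set.indicator_of_mem (Set.mem_Ioi.2 hr')]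
    refine ENNReal.ofReal_le_ofReal ?_
    have h1 : (r - t) ^ s ≤ (r - max t 0) ^ s :=
      Real.rpow_le_rpow_of_nonpos hr' (by linarith [le_max_left t 0]) hs
    have h2 : Real.exp (-(δ * r)) ≤ Real.exp (-(δ * (r - max t 0))) := by
      apply Real.exp_le_exp.2
      nlinarith [le_max_right t 0]
    exact mul_le_mul h1 h2 (Real.exp_nonneg _) (Real.rpow_nonneg hr'.le _)
  · rw [Set.indicator_of_notMem (by simpa using hr)]
    exact zero_le

theorem border_bound {n : ℕ} {s δ : ℝ} (hδ : 0 < δ) (x : SymMat n) (y : Fin n → ℝ)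
    (r : ℝ) :
    (cone (n + 1)).indicator (fun x => ENNReal.ofReal
        ((mat x).det ^ s * Real.exp (-(δ * (mat x).trace)))) (border n ((x, y), r))
      ≤ ((cone n).indicator (fun x => ENNReal.ofReal
        ((mat x).det ^ s * Real.exp (-(δ / 2 * (mat x).trace)))) x
        * ENNReal.ofReal (∏ i, Real.exp (-(δ / (n + 1) * |y i|))))
        * (Set.Ioi (max (-((mat (border n ((x, y), 0))).det / (mat x).det)) 0)).indicator
          (fun r => ENNReal.ofReal ((r - -((mat (border n ((x, y), 0))).det / (mat x).det)) ^ s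
            * Real.exp (-(δ / 2 * r)))) r := by
  by_cases hb : border n ((x, y), r) ∈ cone (n + 1)
  swap
  · rw [Set.indicator_of_notMem hb]; exact zero_le
  have hx := mem_cone_of_border hb
  have hd := det_pos_of_mem_cone hx
  set R := (mat (border n ((x, y), 0))).det with hR
  set d := (mat x).det with hdd
  have hdet : (mat (border n ((x, y), r))).det = d * (r - -(R / d)) := by
    rw [det_border]; field_simp; rw [← hdd, ← hR]; ring
  have hpos := det_pos_of_mem_cone hb
  have hr0 : 0 < r := by
    have := diag_pos_of_mem_cone hb 0
    rwa [border_zero_zero] at this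
  have hrt : -(R / d) < r := by
    rw [hdet] at hpos
    linarith [pos_of_mul_pos_right hpos hd.le]
  have hy : ∀ i, 2 * |y i| ≤ r + (mat x).trace := fun i => by
    have h := two_mul_abs_le_of_mem_cone hb (Fin.succ_ne_zero i).symm
    rw [border_zero_succ, border_zero_zero, border_succ_succ] at h
    have : x s(i, i) ≤ (mat x).trace := by
      rw [trace_mat]
      exact Finset.single_le_sum (f := fun i => x s(i, i))
        (fun i _ => (diag_pos_of_mem_cone hx i).le) (Finset.mem_univ i)
    simp only at h
    linarith
  rw [Set.indicator_of_mem hb, Set.indicator_of_mem hx,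
    Set.indicator_of_mem (Set.mem_Ioi.2 (max_lt hrt hr0)), ← ENNReal.ofReal_mul (by positivity),
    ← ENNReal.ofReal_mul (by positivity)]
  refine ENNReal.ofReal_le_ofReal ?_
  rw [hdet, Real.mul_rpow hd.le (by linarith), trace_border, ← Real.exp_sum]
  have hsum : ∑ i, -(δ / (n + 1) * |y i|) ≥ -(δ / 2 * (r + (mat x).trace)) := by
    have ht : 0 ≤ r + (mat x).trace := add_nonneg hr0.le (trace_nonneg_of_mem_cone hx)
    calc ∑ i, -(δ / (n + 1) * |y i|)
        ≥ ∑ i : Fin n, -(δ / (n + 1) * ((r + (mat x).trace) / 2)) := by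
          refine Finset.sum_le_sum fun i _ => neg_le_neg ?_
          have := hy i
          gcongr
          linarith
      _ = -(δ / 2 * (r + (mat x).trace)) * (n / (n + 1)) := by
          simp; ring
      _ ≥ -(δ / 2 * (r + (mat x).trace)) := by
          have h1 : (n : ℝ) / (n + 1) ≤ 1 := by
            rw [div_le_one (by positivity)]; linarith
          have h2 : 0 ≤ δ / 2 * (r + (mat x).trace) := by positivity
          nlinarith
  have hexp : Real.exp (-(δ * (r + (mat x).trace))) ≤ Real.exp (-(δ / 2 * (mat x).trace))
      * Real.exp (∑ i, -(δ / (n + 1) * |y i|)) * Real.exp (-(δ / 2 * r)) := by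
    rw [← Real.exp_add, ← Real.exp_add]
    apply Real.exp_le_exp.2
    linarith
  have hA : 0 ≤ d ^ s * (r - -(R / d)) ^ s :=
    mul_nonneg (Real.rpow_nonneg hd.le _) (Real.rpow_nonneg (by linarith) _)
  calc d ^ s * (r - -(R / d)) ^ s * Real.exp (-(δ * (r + (mat x).trace)))
      ≤ d ^ s * (r - -(R / d)) ^ s * (Real.exp (-(δ / 2 * (mat x).trace))
      * Real.exp (∑ i, -(δ / (n + 1) * |y i|)) * Real.exp (-(δ / 2 * r))) :=
        mul_le_mul_of_nonneg_left hexp hA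
    _ = _ := by ring

/-- The integral defining the gamma function of the cone converges for exponents in `(-1, 0]`, by
induction on the size of the matrices. -/
theorem lintegral_det_rpow_mul_exp_lt_top {s : ℝ} (hs : -1 < s) (hs0 : s ≤ 0) (n : ℕ) :
    ∀ δ : ℝ, 0 < δ → ∫⁻ x in cone n, ENNReal.ofReal
      ((mat x).det ^ s * Real.exp (-(δ * (mat x).trace))) < ⊤ := by
  have hmeas : ∀ m (δ : ℝ), Measurable fun x : SymMat m => ENNReal.ofReal
      ((mat x).det ^ s * Real.exp (-(δ * (mat x).trace))) := fun m δ =>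
    (((measurable_det_mat m).pow_const s).mul
      (((continuous_trace_mat m).const_mul δ).neg.rexp.measurable)).ennreal_ofReal
  induction n with
  | zero =>
    intro δ hδ
    have : ∀ x : SymMat 0, ENNReal.ofReal
        ((mat x).det ^ s * Real.exp (-(δ * (mat x).trace))) = 1 := by
      intro x
      simp
    simp only [this]
    rw [lintegral_one, Measure.restrict_apply_univ]
    exact (measure_mono (Set.subset_univ _)).trans_lt isCompact_univ.measure_lt_top
  | succ n ih =>
    intro δ hδ
    rw [← lintegral_indicator (measurableSet_cone _),
      ← (measurePreserving_border n).lintegral_comp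
        ((hmeas _ _).indicator (measurableSet_cone _)),
      Measure.volume_eq_prod, lintegral_prod (fun q => (cone (n + 1)).indicator (fun x =>
        ENNReal.ofReal ((mat x).det ^ s * Real.exp (-(δ * (mat x).trace)))) (border n q))
        (((hmeas _ _).indicator
        (measurableSet_cone _)).comp (measurePreserving_border n).measurable).aemeasurable]
    set C := ∫⁻ r in Set.Ioi (0 : ℝ), ENNReal.ofReal (r ^ s * Real.exp (-(δ / 2 * r))) with hC
    have hCfin : C < ⊤ := lintegral_rpow_mul_exp_lt_top hs (half_pos hδ)
    calc _ ≤ ∫⁻ q : SymMat n × (Fin n → ℝ), ((cone n).indicator (fun x => ENNReal.ofReal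
        ((mat x).det ^ s * Real.exp (-(δ / 2 * (mat x).trace)))) q.1
        * ENNReal.ofReal (∏ i, Real.exp (-(δ / (n + 1) * |q.2 i|)))) * C := by
          refine lintegral_mono fun q => ?_
          obtain ⟨x, y⟩ := q
          refine (lintegral_mono fun r => border_bound hδ x y r).trans ?_
          rw [lintegral_const_mul']
          · refine mul_le_mul_right ?_ _
            rw [lintegral_indicator measurableSet_Ioi]
            exact lintegral_shifted_le hs0 (half_pos hδ) _
          · refine ENNReal.mul_ne_top ?_ ENNReal.ofReal_ne_top
            by_cases hx : x ∈ cone n <;> simp [hx]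
      _ < ⊤ := by
          rw [lintegral_mul_const' _ _ hCfin.ne]
          refine ENNReal.mul_lt_top ?_ hCfin
          rw [Measure.volume_eq_prod, lintegral_prod_mul
            (g := fun y : Fin n → ℝ => ENNReal.ofReal (∏ i, Real.exp (-(δ / (n + 1) * |y i|))))
            (((hmeas _ _).indicator (measurableSet_cone _)).aemeasurable)]
          · refine ENNReal.mul_lt_top ?_ ?_
            · rw [lintegral_indicator (measurableSet_cone _)]
              exact ih _ (half_pos hδ)
            · refine Integrable.lintegral_lt_top ?_
              exact Integrable.fintype_prod (f := fun _ (y : ℝ) =>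
                Real.exp (-(δ / (n + 1) * |y|))) fun i =>
                integrable_exp_neg_mul_abs (by positivity)
          · exact Measurable.aemeasurable (by fun_prop)

theorem ae_mem_cone (n : ℕ) (ν : ℝ) : ∀ᵐ x ∂(mu n ν), x ∈ cone n :=
  (withDensity_absolutelyContinuous _ _).ae_le (ae_restrict_mem (measurableSet_cone n))

theorem measurable_density (n : ℕ) (s : ℝ) :
    Measurable fun x : SymMat n => ENNReal.ofReal ((mat x).det ^ s) :=
  ((measurable_det_mat n).pow_const s).ennreal_ofReal

/-- For positive exponents the power of the determinant is absorbed by half of the exponential. -/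
theorem det_rpow_mul_exp_le {s δ : ℝ} (hs : 0 < s) (hδ : 0 < δ) (n : ℕ) :
    ∃ C : ℝ, 0 ≤ C ∧ ∀ x ∈ cone n, (mat x).det ^ s * Real.exp (-(δ * (mat x).trace))
      ≤ C * Real.exp (-(δ / 2 * (mat x).trace)) := by
  set c : ℝ := δ / (2 * (n * s + 1)) with hc
  have hns : 0 ≤ n * s := by positivity
  have hc0 : 0 < c := by positivity
  refine ⟨((n.factorial : ℝ) * (c⁻¹) ^ n) ^ s, by positivity, fun x hx => ?_⟩
  set t := (mat x).trace with ht
  have ht0 : 0 ≤ t := trace_nonneg_of_mem_cone hx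
  have h1 : (mat x).det ≤ n.factorial * (c⁻¹) ^ n * Real.exp (c * n * t) := by
    have h := Matrix.det_le (A := mat x) (abv := AbsoluteValue.abs) (x := t)
      (fun i j => abs_le_trace_of_mem_cone hx s(i, j))
    have h2 : t ≤ c⁻¹ * Real.exp (c * t) := by
      have := Real.add_one_le_exp (c * t)
      rw [inv_mul_eq_div, le_div_iff₀ hc0]
      linarith
    calc (mat x).det ≤ |(mat x).det| := le_abs_self _
      _ ≤ n.factorial * t ^ n := by simpa using h
      _ ≤ n.factorial * (c⁻¹ * Real.exp (c * t)) ^ n := by gcongr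
      _ = _ := by rw [mul_pow, ← Real.exp_nat_mul]; ring_nf
  have hd := det_pos_of_mem_cone hx
  calc (mat x).det ^ s * Real.exp (-(δ * t))
      ≤ (n.factorial * (c⁻¹) ^ n * Real.exp (c * n * t)) ^ s * Real.exp (-(δ * t)) := by
        gcongr
    _ = (n.factorial * (c⁻¹) ^ n) ^ s * Real.exp (c * n * s * t - δ * t) := by
        rw [Real.mul_rpow (by positivity) (by positivity), ← Real.exp_mul, mul_assoc,
          ← Real.exp_add]
        ring_nf
    _ ≤ _ := by
        refine mul_le_mul_of_nonneg_left (Real.exp_le_exp.2 ?_) (by positivity)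
        have : c * (n * s) ≤ δ / 2 := by
          rw [hc, div_mul_eq_mul_div, div_le_div_iff₀ (by positivity) two_pos]
          nlinarith
        nlinarith

theorem integrable_exp_neg_trace {n : ℕ} {ν : ℝ} (hν : ((n : ℝ) - 1) / 2 < ν) {δ : ℝ}
    (hδ : 0 < δ) : Integrable (fun x => Real.exp (-(δ * (mat x).trace))) (mu n ν) := by
  have hm : Measurable fun x : SymMat n => Real.exp (-(δ * (mat x).trace)) :=
    (((continuous_trace_mat n).const_mul δ).neg.rexp.measurable)
  refine ⟨hm.aestronglyMeasurable, ?_⟩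
  rw [hasFiniteIntegral_iff_ofReal (Filter.Eventually.of_forall fun x => (Real.exp_nonneg _)),
    mu, lintegral_withDensity_eq_lintegral_mul _ (measurable_density n _) hm.ennreal_ofReal]
  set s := ν - ((n : ℝ) + 1) / 2 with hsd
  have hs : -1 < s := by rw [hsd]; linarith
  have e : ∀ (s δ : ℝ), ∫⁻ x in cone n,
      ((fun x => ENNReal.ofReal ((mat x).det ^ s) : SymMat n → ENNReal) *
      (fun x => ENNReal.ofReal (Real.exp (-(δ * (mat x).trace))) : SymMat n → ENNReal)) x
      = ∫⁻ x in cone n, ENNReal.ofReal ((mat x).det ^ s * Real.exp (-(δ * (mat x).trace))) := by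
    intro s δ
    refine setLIntegral_congr_fun (measurableSet_cone n) fun x hx => ?_
    rw [ENNReal.ofReal_mul (Real.rpow_nonneg (det_pos_of_mem_cone hx).le _)]
    rfl
  rw [e]
  rcases le_or_gt s 0 with hs0 | hs0
  · exact lintegral_det_rpow_mul_exp_lt_top hs hs0 n δ hδ
  · obtain ⟨C, hC, hCx⟩ := det_rpow_mul_exp_le hs0 hδ n
    refine (setLIntegral_mono_ae (g := fun x => ENNReal.ofReal C *
      ENNReal.ofReal ((mat x).det ^ (0 : ℝ) * Real.exp (-(δ / 2 * (mat x).trace)))) ?_ ?_).trans_lt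
      ?_
    · exact (((measurable_det_mat n).pow_const _).mul
        ((continuous_trace_mat n).const_mul _).neg.rexp.measurable).ennreal_ofReal.aemeasurable
          |>.const_mul _
    · refine Filter.Eventually.of_forall fun x hx => ?_
      rw [← ENNReal.ofReal_mul hC, Real.rpow_zero, one_mul]
      exact ENNReal.ofReal_le_ofReal (hCx x hx)
    · rw [lintegral_const_mul' _ _ ENNReal.ofReal_ne_top]
      exact ENNReal.mul_lt_top ENNReal.ofReal_lt_top
        (lintegral_det_rpow_mul_exp_lt_top (by norm_num) le_rfl n _ (half_pos hδ))

/-! ### Pairings on the Hilbert space -/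

instance sigmaFinite_mu (n : ℕ) (ν : ℝ) : SigmaFinite (mu n ν) :=
  SigmaFinite.withDensity_of_ne_top (Filter.Eventually.of_forall fun _ => ENNReal.ofReal_ne_top)

/-- A function that decays exponentially on the cone is square integrable. -/
theorem memLp_of_norm_le_exp {n : ℕ} {ν : ℝ} (hν : ((n : ℝ) - 1) / 2 < ν) {g : SymMat n → ℂ}
    (hg : AEStronglyMeasurable g (mu n ν)) {C δ : ℝ} (hδ : 0 < δ)
    (h : ∀ x ∈ cone n, ‖g x‖ ≤ C * Real.exp (-(δ * (mat x).trace))) : MemLp g 2 (mu n ν) := by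
  have h2 : MemLp (fun x : SymMat n => Real.exp (-(δ * (mat x).trace))) 2 (mu n ν) := by
    have hm : Continuous fun x : SymMat n => Real.exp (-(δ * (mat x).trace)) :=
      ((continuous_trace_mat n).const_mul δ).neg.rexp
    rw [memLp_two_iff_integrable_sq hm.aestronglyMeasurable]
    refine (integrable_exp_neg_trace hν (mul_pos two_pos hδ)).congr
      (Filter.Eventually.of_forall fun x => ?_)
    simp only
    rw [← Real.exp_nat_mul]
    push_cast
    ring_nf
  refine h2.of_le_mul (c := C) hg ?_
  filter_upwards [ae_mem_cone n ν] with x hx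
  rw [Real.norm_of_nonneg (Real.exp_nonneg _)]
  exact h x hx

theorem memLp_of_hasCompactSupport {n : ℕ} {ν : ℝ} (hν : ((n : ℝ) - 1) / 2 < ν)
    {g : SymMat n → ℂ} (hg : Continuous g) (hc : HasCompactSupport g) : MemLp g 2 (mu n ν) := by
  have h1 : Continuous fun x => g x * (Real.exp ((mat x).trace) : ℂ) :=
    hg.mul (Complex.continuous_ofReal.comp (continuous_trace_mat n).rexp)
  obtain ⟨C, hC⟩ := h1.bounded_above_of_compact_support hc.mul_right
  refine memLp_of_norm_le_exp hν hg.aestronglyMeasurable one_pos (C := C) fun x _ => ?_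
  have := hC x
  rw [norm_mul, Complex.norm_real, Real.norm_of_nonneg (Real.exp_nonneg _)] at this
  rwa [one_mul, Real.exp_neg, ← div_eq_mul_inv, le_div_iff₀ (Real.exp_pos _)]

theorem norm_mul_exp_le {n : ℕ} {δ : ℝ} (hδ : 0 < δ) {x : SymMat n} (hx : x ∈ cone n) :
    ‖x‖ * Real.exp (-(δ * (mat x).trace)) ≤ 2 / δ * Real.exp (-(δ / 2 * (mat x).trace)) := by
  have h1 := norm_le_trace_of_mem_cone hx
  have h2 : (mat x).trace ≤ 2 / δ * Real.exp (δ / 2 * (mat x).trace) := by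
    have := Real.add_one_le_exp (δ / 2 * (mat x).trace)
    rw [div_mul_eq_mul_div, le_div_iff₀ hδ]
    linarith
  calc ‖x‖ * Real.exp (-(δ * (mat x).trace))
      ≤ 2 / δ * Real.exp (δ / 2 * (mat x).trace) * Real.exp (-(δ * (mat x).trace)) :=
        mul_le_mul_of_nonneg_right (h1.trans h2) (Real.exp_nonneg _)
    _ = _ := by
        rw [mul_assoc, ← Real.exp_add]; ring_nf

/-- The complex bilinear pairing `h ↦ ∫ g h dμ_ν` with a square integrable function `g`. -/
def pairing {n : ℕ} {ν : ℝ} {g : SymMat n → ℂ} (hg : MemLp g 2 (mu n ν)) : L2 n ν →L[ℂ] ℂ :=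
  innerSL ℂ hg.star.toLp

theorem pairing_apply {n : ℕ} {ν : ℝ} {g : SymMat n → ℂ} (hg : MemLp g 2 (mu n ν))
    (h : L2 n ν) : pairing hg h = ∫ x, g x * h x ∂(mu n ν) := by
  rw [pairing, innerSL_apply_apply, L2.inner_def]
  refine integral_congr_ae ?_
  filter_upwards [hg.star.coeFn_toLp] with x hx
  rw [hx]
  simp [mul_comm]

theorem integrable_mul_L2 {n : ℕ} {ν : ℝ} {g : SymMat n → ℂ} (hg : MemLp g 2 (mu n ν))
    (h : L2 n ν) : Integrable (fun x => g x * h x) (mu n ν) :=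
  hg.integrable_mul (Lp.memLp h)

theorem hasDerivAt_integral_mul {n : ℕ} {ν : ℝ} {g : SymMat n → ℂ} (hg : MemLp g 2 (mu n ν))
    {u : ℝ → L2 n ν} {u' : L2 n ν} {t : ℝ} (hu : HasDerivAt u u' t) :
    HasDerivAt (fun t => ∫ x, g x * u t x ∂(mu n ν)) (∫ x, g x * u' x ∂(mu n ν)) t := by
  have := ((pairing hg).restrictScalars ℝ).hasFDerivAt.comp_hasDerivAt t hu
  simpa only [Function.comp_def, ContinuousLinearMap.coe_restrictScalars', pairing_apply]
    using this

/-- `|e^{-tr(zx)}| ≤ e^{-δ tr x}` as soon as `Re tr(zx) ≥ δ tr x`. -/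
theorem norm_exp_neg_le {n : ℕ} {z : CMat n} {δ : ℝ} {x : SymMat n}
    (h : δ * (mat x).trace ≤ (z * cmat x).trace.re) :
    ‖Complex.exp (-(z * cmat x).trace)‖ ≤ Real.exp (-(δ * (mat x).trace)) := by
  rw [Complex.norm_exp, Complex.neg_re]
  exact Real.exp_le_exp.2 (neg_le_neg h)

theorem continuous_exp_neg {n : ℕ} (z : CMat n) :
    Continuous fun x : SymMat n => Complex.exp (-(z * cmat x).trace) :=
  (continuous_trace_mul_cmat z).neg.cexp

theorem memLp_exp_neg {n : ℕ} {ν : ℝ} (hν : ((n : ℝ) - 1) / 2 < ν) {z : CMat n} {δ : ℝ}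
    (hδ : 0 < δ) (h : ∀ x ∈ cone n, δ * (mat x).trace ≤ (z * cmat x).trace.re) :
    MemLp (fun x => Complex.exp (-(z * cmat x).trace)) 2 (mu n ν) :=
  memLp_of_norm_le_exp hν (continuous_exp_neg z).aestronglyMeasurable hδ (C := 1) fun x hx => by
    rw [one_mul]; exact norm_exp_neg_le (h x hx)

theorem memLp_norm_mul_exp {n : ℕ} {ν : ℝ} (hν : ((n : ℝ) - 1) / 2 < ν) {δ : ℝ}
    (hδ : 0 < δ) :
    MemLp (fun x : SymMat n => ((‖x‖ * Real.exp (-(δ * (mat x).trace)) : ℝ) : ℂ)) 2 (mu n ν) := by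
  refine memLp_of_norm_le_exp hν (δ := δ / 2) (C := 2 / δ) ?_ (half_pos hδ) fun x hx => ?_
  · refine Continuous.aestronglyMeasurable (Complex.continuous_ofReal.comp ?_)
    exact continuous_norm.mul ((continuous_trace_mat n).const_mul δ).neg.rexp
  · rw [Complex.norm_real, Real.norm_of_nonneg (by positivity)]
    exact norm_mul_exp_le hδ hx

/-- Test functions: smooth complex functions of compact support on the space of symmetric
matrices. -/
def IsTest {n : ℕ} (ψ : SymMat n → ℂ) : Prop := ContDiff ℝ ∞ ψ ∧ HasCompactSupport ψ

theorem IsTest.memLp {n : ℕ} {ν : ℝ} (hν : ((n : ℝ) - 1) / 2 < ν) {ψ : SymMat n → ℂ}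
    (hψ : IsTest ψ) : MemLp ψ 2 (mu n ν) :=
  memLp_of_hasCompactSupport hν hψ.1.continuous hψ.2

/-- An element of `L²_ν(Ω)` is locally integrable on the whole space of symmetric matrices. -/
theorem locallyIntegrable_L2 {n : ℕ} {ν : ℝ} (hν : ((n : ℝ) - 1) / 2 < ν) (h : L2 n ν) :
    LocallyIntegrable h (mu n ν) := by
  have hE : Continuous fun x : SymMat n => (Real.exp ((mat x).trace) : ℂ) :=
    Complex.continuous_ofReal.comp (continuous_trace_mat n).rexp
  have hm : MemLp (fun x : SymMat n => ((Real.exp (-(1 * (mat x).trace)) : ℝ) : ℂ)) 2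
      (mu n ν) := by
    refine memLp_of_norm_le_exp hν (δ := 1) (C := 1) ?_ one_pos fun x hx => ?_
    · exact (Complex.continuous_ofReal.comp
        ((continuous_trace_mat n).const_mul 1).neg.rexp).aestronglyMeasurable
    · rw [Complex.norm_real, Real.norm_of_nonneg (Real.exp_nonneg _)]
      exact (one_mul _).ge
  have := (integrable_mul_L2 hm h).locallyIntegrable
  have h2 := this.continuous_smul (g := fun x => (Real.exp ((mat x).trace) : ℂ)) hE
  refine h2.congr (Filter.Eventually.of_forall fun x => ?_)
  simp only [smul_eq_mul]
  rw [← mul_assoc, ← Complex.ofReal_mul, ← Real.exp_add]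
  simp

/-- An element of `L²_ν(Ω)` is zero when its integrals against all test functions vanish. -/
theorem L2_eq_of_integral_eq {n : ℕ} {ν : ℝ} (hν : ((n : ℝ) - 1) / 2 < ν) {g h : L2 n ν}
    (H : ∀ ψ : SymMat n → ℂ, IsTest ψ →
      ∫ x, ψ x * g x ∂(mu n ν) = ∫ x, ψ x * h x ∂(mu n ν)) : g = h := by
  refine Lp.ext ?_
  refine ae_eq_of_integral_contDiff_smul_eq (locallyIntegrable_L2 hν g)
    (locallyIntegrable_L2 hν h) fun φ hφ hc => ?_
  have := H (fun x => (φ x : ℂ)) ⟨Complex.ofRealCLM.contDiff.comp hφ,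
    hc.comp_left Complex.ofReal_zero⟩
  simpa [Complex.real_smul] using this

/-! ### Test functions as superpositions of exponentials -/

/-- The space dual to `SymMat n` under the coordinate pairing, with its Euclidean structure. -/
abbrev Freq (n : ℕ) := EuclideanSpace ℝ (Sym2 (Fin n))

/-- The symmetric matrix `Y(ξ)` with `tr(Y(ξ) x) = -2π ∑ ξ_p x_p`. -/
def freqMat {n : ℕ} : Freq n →L[ℝ] SymMat n :=
  ∑ p : Sym2 (Fin n), ((-(2 * Real.pi)) • (EuclideanSpace.proj p : Freq n →L[ℝ] ℝ)).smulRight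
    (symPart (Matrix.single (Quot.out p).1 (Quot.out p).2 (1 : ℝ)))

theorem trace_mul_cmat_symPart {n : ℕ} (z : CMat n) (hz : zᵀ = z) (i j : Fin n) :
    (z * cmat (symPart (Matrix.single i j (1 : ℝ)))).trace = z i j := by
  have hz' : ∀ k l, z k l = z l k := fun k l => by rw [← hz, transpose_apply, hz]
  rw [trace_mul_cmat]
  simp only [symPart, Sym2.lift_mk, Matrix.single_apply, ite_and]
  simp [apply_ite Complex.ofReal, add_div, mul_add, Finset.sum_add_distrib, ite_div]
  rw [hz' j i]
  ring

theorem cmat_transpose {n : ℕ} (x : SymMat n) : (cmat x)ᵀ = cmat x := by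
  rw [cmat, ← transpose_map, mat_transpose]

theorem cmat_add {n : ℕ} (x y : SymMat n) : cmat (x + y) = cmat x + cmat y := by
  ext i j; simp [cmat_apply]

theorem cmat_smul {n : ℕ} (r : ℝ) (x : SymMat n) : cmat (r • x) = (r : ℂ) • cmat x := by
  ext i j; simp [cmat_apply]

theorem cmat_sum {n : ℕ} {ι : Type*} (s : Finset ι) (x : ι → SymMat n) :
    cmat (∑ i ∈ s, x i) = ∑ i ∈ s, cmat (x i) := by
  ext i j; simp [cmat_apply, Finset.sum_apply, Matrix.sum_apply]

theorem trace_freqMat_mul {n : ℕ} (ξ : Freq n) (x : SymMat n) :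
    (cmat (freqMat ξ) * cmat x).trace = ((-(2 * Real.pi * ∑ p, ξ p * x p) : ℝ) : ℂ) := by
  have h : freqMat ξ = ∑ p, (-(2 * Real.pi) * ξ p) •
      symPart (Matrix.single (Quot.out p).1 (Quot.out p).2 (1 : ℝ)) := by
    simp [freqMat]
  rw [h, cmat_sum, Finset.sum_mul, trace_sum, Finset.mul_sum, ← Finset.sum_neg_distrib,
    Complex.ofReal_sum]
  refine Finset.sum_congr rfl fun p _ => ?_
  have hp : s((Quot.out p).1, (Quot.out p).2) = p := Quot.out_eq p
  rw [cmat_smul, smul_mul_assoc, trace_smul, trace_mul_comm,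
    trace_mul_cmat_symPart _ (cmat_transpose x), cmat_apply, hp]
  push_cast
  simp
  ring

/-- The points `1 + i Y(ξ)` of the tube domain. -/
def zpt {n : ℕ} (ξ : Freq n) : CMat n := 1 + Complex.I • cmat (freqMat ξ)

theorem zpt_transpose {n : ℕ} (ξ : Freq n) : (zpt ξ)ᵀ = zpt ξ := by
  rw [zpt, transpose_add, transpose_smul, transpose_one, cmat_transpose]

theorem trace_zpt_mul {n : ℕ} (ξ : Freq n) (x : SymMat n) :
    (zpt ξ * cmat x).trace
      = ((mat x).trace : ℂ) + Complex.I * ((-(2 * Real.pi * ∑ p, ξ p * x p) : ℝ) : ℂ) := by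
  rw [zpt, add_mul, trace_add, one_mul, smul_mul_assoc, trace_smul, trace_freqMat_mul]
  congr 1
  simp [Matrix.trace, cmat_apply, mat_apply]

theorem re_trace_zpt_mul {n : ℕ} (ξ : Freq n) (x : SymMat n) :
    (zpt ξ * cmat x).trace.re = (mat x).trace := by
  rw [trace_zpt_mul, Complex.add_re, Complex.re_mul_ofReal]
  simp

theorem zpt_mem_tube {n : ℕ} (ξ : Freq n) : zpt ξ ∈ tube n := by
  refine ⟨zpt_transpose ξ, ?_⟩
  have : (zpt ξ).map Complex.re = 1 := by
    ext i j
    simp [zpt, cmat_apply, Matrix.one_apply]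
    split_ifs <;> simp
  rw [this]
  exact Matrix.PosDef.one

theorem norm_exp_zpt {n : ℕ} (ξ : Freq n) (x : SymMat n) :
    ‖Complex.exp (-(zpt ξ * cmat x).trace)‖ = Real.exp (-(mat x).trace) := by
  rw [Complex.norm_exp, Complex.neg_re, re_trace_zpt_mul]

theorem memLp_exp_zpt {n : ℕ} {ν : ℝ} (hν : ((n : ℝ) - 1) / 2 < ν) (ξ : Freq n) :
    MemLp (fun x => Complex.exp (-(zpt ξ * cmat x).trace)) 2 (mu n ν) :=
  memLp_exp_neg hν one_pos fun x _ => by rw [re_trace_zpt_mul, one_mul]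

theorem continuous_zpt_apply {n : ℕ} (i j : Fin n) :
    Continuous fun ξ : Freq n => zpt ξ i j := by
  simp only [zpt, Matrix.add_apply, Matrix.smul_apply, cmat_apply]
  have : Continuous fun ξ : Freq n => (freqMat ξ) s(i, j) :=
    (continuous_apply _).comp freqMat.continuous
  fun_prop

theorem norm_zpt_apply_le {n : ℕ} (ξ : Freq n) (i j : Fin n) :
    ‖zpt ξ i j‖ ≤ (1 + ‖(freqMat : Freq n →L[ℝ] SymMat n)‖) * (1 + ‖ξ‖) := by
  have h1 : ‖(1 : CMat n) i j‖ ≤ 1 := by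
    rw [Matrix.one_apply]; split_ifs <;> simp
  have h2 : ‖Complex.I • cmat (freqMat ξ) i j‖ ≤ ‖(freqMat : Freq n →L[ℝ] SymMat n)‖ * ‖ξ‖ := by
    rw [norm_smul, Complex.norm_I, one_mul, cmat_apply, Complex.norm_real]
    exact (norm_le_pi_norm _ _).trans (freqMat.le_opNorm ξ)
  refine (norm_add_le _ _).trans ?_
  have := norm_nonneg (freqMat : Freq n →L[ℝ] SymMat n)
  have := norm_nonneg ξ
  calc _ ≤ 1 + ‖(freqMat : Freq n →L[ℝ] SymMat n)‖ * ‖ξ‖ := add_le_add h1 h2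
    _ ≤ _ := by nlinarith

/-- Continuous functions on the dual space all of whose moments are finite. -/
def IsRapid {n : ℕ} (ρ : Freq n → ℂ) : Prop :=
  Continuous ρ ∧ ∀ k : ℕ, Integrable fun ξ => ‖ξ‖ ^ k * ‖ρ ξ‖

theorem IsRapid.integrable {n : ℕ} {ρ : Freq n → ℂ} (h : IsRapid ρ) : Integrable ρ := by
  have := h.2 0
  simp only [pow_zero, one_mul] at this
  exact (integrable_norm_iff h.1.aestronglyMeasurable).1 this

theorem IsRapid.mul {n : ℕ} {ρ p : Freq n → ℂ} (h : IsRapid ρ) (hp : Continuous p) {C : ℝ}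
    {m : ℕ} (hb : ∀ ξ, ‖p ξ‖ ≤ C * (1 + ‖ξ‖) ^ m) : IsRapid fun ξ => p ξ * ρ ξ := by
  refine ⟨hp.mul h.1, fun k => ?_⟩
  have h1 : Integrable fun ξ : Freq n => C * ((1 + ‖ξ‖) ^ m * (‖ξ‖ ^ k * ‖ρ ξ‖)) := by
    refine Integrable.const_mul ?_ C
    have : ∀ ξ : Freq n, (1 + ‖ξ‖) ^ m * (‖ξ‖ ^ k * ‖ρ ξ‖)
        = ∑ i ∈ Finset.range (m + 1), (m.choose i : ℝ) * (‖ξ‖ ^ (m - i + k) * ‖ρ ξ‖) := by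
      intro ξ
      rw [add_pow, Finset.sum_mul]
      refine Finset.sum_congr rfl fun i _ => ?_
      rw [one_pow, one_mul, pow_add]
      ring
    simp only [this]
    exact integrable_finsetSum _ fun i _ => (h.2 _).const_mul _
  refine h1.mono' ?_ (Filter.Eventually.of_forall fun ξ => ?_)
  · exact ((continuous_norm.pow k).mul (hp.mul h.1).norm).aestronglyMeasurable
  · rw [Real.norm_of_nonneg (by positivity), norm_mul]
    calc ‖ξ‖ ^ k * (‖p ξ‖ * ‖ρ ξ‖) ≤ ‖ξ‖ ^ k * ((C * (1 + ‖ξ‖) ^ m) * ‖ρ ξ‖) := by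
          gcongr; exact hb ξ
      _ = _ := by ring

theorem IsRapid.zpt_mul {n : ℕ} {ρ : Freq n → ℂ} (h : IsRapid ρ) (i j : Fin n) :
    IsRapid fun ξ => zpt ξ i j * ρ ξ :=
  h.mul (continuous_zpt_apply i j) (m := 1) fun ξ => by
    rw [pow_one]; exact norm_zpt_apply_le ξ i j

theorem IsRapid.const_mul {n : ℕ} {ρ : Freq n → ℂ} (h : IsRapid ρ) (c : ℂ) :
    IsRapid fun ξ => c * ρ ξ :=
  h.mul continuous_const (m := 0) (C := ‖c‖) fun ξ => by simp

theorem IsRapid.sum {n : ℕ} {ι : Type*} (s : Finset ι) {ρ : ι → Freq n → ℂ}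
    (h : ∀ i ∈ s, IsRapid (ρ i)) : IsRapid fun ξ => ∑ i ∈ s, ρ i ξ := by
  have hc : Continuous fun ξ => ∑ i ∈ s, ρ i ξ := continuous_finsetSum _ fun i hi => (h i hi).1
  refine ⟨hc, fun k => ?_⟩
  refine (integrable_finsetSum s fun i hi => (h i hi).2 k).mono'
    ((continuous_norm.pow k).mul hc.norm).aestronglyMeasurable
    (Filter.Eventually.of_forall fun ξ => ?_)
  rw [Real.norm_of_nonneg (by positivity), ← Finset.mul_sum]
  exact mul_le_mul_of_nonneg_left (norm_sum_le _ _) (by positivity)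

theorem IsRapid.add {n : ℕ} {ρ σ : Freq n → ℂ} (h : IsRapid ρ) (h' : IsRapid σ) :
    IsRapid fun ξ => ρ ξ + σ ξ := by
  have := IsRapid.sum (Finset.univ : Finset (Fin 2)) (ρ := ![ρ, σ]) (by
    intro i _; fin_cases i <;> assumption)
  simpa [Fin.sum_univ_two] using this

/-- The superposition `∫ ρ(ξ) e^{-tr(z_ξ x)} dξ` of exponentials. -/
def synth {n : ℕ} (ρ : Freq n → ℂ) (x : SymMat n) : ℂ :=
  ∫ ξ, ρ ξ * Complex.exp (-(zpt ξ * cmat x).trace)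

theorem continuous_exp_zpt_prod {n : ℕ} :
    Continuous fun q : Freq n × SymMat n => Complex.exp (-(zpt q.1 * cmat q.2).trace) := by
  simp only [trace_mul_cmat]
  have : ∀ i j, Continuous fun q : Freq n × SymMat n => zpt q.1 i j := fun i j =>
    (continuous_zpt_apply i j).comp continuous_fst
  fun_prop

theorem IsRapid.integrable_synth {n : ℕ} {ρ : Freq n → ℂ} (h : IsRapid ρ) (x : SymMat n) :
    Integrable fun ξ => ρ ξ * Complex.exp (-(zpt ξ * cmat x).trace) := by
  refine h.integrable.mul_bdd (c := Real.exp (-(mat x).trace)) ?_ ?_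
  · exact (continuous_exp_zpt_prod.comp (Continuous.prodMk_left x)).aestronglyMeasurable
  · exact Filter.Eventually.of_forall fun ξ => (norm_exp_zpt ξ x).le

theorem synth_sum {n : ℕ} {ι : Type*} (s : Finset ι) {ρ : ι → Freq n → ℂ}
    (h : ∀ i ∈ s, IsRapid (ρ i)) (x : SymMat n) :
    synth (fun ξ => ∑ i ∈ s, ρ i ξ) x = ∑ i ∈ s, synth (ρ i) x := by
  simp only [synth, Finset.sum_mul]
  exact integral_finsetSum _ fun i hi => (h i hi).integrable_synth x

theorem synth_add {n : ℕ} {ρ σ : Freq n → ℂ} (h : IsRapid ρ) (h' : IsRapid σ) (x : SymMat n) :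
    synth (fun ξ => ρ ξ + σ ξ) x = synth ρ x + synth σ x := by
  simp only [synth, add_mul]
  exact integral_add (h.integrable_synth x) (h'.integrable_synth x)

theorem synth_const_mul {n : ℕ} (ρ : Freq n → ℂ) (c : ℂ) (x : SymMat n) :
    synth (fun ξ => c * ρ ξ) x = c * synth ρ x := by
  simp only [synth, mul_assoc]
  exact integral_const_mul c _

theorem hasDerivAt_synth {n : ℕ} {ρ : Freq n → ℂ} (h : IsRapid ρ) (x v : SymMat n) :
    HasDerivAt (fun t : ℝ => synth ρ (x + t • v))
      (-synth (fun ξ => (zpt ξ * cmat v).trace * ρ ξ) x) 0 := by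
  have hv : IsRapid fun ξ => (zpt ξ * cmat v).trace * ρ ξ := by
    simp only [trace_mul_cmat, Finset.sum_mul]
    refine IsRapid.sum _ fun i _ => IsRapid.sum _ fun j _ => ?_
    have := (h.zpt_mul i j).const_mul (v s(i, j) : ℂ)
    convert this using 2 with ξ
    ring
  set M := Real.exp (|(mat x).trace| + |(mat v).trace|) with hM
  have key := hasDerivAt_integral_of_dominated_loc_of_deriv_le (μ := (volume : Measure (Freq n)))
    (F := fun (t : ℝ) ξ => ρ ξ * Complex.exp (-(zpt ξ * cmat (x + t • v)).trace))
    (F' := fun (t : ℝ) ξ => ρ ξ * (Complex.exp (-(zpt ξ * cmat (x + t • v)).trace)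
      * (-(zpt ξ * cmat v).trace))) (x₀ := 0) (s := Metric.ball 0 1)
    (bound := fun ξ => ‖(zpt ξ * cmat v).trace * ρ ξ‖ * M) (Metric.ball_mem_nhds 0 one_pos)
    (Filter.Eventually.of_forall fun t => (h.integrable_synth _).aestronglyMeasurable)
    (h.integrable_synth _) ?_ ?_ ?_ ?_
  · refine key.2.congr_deriv ?_
    rw [synth, ← integral_neg]
    refine integral_congr_ae (Filter.Eventually.of_forall fun ξ => ?_)
    simp only [zero_smul, add_zero]
    ring
  · refine ((hv.integrable_synth x).neg.aestronglyMeasurable).congr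
      (Filter.Eventually.of_forall fun ξ => ?_)
    simp only [zero_smul, add_zero, Pi.neg_apply]
    ring
  · refine Filter.Eventually.of_forall fun ξ t ht => ?_
    rw [norm_mul, norm_mul, norm_neg, norm_exp_zpt, norm_mul]
    have : Real.exp (-(mat (x + t • v)).trace) ≤ M := by
      apply Real.exp_le_exp.2
      have e : (mat (x + t • v)).trace = (mat x).trace + t * (mat v).trace := by
        simp [trace_mat, Finset.sum_add_distrib, Finset.mul_sum]
      rw [e]
      have ht' : |t| ≤ 1 := by
        have := Metric.mem_ball.1 ht
        rw [dist_zero_right, Real.norm_eq_abs] at this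
        exact this.le
      have h1 : |t * (mat v).trace| ≤ |(mat v).trace| := by
        rw [abs_mul]
        exact mul_le_of_le_one_left (abs_nonneg _) ht'
      have h2 := neg_abs_le (t * (mat v).trace)
      have h3 := neg_abs_le (mat x).trace
      linarith
    calc _ = ‖(zpt ξ * cmat v).trace‖ * ‖ρ ξ‖ * Real.exp (-(mat (x + t • v)).trace) := by ring
      _ ≤ _ := by gcongr
  · exact hv.integrable.norm.mul_const M
  · refine Filter.Eventually.of_forall fun ξ t _ => ?_
    refine HasDerivAt.const_mul (ρ ξ) (HasDerivAt.cexp ?_)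
    have e : ∀ t : ℝ, -(zpt ξ * cmat (x + t • v)).trace
        = -(zpt ξ * cmat x).trace + t * -(zpt ξ * cmat v).trace := by
      intro t
      rw [cmat_add, cmat_smul, mul_add, trace_add, mul_smul_comm, trace_smul, smul_eq_mul]
      ring
    simp only [e]
    have := ((hasDerivAt_id t).ofReal_comp).mul_const (-(zpt ξ * cmat v).trace)
    simpa using this.const_add (-(zpt ξ * cmat x).trace)

theorem D_eq_of_synth {n : ℕ} {ψ : SymMat n → ℂ} (hψ : ContDiff ℝ ∞ ψ) {ρ : Freq n → ℂ}
    (h : IsRapid ρ) (hs : ∀ x, ψ x = synth ρ x) (i j : Fin n) (x : SymMat n) :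
    D i j ψ x = -synth (fun ξ => zpt ξ i j * ρ ξ) x := by
  have h1 : HasFDerivAt ψ (fderiv ℝ ψ x) x :=
    (hψ.differentiable (by simp)).differentiableAt.hasFDerivAt
  have h2 := h1.hasLineDerivAt (symPart (Matrix.single i j 1))
  have h3 := hasDerivAt_synth h x (symPart (Matrix.single i j 1))
  rw [HasLineDerivAt] at h2
  simp only [hs] at h2
  rw [D, h2.unique h3]
  simp only [trace_mul_cmat_symPart _ (zpt_transpose _)]

theorem exists_synth {n : ℕ} {ψ : SymMat n → ℂ} (hψ : IsTest ψ) :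
    ∃ ρ : Freq n → ℂ, IsRapid ρ ∧ ∀ x, ψ x = synth ρ x := by
  set ψ₁ : Freq n → ℂ := fun v => ψ (WithLp.ofLp v) * (Real.exp ((mat (WithLp.ofLp v)).trace) : ℂ)
    with hψ₁
  have hL : ContDiff ℝ ∞ (fun v : Freq n => (WithLp.ofLp v : SymMat n)) :=
    (PiLp.continuousLinearEquiv 2 ℝ (fun _ : Sym2 (Fin n) => ℝ)).contDiff
  have hsm : ContDiff ℝ ∞ ψ₁ := by
    refine (hψ.1.comp hL).mul (Complex.ofRealCLM.contDiff.comp (ContDiff.exp ?_))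
    simp only [trace_mat]
    refine ContDiff.sum fun i _ => ?_
    exact (contDiff_apply ℝ ℝ s(i, i)).comp hL
  have hcs : HasCompactSupport ψ₁ := by
    refine HasCompactSupport.mul_right ?_
    exact hψ.2.comp_homeomorph
      (PiLp.continuousLinearEquiv 2 ℝ (fun _ : Sym2 (Fin n) => ℝ)).toHomeomorph
  set S : SchwartzMap (Freq n) ℂ := hcs.toSchwartzMap hsm with hS
  set R : SchwartzMap (Freq n) ℂ := 𝓕 S with hR
  refine ⟨R, ⟨R.continuous, fun k => R.integrable_pow_mul volume k⟩, fun x => ?_⟩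
  have hinv : (𝓕⁻ R : SchwartzMap (Freq n) ℂ) = S := FourierTransform.fourierInv_fourier_eq S
  have h1 : (𝓕⁻ R : SchwartzMap (Freq n) ℂ) (WithLp.toLp 2 x) = ψ₁ (WithLp.toLp 2 x) := by
    rw [hinv]; rfl
  rw [SchwartzMap.fourierInv_coe, Real.fourierInv_eq'] at h1
  have h2 : ψ x = ψ₁ (WithLp.toLp 2 x) * (Real.exp (-(mat x).trace) : ℂ) := by
    simp only [hψ₁]
    rw [mul_assoc, ← Complex.ofReal_mul, ← Real.exp_add]
    simp
  rw [h2, ← h1, synth, ← integral_mul_const]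
  refine integral_congr_ae (Filter.Eventually.of_forall fun ξ => ?_)
  simp only [smul_eq_mul]
  rw [trace_zpt_mul, mul_comm (Complex.exp _), mul_assoc, Complex.ofReal_exp, ← Complex.exp_add]
  have hin : inner ℝ ξ (WithLp.toLp 2 x : Freq n) = ∑ p, ξ p * x p := by
    simp [PiLp.inner_apply, mul_comm]
  rw [hin]
  congr 2
  push_cast
  ring

/-! ### From identities between Laplace transforms to weak identities -/

/-- Kernels `G(ξ, x)` for which `∫∫ G(ξ, x) ρ(ξ) e^{-tr(z_ξ x)} h(x) dξ dμ_ν(x)` converges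
absolutely, whatever the rapidly decreasing `ρ` and the square integrable `h`. -/
def IsFubini {n : ℕ} (ν : ℝ) (G : Freq n → SymMat n → ℂ) : Prop :=
  ∀ ρ : Freq n → ℂ, IsRapid ρ → ∀ h : L2 n ν, Integrable (fun q : Freq n × SymMat n =>
    G q.1 q.2 * ρ q.1 * Complex.exp (-(zpt q.1 * cmat q.2).trace) * h q.2)
    (volume.prod (mu n ν))

theorem IsFubini.of_right {n : ℕ} {ν : ℝ} (hν : ((n : ℝ) - 1) / 2 < ν) {q : SymMat n → ℂ}
    (hq : Continuous q) {C : ℝ} (hC : ∀ x, ‖q x‖ ≤ C * (1 + ‖x‖)) :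
    IsFubini ν fun _ x => q x := by
  intro ρ hρ h
  have hC0 : 0 ≤ C := by
    have := (norm_nonneg _).trans (hC 0)
    simpa using this
  have hw : MemLp (fun x : SymMat n => q x * (Real.exp (-(mat x).trace) : ℂ)) 2 (mu n ν) := by
    refine memLp_of_norm_le_exp hν (δ := 1 / 2) (C := 3 * C) ?_ (by norm_num) fun x hx => ?_
    · exact (hq.mul (Complex.continuous_ofReal.comp
        (continuous_trace_mat n).neg.rexp)).aestronglyMeasurable
    · rw [norm_mul, Complex.norm_real, Real.norm_of_nonneg (Real.exp_nonneg _)]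
      have h1 := norm_mul_exp_le one_pos hx
      rw [one_mul, div_one] at h1
      have h2 : Real.exp (-(mat x).trace) ≤ Real.exp (-(1 / 2 * (mat x).trace)) :=
        Real.exp_le_exp.2 (by linarith [trace_nonneg_of_mem_cone hx])
      calc ‖q x‖ * Real.exp (-(mat x).trace)
          ≤ C * (1 + ‖x‖) * Real.exp (-(mat x).trace) := by gcongr; exact hC x
        _ = C * (Real.exp (-(mat x).trace) + ‖x‖ * Real.exp (-(mat x).trace)) := by ring
        _ ≤ C * (Real.exp (-(1 / 2 * (mat x).trace)) + 2 * Real.exp (-(1 / 2 * (mat x).trace))) := by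
          gcongr
        _ = _ := by ring
  have h1 := hρ.integrable.mul_prod (integrable_mul_L2 hw h)
  have hph : Continuous fun p : Freq n × SymMat n =>
      Complex.exp (-(zpt p.1 * cmat p.2).trace) * (Real.exp ((mat p.2).trace) : ℂ) :=
    continuous_exp_zpt_prod.mul (Complex.continuous_ofReal.comp
      (((continuous_trace_mat n).comp continuous_snd).rexp))
  have h2 := h1.mul_bdd (c := 1) hph.aestronglyMeasurable
    (Filter.Eventually.of_forall fun p => by
      rw [norm_mul, norm_exp_zpt, Complex.norm_real, Real.norm_of_nonneg (Real.exp_nonneg _),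
        ← Real.exp_add]
      simp)
  refine h2.congr (Filter.Eventually.of_forall fun p => ?_)
  have e : (Real.exp (-(mat p.2).trace) : ℂ) * (Real.exp ((mat p.2).trace) : ℂ) = 1 := by
    rw [← Complex.ofReal_mul, ← Real.exp_add]; simp
  simp only
  linear_combination (ρ p.1 * q p.2 * h p.2 * Complex.exp (-(zpt p.1 * cmat p.2).trace)) * e

theorem IsFubini.add {n : ℕ} {ν : ℝ} {G H : Freq n → SymMat n → ℂ} (hG : IsFubini ν G)
    (hH : IsFubini ν H) : IsFubini ν fun ξ x => G ξ x + H ξ x := fun ρ hρ h =>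
  ((hG ρ hρ h).add (hH ρ hρ h)).congr (Filter.Eventually.of_forall fun p => by
    simp only [Pi.add_apply]; ring)

theorem IsFubini.const_mul {n : ℕ} {ν : ℝ} {G : Freq n → SymMat n → ℂ} (hG : IsFubini ν G)
    (c : ℂ) : IsFubini ν fun ξ x => c * G ξ x := fun ρ hρ h =>
  ((hG ρ hρ h).const_mul c).congr (Filter.Eventually.of_forall fun p => by ring)

theorem IsFubini.sum {n : ℕ} {ν : ℝ} {ι : Type*} (s : Finset ι) {G : ι → Freq n → SymMat n → ℂ}
    (hG : ∀ i ∈ s, IsFubini ν (G i)) : IsFubini ν fun ξ x => ∑ i ∈ s, G i ξ x := fun ρ hρ h =>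
  (integrable_finsetSum s fun i hi => hG i hi ρ hρ h).congr
    (Filter.Eventually.of_forall fun p => by simp only [Finset.sum_mul])

theorem IsFubini.zpt_mul {n : ℕ} {ν : ℝ} {G : Freq n → SymMat n → ℂ} (hG : IsFubini ν G)
    (i j : Fin n) : IsFubini ν fun ξ x => zpt ξ i j * G ξ x := fun ρ hρ h =>
  (hG _ (hρ.zpt_mul i j) h).congr (Filter.Eventually.of_forall fun p => by ring)

/-- Matrices of kernels. -/
def IsFubiniMat {n : ℕ} (ν : ℝ) (M : Freq n → SymMat n → CMat n) : Prop :=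
  ∀ i j, IsFubini ν fun ξ x => M ξ x i j

theorem isFubiniMat_cmat {n : ℕ} {ν : ℝ} (hν : ((n : ℝ) - 1) / 2 < ν) :
    IsFubiniMat (n := n) ν fun _ x => cmat x := fun i j =>
  IsFubini.of_right hν (C := 1) (by simp only [cmat_apply]; fun_prop) fun x => by
    rw [cmat_apply, Complex.norm_real]
    linarith [norm_le_pi_norm x s(i, j)]

theorem isFubiniMat_one {n : ℕ} {ν : ℝ} (hν : ((n : ℝ) - 1) / 2 < ν) :
    IsFubiniMat (n := n) ν fun _ _ => 1 := fun i j =>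
  IsFubini.of_right hν (C := 1) continuous_const fun x => by
    have : ‖(1 : CMat n) i j‖ ≤ 1 := by rw [Matrix.one_apply]; split_ifs <;> simp
    linarith [norm_nonneg x]

theorem IsFubiniMat.mul_const {n : ℕ} {ν : ℝ} {M : Freq n → SymMat n → CMat n}
    (hM : IsFubiniMat ν M) (a : CMat n) : IsFubiniMat ν fun ξ x => M ξ x * a := fun i j => by
  simp only [Matrix.mul_apply]
  refine IsFubini.sum _ fun k _ => ?_
  simp only [mul_comm _ (a k j)]
  exact (hM i k).const_mul _

theorem IsFubiniMat.const_mul {n : ℕ} {ν : ℝ} {M : Freq n → SymMat n → CMat n}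
    (hM : IsFubiniMat ν M) (a : CMat n) : IsFubiniMat ν fun ξ x => a * M ξ x := fun i j => by
  simp only [Matrix.mul_apply]
  exact IsFubini.sum _ fun k _ => (hM k j).const_mul _

theorem IsFubiniMat.mul_zpt {n : ℕ} {ν : ℝ} {M : Freq n → SymMat n → CMat n}
    (hM : IsFubiniMat ν M) : IsFubiniMat ν fun ξ x => M ξ x * zpt ξ := fun i j => by
  simp only [Matrix.mul_apply]
  refine IsFubini.sum _ fun k _ => ?_
  simp only [mul_comm _ (zpt _ k j)]
  exact (hM i k).zpt_mul k j

theorem IsFubiniMat.trace {n : ℕ} {ν : ℝ} {M : Freq n → SymMat n → CMat n}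
    (hM : IsFubiniMat ν M) : IsFubini ν fun ξ x => (M ξ x).trace :=
  IsFubini.sum _ fun i _ => hM i i

theorem IsFubini.integral_synth_mul {n : ℕ} {ν : ℝ} {G : Freq n → SymMat n → ℂ}
    (hG : IsFubini ν G) {ρ : Freq n → ℂ} (hρ : IsRapid ρ) (h : L2 n ν) :
    ∫ x, synth (fun ξ => G ξ x * ρ ξ) x * h x ∂(mu n ν)
      = ∫ ξ, ρ ξ * ∫ x, G ξ x * Complex.exp (-(zpt ξ * cmat x).trace) * h x ∂(mu n ν) := by
  have := integral_integral_swap (f := fun (ξ : Freq n) (x : SymMat n) =>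
    G ξ x * ρ ξ * Complex.exp (-(zpt ξ * cmat x).trace) * h x) (hG ρ hρ h)
  simp only [synth, ← integral_mul_const, ← integral_const_mul]
  rw [← this]
  refine integral_congr_ae (Filter.Eventually.of_forall fun ξ =>
    integral_congr_ae (Filter.Eventually.of_forall fun x => ?_))
  simp only
  ring

/-- The symbol of the infinitesimal action of `(a, b; c, -aᵗ)`: applying `π_ν` of this element to
`z ↦ e^{-tr(zx)}` multiplies it by `symbol ν a b c z x`. -/
def symbol {n : ℕ} (ν : ℝ) (a b c z : CMat n) (x : SymMat n) : ℂ :=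
  ((b * cmat x).trace - ν * a.trace) + ((cmat x * a + aᵀ * cmat x + (ν : ℂ) • c) * z).trace
    - (cmat x * (z * c * z)).trace

/-- The second order operator in `x` with
`dualOp ν a b c e^{-tr(zx)} = symbol ν a b c z x e^{-tr(zx)}`;
it is the transpose of `λ_ν(a, b; c, -aᵗ)` for the measure `μ_ν`. -/
def dualOp {n : ℕ} (ν : ℝ) (a b c : CMat n) (ψ : SymMat n → ℂ) (x : SymMat n) : ℂ :=
  ((b * cmat x).trace - ν * a.trace) * ψ x
    - ((cmat x * a + aᵀ * cmat x + (ν : ℂ) • c) * grad ψ x).trace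
    - (cmat x * nabla (fun y => c * grad ψ y) x).trace

theorem isFubini_symbol {n : ℕ} {ν : ℝ} (hν : ((n : ℝ) - 1) / 2 < ν) (a b c : CMat n) :
    IsFubini ν fun ξ x => symbol ν a b c (zpt ξ) x := by
  have h1 := isFubiniMat_cmat (n := n) hν
  have hone := isFubiniMat_one (n := n) hν
  have t1 : IsFubini ν fun (ξ : Freq n) (x : SymMat n) => (b * cmat x).trace :=
    (h1.const_mul b).trace
  have t2 : IsFubini ν fun (ξ : Freq n) (x : SymMat n) => -(ν * a.trace : ℂ) :=
    IsFubini.of_right hν (C := ‖-(ν * a.trace : ℂ)‖) continuous_const fun x => by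
      have := norm_nonneg (-(ν * a.trace : ℂ))
      nlinarith [norm_nonneg x]
  have t3 := (h1.mul_const a).mul_zpt.trace
  have t4 := (h1.const_mul aᵀ).mul_zpt.trace
  have t5 := ((hone.mul_const c).mul_zpt.trace).const_mul (ν : ℂ)
  have t6 := ((h1.mul_zpt.mul_const c).mul_zpt.trace).const_mul (-1)
  convert ((((t1.add t2).add t3).add t4).add t5).add t6 using 3 with ξ x
  simp only [symbol, add_mul, trace_add, Matrix.mul_assoc, one_mul, smul_mul_assoc, trace_smul,
    smul_eq_mul]
  ring

theorem D_sum {n : ℕ} {ι : Type*} (s : Finset ι) {f : ι → SymMat n → ℂ} {x : SymMat n}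
    (hf : ∀ k ∈ s, DifferentiableAt ℝ (f k) x) (i j : Fin n) :
    D i j (fun y => ∑ k ∈ s, f k y) x = ∑ k ∈ s, D i j (f k) x := by
  have : (fun y => ∑ k ∈ s, f k y) = ∑ k ∈ s, f k := by funext y; simp
  rw [D, this, fderiv_sum hf]
  simp [D]

theorem D_const_mul {n : ℕ} {f : SymMat n → ℂ} {x : SymMat n} (hf : DifferentiableAt ℝ f x)
    (c : ℂ) (i j : Fin n) : D i j (fun y => c * f y) x = c * D i j f x := by
  rw [D, fderiv_const_mul hf]
  simp [D]

theorem contDiff_D {n : ℕ} {f : SymMat n → ℂ} (hf : ContDiff ℝ ∞ f) (i j : Fin n) :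
    ContDiff ℝ ∞ (D i j f) :=
  (hf.fderiv_right (m := ∞) (by simp)).clm_apply contDiff_const

/-- The second order part of the operators, written out in second derivatives. -/
theorem trace_mul_nabla {n : ℕ} {f : SymMat n → ℂ} {x : SymMat n} (M c : CMat n)
    (hf : ∀ i j, DifferentiableAt ℝ (D i j f) x) :
    (M * nabla (fun y => c * grad f y) x).trace
      = ∑ i, ∑ j, ∑ k, ∑ l, M i j * (c k l * D j k (D l i f) x) := by
  simp only [Matrix.trace, Matrix.diag, Matrix.mul_apply, nabla, Matrix.of_apply, grad]
  refine Finset.sum_congr rfl fun i _ => Finset.sum_congr rfl fun j _ => ?_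
  rw [Finset.mul_sum]
  refine Finset.sum_congr rfl fun k _ => ?_
  rw [D_sum _ (fun l _ => (hf l i).const_mul _), Finset.mul_sum]
  exact Finset.sum_congr rfl fun l _ => by rw [D_const_mul (hf l i)]

theorem trace_mul_grad {n : ℕ} (M : CMat n) (f : SymMat n → ℂ) (x : SymMat n) :
    (M * grad f x).trace = ∑ i, ∑ j, M i j * D j i f x := by
  simp only [Matrix.trace, Matrix.diag, Matrix.mul_apply, Matrix.of_apply, grad]

theorem synth_symbol {n : ℕ} {ν : ℝ} (a b c : CMat n) {ψ : SymMat n → ℂ} (hψ : ContDiff ℝ ∞ ψ)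
    {ρ : Freq n → ℂ} (h : IsRapid ρ) (hs : ∀ x, ψ x = synth ρ x) (x : SymMat n) :
    synth (fun ξ => symbol ν a b c (zpt ξ) x * ρ ξ) x = dualOp ν a b c ψ x := by
  have hD1 : ∀ i j y, D i j ψ y = synth (fun ξ => (-1) * (zpt ξ i j * ρ ξ)) y := fun i j y => by
    rw [D_eq_of_synth hψ h hs, synth_const_mul]; ring
  have hD2 : ∀ i j k l, D i j (D k l ψ) x = synth (fun ξ => zpt ξ i j * (zpt ξ k l * ρ ξ)) x := by
    intro i j k l
    rw [D_eq_of_synth (contDiff_D hψ k l) ((h.zpt_mul k l).const_mul (-1)) (hD1 k l),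
      ← neg_one_mul, ← synth_const_mul]
    congr 1
    funext ξ
    ring
  rw [dualOp, trace_mul_nabla _ _ fun i j =>
    ((contDiff_D hψ i j).differentiable (by simp)).differentiableAt, trace_mul_grad]
  simp only [hD2, hs x, D_eq_of_synth hψ h hs]
  set M := cmat x * a + aᵀ * cmat x + (ν : ℂ) • c with hM
  have r1 := h.const_mul ((b * cmat x).trace - ν * a.trace)
  have r2 : ∀ i j, IsRapid fun ξ => M i j * (zpt ξ j i * ρ ξ) := fun i j =>
    (h.zpt_mul j i).const_mul _
  have r3 : ∀ i j k l, IsRapid fun ξ => -(cmat x i j * c k l) * (zpt ξ j k * (zpt ξ l i * ρ ξ)) :=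
    fun i j k l => ((h.zpt_mul l i).zpt_mul j k).const_mul _
  have e : (fun ξ => symbol ν a b c (zpt ξ) x * ρ ξ) = fun ξ =>
      (((b * cmat x).trace - ν * a.trace) * ρ ξ + ∑ i, ∑ j, M i j * (zpt ξ j i * ρ ξ))
        + ∑ i, ∑ j, ∑ k, ∑ l, -(cmat x i j * c k l) * (zpt ξ j k * (zpt ξ l i * ρ ξ)) := by
    funext ξ
    have e1 : (M * zpt ξ).trace * ρ ξ = ∑ i, ∑ j, M i j * (zpt ξ j i * ρ ξ) := by
      simp only [Matrix.trace, Matrix.diag, Matrix.mul_apply, Finset.sum_mul, mul_assoc]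
    have e2 : (cmat x * (zpt ξ * c * zpt ξ)).trace * ρ ξ
        = -∑ i, ∑ j, ∑ k, ∑ l, -(cmat x i j * c k l) * (zpt ξ j k * (zpt ξ l i * ρ ξ)) := by
      rw [Matrix.mul_assoc (zpt ξ)]
      simp only [Matrix.trace, Matrix.diag, Matrix.mul_apply, Finset.sum_mul, Finset.mul_sum,
        ← Finset.sum_neg_distrib]
      refine Finset.sum_congr rfl fun i _ => Finset.sum_congr rfl fun j _ =>
        Finset.sum_congr rfl fun k _ => Finset.sum_congr rfl fun l _ => ?_
      ring
    rw [symbol, sub_mul, add_mul, ← hM, e1, e2, sub_neg_eq_add]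
  rw [e, synth_add (r1.add (IsRapid.sum _ fun i _ => IsRapid.sum _ fun j _ => r2 i j))
    (IsRapid.sum _ fun i _ => IsRapid.sum _ fun j _ => IsRapid.sum _ fun k _ =>
      IsRapid.sum _ fun l _ => r3 i j k l),
    synth_add r1 (IsRapid.sum _ fun i _ => IsRapid.sum _ fun j _ => r2 i j), synth_const_mul,
    synth_sum _ fun i _ => IsRapid.sum _ fun j _ => r2 i j,
    synth_sum _ fun i _ => IsRapid.sum _ fun j _ => IsRapid.sum _ fun k _ =>
      IsRapid.sum _ fun l _ => r3 i j k l]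
  simp only [sub_eq_add_neg, ← Finset.sum_neg_distrib]
  congr 1
  · congr 1
    refine Finset.sum_congr rfl fun i _ => ?_
    rw [synth_sum _ fun j _ => r2 i j]
    refine Finset.sum_congr rfl fun j _ => ?_
    rw [synth_const_mul]; ring
  · refine Finset.sum_congr rfl fun i _ => ?_
    rw [synth_sum _ fun j _ => IsRapid.sum _ fun k _ => IsRapid.sum _ fun l _ => r3 i j k l]
    refine Finset.sum_congr rfl fun j _ => ?_
    rw [synth_sum _ fun k _ => IsRapid.sum _ fun l _ => r3 i j k l]
    refine Finset.sum_congr rfl fun k _ => ?_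
    rw [synth_sum _ fun l _ => r3 i j k l]
    refine Finset.sum_congr rfl fun l _ => ?_
    rw [synth_const_mul]; ring

/-- The integral of a function against a test function is determined by its Laplace transform. -/
theorem integral_test_mul {n : ℕ} {ν : ℝ} (hν : ((n : ℝ) - 1) / 2 < ν) {ψ : SymMat n → ℂ}
    {ρ : Freq n → ℂ} (h : IsRapid ρ) (hs : ∀ x, ψ x = synth ρ x) (g : L2 n ν) :
    ∫ x, ψ x * g x ∂(mu n ν) = ∫ ξ, ρ ξ * laplace g (zpt ξ) := by
  have h1 : IsFubini ν fun (_ : Freq n) (_ : SymMat n) => (1 : ℂ) :=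
    IsFubini.of_right hν (C := 1) continuous_const fun x => by
      rw [norm_one]; linarith [norm_nonneg x]
  have := h1.integral_synth_mul h g
  simp only [one_mul, ← hs] at this
  exact this

/-- The Laplace transform is injective on `L²_ν(Ω)`. -/
theorem laplace_injective {n : ℕ} {ν : ℝ} (hν : ((n : ℝ) - 1) / 2 < ν) {g h : L2 n ν}
    (H : Set.EqOn (laplace g) (laplace h) (tube n)) : g = h := by
  refine L2_eq_of_integral_eq hν fun ψ hψ => ?_
  obtain ⟨ρ, hρ, hs⟩ := exists_synth hψ
  rw [integral_test_mul hν hρ hs, integral_test_mul hν hρ hs]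
  simp only [H (zpt_mem_tube _)]

theorem integral_test_mul_eq_dualOp {n : ℕ} {ν : ℝ} (hν : ((n : ℝ) - 1) / 2 < ν)
    (a b c : CMat n) {f g : L2 n ν}
    (H : ∀ ξ : Freq n, laplace g (zpt ξ) = ∫ x, symbol ν a b c (zpt ξ) x *
      Complex.exp (-(zpt ξ * cmat x).trace) * f x ∂(mu n ν))
    {ψ : SymMat n → ℂ} (hψ : IsTest ψ) :
    ∫ x, ψ x * g x ∂(mu n ν) = ∫ x, dualOp ν a b c ψ x * f x ∂(mu n ν) := by
  obtain ⟨ρ, hρ, hs⟩ := exists_synth hψ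
  rw [integral_test_mul hν hρ hs]
  simp only [H]
  rw [← (isFubini_symbol hν a b c).integral_synth_mul hρ f]
  simp only [synth_symbol a b c hψ.1 hρ hs]

/-! ### Continuous logarithms -/

/-- A nowhere vanishing `C¹` path in `ℂ` starting at `1` has a continuous logarithm, the integral
of its logarithmic derivative. -/
theorem exists_continuous_log {d : ℝ → ℂ} (hd : ContDiff ℝ 1 d) (h0 : d 0 = 1)
    (hne : ∀ t, d t ≠ 0) :
    ∃ l : ℝ → ℂ, Continuous l ∧ l 0 = 0 ∧ ∀ t, Complex.exp (l t) = d t := by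
  have hc : Continuous fun t => deriv d t / d t :=
    (hd.continuous_deriv le_rfl).div hd.continuous hne
  have hl : ∀ t, HasDerivAt (fun t => ∫ s in (0 : ℝ)..t, deriv d s / d s) (deriv d t / d t) t :=
    fun t => intervalIntegral.integral_hasDerivAt_right (hc.intervalIntegrable _ _)
      hc.aestronglyMeasurable.stronglyMeasurableAtFilter hc.continuousAt
  refine ⟨fun t => ∫ s in (0 : ℝ)..t, deriv d s / d s, ?_, by simp, fun t => ?_⟩
  · exact continuous_iff_continuousAt.2 fun t => (hl t).continuousAt
  · set l := fun t => ∫ s in (0 : ℝ)..t, deriv d s / d s with hldef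
    have hder : ∀ t, HasDerivAt (fun t => d t * Complex.exp (-l t)) 0 t := by
      intro t
      have h1 := ((hd.differentiable one_ne_zero) t).hasDerivAt
      have h2 := (hl t).neg.cexp
      refine (h1.mul h2).congr_deriv ?_
      have := hne t
      simp only [Pi.neg_apply]
      field_simp
      ring
    have hconst := is_const_of_deriv_eq_zero (fun t => (hder t).differentiableAt)
      (fun t => (hder t).deriv) t 0
    have hl0 : l 0 = 0 := by simp [hldef]
    simp only [hl0, h0, neg_zero, Complex.exp_zero, mul_one] at hconst
    have : Complex.exp (l t) = Complex.exp (l t) * (d t * Complex.exp (-l t)) := by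
      rw [hconst, mul_one]
    rw [this, mul_left_comm, ← Complex.exp_add]
    simp

theorem continuous_log_unique {l m : ℝ → ℂ} (hl : Continuous l) (hm : Continuous m)
    (h0 : l 0 = m 0) (h : ∀ t, Complex.exp (l t) = Complex.exp (m t)) : l = m := by
  have hπ : (2 * Real.pi * Complex.I : ℂ) ≠ 0 := Complex.two_pi_I_ne_zero
  have hf : ∀ t, ∃ k : ℤ, (l t - m t) / (2 * Real.pi * Complex.I) = k := fun t => by
    obtain ⟨k, hk⟩ := Complex.exp_eq_exp_iff_exists_int.1 (h t)
    exact ⟨k, by rw [hk]; field_simp; ring⟩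
  choose k hk using hf
  have hkc : Continuous k := by
    have h1 : Continuous fun t => ((k t : ℤ) : ℂ) := by
      simp only [← hk]
      exact (hl.sub hm).div_const _
    have h2 : Continuous fun t => ((k t : ℤ) : ℝ) := by
      have := Complex.continuous_re.comp h1
      simpa [Function.comp_def] using this
    exact Int.isClosedEmbedding_coe_real.isEmbedding.continuous_iff.2 h2
  funext t
  have hkt : k t = k 0 := PreconnectedSpace.constant inferInstance hkc
  have h1 := hk t
  rw [hkt, ← hk 0, h0, sub_self, zero_div, div_eq_zero_iff] at h1
  rcases h1 with h1 | h1
  · exact sub_eq_zero.1 h1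
  · exact absurd h1 hπ

theorem hasDerivAt_of_exp_eq {l d : ℝ → ℂ} (hl : Continuous l) (h0 : l 0 = 0)
    (h : ∀ t, Complex.exp (l t) = d t) {d' : ℂ} (hd : HasDerivAt d d' 0) :
    HasDerivAt l d' 0 := by
  have hd0 : d 0 = 1 := by rw [← h, h0, Complex.exp_zero]
  have h1 := hd.clog_real (by rw [hd0]; exact Complex.one_mem_slitPlane)
  rw [hd0, div_one] at h1
  refine h1.congr_of_eventuallyEq ?_
  have him : ContinuousAt (fun t => (l t).im) 0 := (Complex.continuous_im.comp hl).continuousAt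
  have h2 : ∀ᶠ t in nhds 0, (l t).im ∈ Set.Ioo (-Real.pi) Real.pi :=
    him.eventually (Ioo_mem_nhds (by simp [h0, Real.pi_pos]) (by simp [h0, Real.pi_pos]))
  filter_upwards [h2] with t ht
  rw [← h, Complex.log_exp ht.1 ht.2.le]

/-! ### One-parameter groups -/

section
open scoped Matrix.Norms.Operator

theorem expNeg_eq {n : ℕ} (X : CMat2 n) (t : ℝ) : expNeg X t = NormedSpace.exp (t • (-X)) := by
  rw [expNeg]
  congr 1
  ext i j
  simp

theorem contDiff_expNeg {n : ℕ} (X : CMat2 n) : ContDiff ℝ 1 (expNeg X) := by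
  have h : expNeg X = fun t => NormedSpace.exp (t • (-X)) := funext (expNeg_eq X)
  rw [h]
  have h1 : ContDiff ℝ 1 (NormedSpace.exp : CMat2 n → CMat2 n) :=
    contDiff_iff_contDiffAt.2 fun A =>
      (NormedSpace.exp_analytic (𝕂 := ℝ) A).contDiffAt
  exact h1.comp (contDiff_id.smul contDiff_const)

theorem hasDerivAt_expNeg {n : ℕ} (X : CMat2 n) : HasDerivAt (expNeg X) (-X) 0 := by
  have h : expNeg X = fun t => NormedSpace.exp (t • (-X)) := funext (expNeg_eq X)
  rw [h]
  have := hasDerivAt_exp_smul_const (𝕂 := ℝ) (-X) 0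
  rw [zero_smul, NormedSpace.exp_zero, one_mul] at this
  exact this

/-- Extraction of an entry as a continuous linear map. -/
def entryCLM {ι : Type*} [Fintype ι] [DecidableEq ι] (i j : ι) : Matrix ι ι ℂ →L[ℝ] ℂ :=
  LinearMap.toContinuousLinearMap (Matrix.entryLinearMap ℝ ℂ i j)

theorem contDiff_expNeg_apply {n : ℕ} (X : CMat2 n) (i j : Fin n ⊕ Fin n) :
    ContDiff ℝ 1 fun t => expNeg X t i j :=
  (entryCLM i j).contDiff.comp (contDiff_expNeg X)

theorem hasDerivAt_expNeg_apply {n : ℕ} (X : CMat2 n) (i j : Fin n ⊕ Fin n) :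
    HasDerivAt (fun t => expNeg X t i j) (-X i j) 0 :=
  (entryCLM i j).hasFDerivAt.comp_hasDerivAt 0 (hasDerivAt_expNeg X)

theorem hasDerivAt_matrix {n : ℕ} {γ : ℝ → CMat n} {w : CMat n} {t : ℝ}
    (h : ∀ i j, HasDerivAt (fun t => γ t i j) (w i j) t) : HasDerivAt γ w t := by
  have h1 : HasDerivAt (fun t => (Matrix.of.symm (γ t) : Fin n → Fin n → ℂ)) (Matrix.of.symm w) t :=
    hasDerivAt_pi.2 fun i => hasDerivAt_pi.2 fun j => h i j
  exact (LinearMap.toContinuousLinearMap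
    (Matrix.ofLinearEquiv ℝ : (Fin n → Fin n → ℂ) ≃ₗ[ℝ] CMat n).toLinearMap).hasFDerivAt.comp_hasDerivAt
      t h1

theorem expNeg_zero {n : ℕ} (X : CMat2 n) : expNeg X 0 = 1 := by
  rw [expNeg_eq, zero_smul, NormedSpace.exp_zero]

theorem toBlocks₂₁_one {n : ℕ} : (1 : CMat2 n).toBlocks₂₁ = 0 := by
  rw [← fromBlocks_one, toBlocks_fromBlocks₂₁]

theorem toBlocks₂₂_one {n : ℕ} : (1 : CMat2 n).toBlocks₂₂ = 1 := by
  rw [← fromBlocks_one, toBlocks_fromBlocks₂₂]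

theorem toBlocks₁₁_one {n : ℕ} : (1 : CMat2 n).toBlocks₁₁ = 1 := by
  rw [← fromBlocks_one, toBlocks_fromBlocks₁₁]

theorem toBlocks₁₂_one {n : ℕ} : (1 : CMat2 n).toBlocks₁₂ = 0 := by
  rw [← fromBlocks_one, toBlocks_fromBlocks₁₂]

theorem hasDerivAt_denom {n : ℕ} (X : CMat2 n) (z : CMat n) :
    HasDerivAt (fun t => denom (expNeg X t) z) (-denom X z) 0 := by
  refine hasDerivAt_matrix fun i j => ?_
  have := (HasDerivAt.fun_sum fun k (_ : k ∈ Finset.univ) =>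
    (hasDerivAt_expNeg_apply X (.inr i) (.inl k)).mul_const (z k j)).add
      (hasDerivAt_expNeg_apply X (.inr i) (.inr j))
  refine this.congr_deriv ?_
  simp [denom, Matrix.mul_apply, toBlocks₂₁, toBlocks₂₂]
  ring

theorem hasDerivAt_numer {n : ℕ} (X : CMat2 n) (z : CMat n) :
    HasDerivAt (fun t => (expNeg X t).toBlocks₁₁ * z + (expNeg X t).toBlocks₁₂)
      (-(X.toBlocks₁₁ * z + X.toBlocks₁₂)) 0 := by
  refine hasDerivAt_matrix fun i j => ?_
  have := (HasDerivAt.fun_sum fun k (_ : k ∈ Finset.univ) =>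
    (hasDerivAt_expNeg_apply X (.inl i) (.inl k)).mul_const (z k j)).add
      (hasDerivAt_expNeg_apply X (.inl i) (.inr j))
  refine this.congr_deriv ?_
  simp [Matrix.mul_apply, toBlocks₁₁, toBlocks₁₂]
  ring

theorem denom_expNeg_zero {n : ℕ} (X : CMat2 n) (z : CMat n) : denom (expNeg X 0) z = 1 := by
  rw [expNeg_zero, denom, toBlocks₂₁_one, toBlocks₂₂_one, zero_mul, zero_add]

theorem act_expNeg_zero {n : ℕ} (X : CMat2 n) (z : CMat n) : act (expNeg X 0) z = z := by
  rw [act, denom_expNeg_zero, expNeg_zero, toBlocks₁₁_one, toBlocks₁₂_one, one_mul, add_zero,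
    inv_one, mul_one]

/-- The vector field of the action: `d/dt exp(-tX)·z = -(Az + B) + z(Cz + D)` at `t = 0`. -/
theorem hasDerivAt_act {n : ℕ} (X : CMat2 n) (z : CMat n) :
    HasDerivAt (fun t => act (expNeg X t) z)
      (-(X.toBlocks₁₁ * z + X.toBlocks₁₂) + z * denom X z) 0 := by
  have h1 := hasFDerivAt_ringInverse (𝕜 := ℝ) (1 : (CMat n)ˣ)
  have h2 : HasFDerivAt Ring.inverse (-ContinuousLinearMap.mulLeftRight ℝ (CMat n)
      ↑(1 : (CMat n)ˣ)⁻¹ ↑(1 : (CMat n)ˣ)⁻¹) (denom (expNeg X 0) z) := by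
    rw [denom_expNeg_zero]; exact h1
  have h3 := (hasDerivAt_numer X z).mul (h2.comp_hasDerivAt 0 (hasDerivAt_denom X z))
  have e : (fun t => act (expNeg X t) z) = fun t =>
      ((expNeg X t).toBlocks₁₁ * z + (expNeg X t).toBlocks₁₂) *
        Ring.inverse (denom (expNeg X t) z) := by
    funext t
    rw [act, Matrix.nonsing_inv_eq_ringInverse]
  rw [e]
  refine h3.congr_deriv ?_
  rw [Function.comp_apply, denom_expNeg_zero, expNeg_zero, toBlocks₁₁_one, toBlocks₁₂_one]
  simp

theorem hasDerivAt_act_apply {n : ℕ} (X : CMat2 n) (z : CMat n) (i j : Fin n) :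
    HasDerivAt (fun t => act (expNeg X t) z i j)
      ((-(X.toBlocks₁₁ * z + X.toBlocks₁₂) + z * denom X z) i j) 0 :=
  (entryCLM i j).hasFDerivAt.comp_hasDerivAt 0 (hasDerivAt_act X z)

theorem contDiff_det_denom {n : ℕ} (X : CMat2 n) (z : CMat n) :
    ContDiff ℝ 1 fun t => (denom (expNeg X t) z).det := by
  have h : ∀ i j, ContDiff ℝ 1 fun t => denom (expNeg X t) z i j := fun i j => by
    simp only [denom, Matrix.add_apply, Matrix.mul_apply, toBlocks₂₁, toBlocks₂₂, Matrix.of_apply]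
    exact (ContDiff.sum fun k _ => (contDiff_expNeg_apply X _ _).mul contDiff_const).add
      (contDiff_expNeg_apply X _ _)
  simp only [Matrix.det_apply]
  refine ContDiff.sum fun σ _ => ContDiff.const_smul _ (contDiff_prod fun i _ => h _ _)

/-- The derivative of the determinant at the identity matrix is the trace. -/
theorem hasDerivAt_det {n : ℕ} {γ : ℝ → CMat n} {w : CMat n} (hγ : HasDerivAt γ w 0)
    (h0 : γ 0 = 1) : HasDerivAt (fun t => (γ t).det) w.trace 0 := by
  have hdet : ContDiff ℝ 1 (fun M : CMat n => M.det) := by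
    simp only [Matrix.det_apply]
    exact ContDiff.sum fun σ _ => ContDiff.const_smul _
      (contDiff_prod fun i _ => (entryCLM (σ i) i).contDiff)
  have hd : HasFDerivAt (fun M : CMat n => M.det) (fderiv ℝ (fun M : CMat n => M.det) 1) (γ 0) := by
    rw [h0]; exact (hdet.differentiable one_ne_zero 1).hasFDerivAt
  refine (hd.comp_hasDerivAt 0 hγ).congr_deriv ?_
  have hline := ((hdet.differentiable one_ne_zero 1).hasFDerivAt).hasLineDerivAt w
  refine HasDerivAt.unique hline ?_
  have e : (fun t : ℝ => (1 + t • w).det) = fun t : ℝ => 1 + w.trace * t +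
      Polynomial.eval (t : ℂ) (1 + (Polynomial.X : Polynomial ℂ) •
        w.map Polynomial.C).det.divX.divX * (t : ℂ) ^ 2 := by
    funext t
    have : t • w = (t : ℂ) • w := by ext i j; simp
    rw [this, Matrix.det_one_add_smul]
  rw [e]
  set P := (1 + (Polynomial.X : Polynomial ℂ) • w.map Polynomial.C).det.divX.divX
  have hid : HasDerivAt (fun t : ℝ => (t : ℂ)) 1 0 := (hasDerivAt_id (0 : ℝ)).ofReal_comp
  have hP : HasDerivAt (fun t : ℝ => Polynomial.eval (t : ℂ) P)
      (Polynomial.eval ((0 : ℝ) : ℂ) (Polynomial.derivative P)) 0 :=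
    (P.hasDerivAt _).comp_ofReal
  have := ((hid.const_mul w.trace).const_add 1).add (hP.mul (hid.pow 2))
  refine this.congr_deriv ?_
  simp

theorem hasDerivAt_det_denom {n : ℕ} (X : CMat2 n) (z : CMat n) :
    HasDerivAt (fun t => (denom (expNeg X t) z).det) (-(denom X z).trace) 0 := by
  have := hasDerivAt_det (hasDerivAt_denom X z) (denom_expNeg_zero X z)
  rwa [trace_neg] at this

/-- The Hermitian form `(0, 1; 1, 0)`, preserved by the group. -/
def swapForm (n : ℕ) : CMat2 n := fromBlocks 0 1 1 0

theorem swapForm_mul_self (n : ℕ) : swapForm n * swapForm n = 1 := by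
  simp [swapForm, fromBlocks_multiply, fromBlocks_one]

theorem swapForm_mul_mul {n : ℕ} {X : CMat2 n} (hX : X ∈ gReal n) :
    swapForm n * X * swapForm n = -Xᴴ := by
  obtain ⟨a, b, c, hb, hc, rfl⟩ := hX
  have ha' : (a.map (fun r : ℝ => (r : ℂ)))ᴴ = aᵀ.map (fun r : ℝ => (r : ℂ)) := by
    ext i j; simp
  have ha'' : (aᵀ.map (fun r : ℝ => (r : ℂ)))ᴴ = a.map (fun r : ℝ => (r : ℂ)) := by
    ext i j; simp
  have hb' : (b.map (fun r : ℝ => (r : ℂ)))ᴴ = b.map (fun r : ℝ => (r : ℂ)) := by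
    rw [← hb]; ext i j; simp; rw [← transpose_apply b, hb]
  have hc' : (c.map (fun r : ℝ => (r : ℂ)))ᴴ = c.map (fun r : ℝ => (r : ℂ)) := by
    rw [← hc]; ext i j; simp; rw [← transpose_apply c, hc]
  simp [swapForm, fromBlocks_multiply, fromBlocks_conjTranspose, fromBlocks_neg,
    conjTranspose_smul, ha', ha'', hb', hc']

theorem expNeg_preserves {n : ℕ} {X : CMat2 n} (hX : X ∈ gReal n) (t : ℝ) :
    (expNeg X t)ᴴ * swapForm n * expNeg X t = swapForm n := by
  have hinv : (swapForm n)⁻¹ = swapForm n := Matrix.inv_eq_left_inv (swapForm_mul_self n)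
  have hu : IsUnit (swapForm n) := IsUnit.of_mul_eq_one _ (swapForm_mul_self n)
  have h1 := Matrix.exp_conj (swapForm n) (t • (-X)) hu
  rw [hinv] at h1
  have h2 : swapForm n * (t • (-X)) * swapForm n = (-(t • (-X)))ᴴ := by
    rw [mul_smul_comm, smul_mul_assoc, mul_neg, neg_mul, swapForm_mul_mul hX, conjTranspose_neg,
      conjTranspose_smul, conjTranspose_neg]
    simp
  rw [h2, Matrix.exp_conjTranspose, Matrix.exp_neg, ← expNeg_eq] at h1
  have hdet : IsUnit (expNeg X t).det := by
    rw [expNeg_eq]; exact (Matrix.isUnit_iff_isUnit_det _).1 (Matrix.isUnit_exp _)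
  calc (expNeg X t)ᴴ * swapForm n * expNeg X t
      = (expNeg X t)ᴴ * (swapForm n * expNeg X t * swapForm n) * swapForm n := by
        simp only [Matrix.mul_assoc, swapForm_mul_self, Matrix.mul_one]
    _ = ((expNeg X t)⁻¹ * expNeg X t)ᴴ * swapForm n := by
        rw [← h1, conjTranspose_mul]
    _ = swapForm n := by
        rw [Matrix.nonsing_inv_mul _ hdet, conjTranspose_one, Matrix.one_mul]

end

theorem zpt_add_conjTranspose {n : ℕ} (ξ : Freq n) : (zpt ξ)ᴴ + zpt ξ = 2 := by
  have h : (cmat (freqMat ξ))ᴴ = cmat (freqMat ξ) := by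
    ext i j
    simp [cmat_apply, Sym2.eq_swap]
  rw [zpt, conjTranspose_add, conjTranspose_smul, h, conjTranspose_one]
  simp only [Complex.star_def, Complex.conj_I, neg_smul]
  calc (1 : CMat n) + -(Complex.I • cmat (freqMat ξ)) + (1 + Complex.I • cmat (freqMat ξ))
      = 1 + 1 := by abel
    _ = 2 := one_add_one_eq_two

section
open scoped ComplexOrder

/-- With `(P, Q)` the image of `(z, 1)`, invariance of the Hermitian form gives
`P* Q + Q* P = z* + z`, which is positive definite; so `Q` is injective. -/
theorem det_denom_ne_zero {n : ℕ} {X : CMat2 n} (hX : X ∈ gReal n) (ξ : Freq n) (t : ℝ) :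
    (denom (expNeg X t) (zpt ξ)).det ≠ 0 := by
  intro hdet
  obtain ⟨v, hv, hv0⟩ := Matrix.exists_mulVec_eq_zero_iff.2 hdet
  set g := expNeg X t with hg
  have hpres := expNeg_preserves hX t
  rw [← hg, ← fromBlocks_toBlocks g, swapForm, fromBlocks_conjTranspose, fromBlocks_multiply,
    fromBlocks_multiply, fromBlocks_inj] at hpres
  simp only [Matrix.mul_zero, Matrix.mul_one, zero_add, add_zero] at hpres
  obtain ⟨e1, e2, e3, e4⟩ := hpres
  set z := zpt ξ with hz
  set A := g.toBlocks₁₁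
  set B := g.toBlocks₁₂
  set C := g.toBlocks₂₁
  set E := g.toBlocks₂₂
  have key : (A * z + B)ᴴ * (C * z + E) + (C * z + E)ᴴ * (A * z + B) = zᴴ + z := by
    have : (A * z + B)ᴴ * (C * z + E) + (C * z + E)ᴴ * (A * z + B)
        = zᴴ * (Cᴴ * A + Aᴴ * C) * z + zᴴ * (Cᴴ * B + Aᴴ * E) + (Eᴴ * A + Bᴴ * C) * z
          + (Eᴴ * B + Bᴴ * E) := by
      simp only [conjTranspose_add, conjTranspose_mul]
      noncomm_ring
    rw [this, e1, e2, e3, e4]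
    simp
  rw [hz, zpt_add_conjTranspose, ← hz] at key
  have hQ : (C * z + E).mulVec v = 0 := hv0
  have h1 : star v ⬝ᵥ ((A * z + B)ᴴ * (C * z + E) + (C * z + E)ᴴ * (A * z + B)).mulVec v = 0 := by
    rw [Matrix.add_mulVec, ← Matrix.mulVec_mulVec, hQ, Matrix.mulVec_zero, zero_add,
      ← Matrix.mulVec_mulVec, Matrix.dotProduct_mulVec, ← Matrix.star_mulVec, hQ]
    simp
  rw [key] at h1
  have h2 : star v ⬝ᵥ (2 : CMat n).mulVec v = 2 * (star v ⬝ᵥ v) := by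
    have : (2 : CMat n) = (2 : ℂ) • 1 := by
      ext i j; simp [Matrix.ofNat_apply, Matrix.one_apply]
    rw [this, Matrix.smul_mulVec, Matrix.one_mulVec, dotProduct_smul, smul_eq_mul]
  rw [h2, mul_eq_zero] at h1
  exact hv (dotProduct_star_self_eq_zero.1 (by
    rcases h1 with h1 | h1
    · norm_num at h1
    · exact h1))

end

theorem isLogDenom_logDenom {n : ℕ} {X : CMat2 n} (hX : X ∈ gReal n) (ξ : Freq n) :
    IsLogDenom X (zpt ξ) (logDenom X (zpt ξ)) := by
  refine Classical.epsilon_spec (p := IsLogDenom X (zpt ξ)) ?_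
  obtain ⟨l, h1, h2, h3⟩ := exists_continuous_log (contDiff_det_denom X (zpt ξ))
    (by rw [denom_expNeg_zero, det_one]) (det_denom_ne_zero hX ξ)
  exact ⟨l, h1, h2, h3⟩

theorem hasDerivAt_logDenom {n : ℕ} {X : CMat2 n} (hX : X ∈ gReal n) (ξ : Freq n) :
    HasDerivAt (logDenom X (zpt ξ)) (-(denom X (zpt ξ)).trace) 0 :=
  let h := isLogDenom_logDenom hX ξ
  hasDerivAt_of_exp_eq h.1 h.2.1 h.2.2 (hasDerivAt_det_denom X (zpt ξ))

/-! ### The infinitesimal action on Laplace transforms -/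

theorem norm_exp_neg_sub_one_le (w : ℂ) : ‖Complex.exp (-w) - 1‖ ≤ ‖w‖ * Real.exp ‖w‖ := by
  have := Complex.norm_exp_sub_sum_le_norm_mul_exp (-w) 1
  simpa using this

/-- The Laplace transform may be differentiated under the integral sign along any path of matrices
that is differentiable at the point in question. -/
theorem hasDerivAt_laplace {n : ℕ} {ν : ℝ} (hν : ((n : ℝ) - 1) / 2 < ν) (f : L2 n ν)
    {γ : ℝ → CMat n} {w : CMat n} (hγ : ∀ i j, HasDerivAt (fun t => γ t i j) (w i j) 0)
    {δ : ℝ} (hδ : 0 < δ) (h0 : ∀ x ∈ cone n, δ * (mat x).trace ≤ (γ 0 * cmat x).trace.re) :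
    Integrable (fun x => -(w * cmat x).trace * Complex.exp (-(γ 0 * cmat x).trace) * f x)
      (mu n ν) ∧
    HasDerivAt (fun t => laplace f (γ t))
      (∫ x, -(w * cmat x).trace * Complex.exp (-(γ 0 * cmat x).trace) * f x ∂(mu n ν)) 0 := by
  obtain ⟨K, hK0, hK⟩ : ∃ K : ℝ, 0 ≤ K ∧ ∀ᶠ t in nhds (0 : ℝ), ∀ i j,
      ‖γ t i j - γ 0 i j‖ ≤ K * ‖t‖ := by
    have h1 : ∀ i j, ∃ c : ℝ, 0 ≤ c ∧ ∀ᶠ t in nhds (0 : ℝ), ‖γ t i j - γ 0 i j‖ ≤ c * ‖t‖ := by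
      intro i j
      obtain ⟨c, hc, hb⟩ := ((hγ i j).isBigO_sub).exists_pos
      refine ⟨c, hc.le, ?_⟩
      filter_upwards [hb.bound] with t ht
      simpa using ht
    choose c hc0 hc using h1
    refine ⟨∑ i, ∑ j, c i j, Finset.sum_nonneg fun i _ => Finset.sum_nonneg fun j _ => hc0 i j, ?_⟩
    have := Filter.eventually_all.2 fun i => Filter.eventually_all.2 fun j => hc i j
    filter_upwards [this] with t ht i j
    refine (ht i j).trans (mul_le_mul_of_nonneg_right ?_ (norm_nonneg _))
    exact (Finset.single_le_sum (f := fun j => c i j) (fun j _ => hc0 i j)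
      (Finset.mem_univ j)).trans (Finset.single_le_sum (f := fun i => ∑ j, c i j)
        (fun i _ => Finset.sum_nonneg fun j _ => hc0 i j) (Finset.mem_univ i))
  set L : ℝ := (n : ℝ) ^ 2 * K with hL
  have hL0 : 0 ≤ L := by positivity
  set s : Set ℝ := {t | (∀ i j, ‖γ t i j - γ 0 i j‖ ≤ K * ‖t‖) ∧ ‖t‖ ≤ δ / (2 * (L + 1))} with hs
  have hsn : s ∈ nhds (0 : ℝ) := by
    have h2 : ∀ᶠ t in nhds (0 : ℝ), ‖t‖ ≤ δ / (2 * (L + 1)) := by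
      have : ∀ᶠ t in nhds (0 : ℝ), ‖t‖ < δ / (2 * (L + 1)) :=
        continuous_norm.continuousAt.eventually (gt_mem_nhds (by simp only [norm_zero]; positivity))
      filter_upwards [this] with t ht using ht.le
    exact hK.and h2
  have hdiff : ∀ t ∈ s, ∀ x : SymMat n,
      ‖((γ t - γ 0) * cmat x).trace‖ ≤ L * ‖t‖ * ‖x‖ := fun t ht x => by
    have := norm_trace_mul_cmat_le (γ t - γ 0) x (r := K * ‖t‖) (fun i j => ht.1 i j)
    calc _ ≤ _ := this
      _ = _ := by rw [hL]; ring
  have hsub : ∀ (t : ℝ) (x : SymMat n), Complex.exp (-(γ t * cmat x).trace)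
      = Complex.exp (-(γ 0 * cmat x).trace) *
        Complex.exp (-((γ t - γ 0) * cmat x).trace) := fun t x => by
    rw [← Complex.exp_add, Matrix.sub_mul, trace_sub]
    congr 1
    ring
  have hcurve : ∀ x : SymMat n, HasDerivAt (fun t => (γ t * cmat x).trace)
      ((w * cmat x).trace) 0 := fun x => by
    simp only [trace_mul_cmat]
    exact HasDerivAt.fun_sum fun i _ => HasDerivAt.fun_sum fun j _ => (hγ i j).mul_const _
  have hF := memLp_exp_neg hν hδ h0
  have key := hasFDerivAt_integral_of_dominated_loc_of_lip' (μ := mu n ν) (𝕜 := ℝ)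
    (F := fun t x => Complex.exp (-(γ t * cmat x).trace) * f x) (x₀ := 0) (s := s)
    (bound := fun x => L * ‖((‖x‖ * Real.exp (-(δ / 2 * (mat x).trace)) : ℝ) : ℂ) * f x‖)
    (F' := fun x => ContinuousLinearMap.toSpanSingleton ℝ
      (-(w * cmat x).trace * Complex.exp (-(γ 0 * cmat x).trace) * f x)) hsn
    (fun t _ => (continuous_exp_neg _).aestronglyMeasurable.mul
      (Lp.aestronglyMeasurable f)) (integrable_mul_L2 hF f) ?_ ?_ ?_ ?_
  · have hi : Integrable (fun x => -(w * cmat x).trace * Complex.exp (-(γ 0 * cmat x).trace) * f x)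
        (mu n ν) := by
      have := key.1.apply_continuousLinearMap (1 : ℝ)
      simpa [ContinuousLinearMap.toSpanSingleton_apply] using this
    refine ⟨hi, ?_⟩
    have h2 := key.2.hasDerivAt
    refine h2.congr_deriv ?_
    refine (ContinuousLinearMap.integral_apply key.1 1).trans ?_
    simp [ContinuousLinearMap.toSpanSingleton_apply]
  · refine (ContinuousLinearMap.toSpanSingletonCLE (𝕜 := ℝ) (E := ℂ)).continuous
      |>.comp_aestronglyMeasurable ?_
    exact (((continuous_trace_mul_cmat w).neg.mul (continuous_exp_neg _)).aestronglyMeasurable).mul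
      (Lp.aestronglyMeasurable f)
  · filter_upwards [ae_mem_cone n ν] with x hx t ht
    have hd := hdiff t ht x
    have htr := norm_le_trace_of_mem_cone hx
    have hqt : ‖((γ t - γ 0) * cmat x).trace‖ ≤ δ / 2 * (mat x).trace := by
      have h3 : L * ‖t‖ ≤ δ / 2 := by
        have := ht.2
        rw [le_div_iff₀ (by positivity)] at this
        nlinarith [norm_nonneg t]
      calc _ ≤ L * ‖t‖ * ‖x‖ := hd
        _ ≤ δ / 2 * (mat x).trace := by gcongr
    rw [hsub t x, ← sub_mul, ← mul_sub_one, norm_mul, norm_mul, sub_zero, norm_mul,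
      Complex.norm_real, Real.norm_of_nonneg (by positivity)]
    have h1 := norm_exp_neg_le (h0 x hx)
    have h2 := norm_exp_neg_sub_one_le (((γ t - γ 0) * cmat x).trace)
    have h3 : Real.exp (-(δ * (mat x).trace)) * Real.exp (δ / 2 * (mat x).trace)
        = Real.exp (-(δ / 2 * (mat x).trace)) := by
      rw [← Real.exp_add]; ring_nf
    calc ‖Complex.exp (-(γ 0 * cmat x).trace)‖ *
          ‖Complex.exp (-((γ t - γ 0) * cmat x).trace) - 1‖ * ‖f x‖
        ≤ Real.exp (-(δ * (mat x).trace)) *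
          ((L * ‖t‖ * ‖x‖) * Real.exp (δ / 2 * (mat x).trace)) * ‖f x‖ := by
          gcongr
          refine h2.trans ?_
          gcongr
      _ = L * (‖x‖ * (Real.exp (-(δ * (mat x).trace)) * Real.exp (δ / 2 * (mat x).trace))
          * ‖f x‖) * ‖t‖ := by ring
      _ = _ := by rw [h3]
  · exact (integrable_mul_L2 (memLp_norm_mul_exp hν (half_pos hδ)) f).norm.const_mul L
  · refine Filter.Eventually.of_forall fun x => ?_
    have := ((hcurve x).neg.cexp).mul_const (f x)
    refine this.hasFDerivAt.congr_fderiv ?_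
    ext
    simp only [Pi.neg_apply, ContinuousLinearMap.toSpanSingleton_apply, one_smul]
    ring

/-- The derivative of `π_ν(exp tX)` on a Laplace transform, at the points `1 + iY`. -/
theorem hasDerivAt_piExp {n : ℕ} {ν : ℝ} (hν : ((n : ℝ) - 1) / 2 < ν) {a b c : CMat n}
    (hX : fromBlocks a b c (-aᵀ) ∈ gReal n) (f : L2 n ν) (ξ : Freq n) :
    HasDerivAt (fun t => piExp ν (fromBlocks a b c (-aᵀ)) t (laplace f) (zpt ξ))
      (∫ x, symbol ν a b c (zpt ξ) x * Complex.exp (-(zpt ξ * cmat x).trace) * f x ∂(mu n ν))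
      0 := by
  set X := fromBlocks a b c (-aᵀ) with hXd
  set z := zpt ξ with hz
  have hact0 : act (expNeg X 0) z = z := act_expNeg_zero X z
  have h0 : ∀ x ∈ cone n, (1 : ℝ) * (mat x).trace ≤ (act (expNeg X 0) z * cmat x).trace.re := by
    intro x _
    rw [hact0, hz, re_trace_zpt_mul, one_mul]
  obtain ⟨hint, h1⟩ := hasDerivAt_laplace hν f (γ := fun t => act (expNeg X t) z)
    (w := -(X.toBlocks₁₁ * z + X.toBlocks₁₂) + z * denom X z)
    (fun i j => hasDerivAt_act_apply X z i j) one_pos h0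
  have h2 := ((hasDerivAt_logDenom hX ξ).const_mul (-(ν : ℂ))).cexp.mul h1
  refine h2.congr_deriv ?_
  have hl0 : logDenom X z 0 = 0 := (isLogDenom_logDenom hX ξ).2.1
  rw [hact0] at hint
  simp only [← hz, hl0, mul_zero, Complex.exp_zero, one_mul, hact0]
  rw [laplace, ← integral_const_mul, ← integral_add]
  · refine integral_congr_ae (Filter.Eventually.of_forall fun x => ?_)
    simp only
    rw [hXd, denom, toBlocks_fromBlocks₁₁, toBlocks_fromBlocks₁₂, toBlocks_fromBlocks₂₁,
      toBlocks_fromBlocks₂₂, symbol]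
    have e1 : (cmat x * a * z).trace = (a * z * cmat x).trace := by
      rw [Matrix.mul_assoc, trace_mul_comm]
    have e2 : (aᵀ * cmat x * z).trace = (z * aᵀ * cmat x).trace := by
      rw [trace_mul_comm, Matrix.mul_assoc]
    have e3 : (cmat x * (z * c * z)).trace = (z * (c * z) * cmat x).trace := by
      rw [trace_mul_comm, Matrix.mul_assoc z]
    simp only [add_mul, mul_add, mul_neg, neg_mul, trace_add, trace_neg, smul_mul_assoc,
      trace_smul, smul_eq_mul, e1, e2, e3, trace_transpose]
    ring
  · exact (integrable_mul_L2 (memLp_exp_zpt hν ξ) f).const_mul _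
  · exact hint

/-- The weak form of the derived representation: `λ_ν(X)` is the transpose of `dualOp`. -/
theorem integral_test_mul_deriv_orbit {n : ℕ} {ν : ℝ} (hν : ((n : ℝ) - 1) / 2 < ν)
    {a b c : CMat n} (hX : fromBlocks a b c (-aᵀ) ∈ gReal n) {f : L2 n ν} {u : ℝ → L2 n ν}
    (hu : IsOrbit (fromBlocks a b c (-aᵀ)) f u) {u' : L2 n ν} (hu' : HasDerivAt u u' 0)
    {ψ : SymMat n → ℂ} (hψ : IsTest ψ) :
    ∫ x, ψ x * u' x ∂(mu n ν) = ∫ x, dualOp ν a b c ψ x * f x ∂(mu n ν) := by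
  refine integral_test_mul_eq_dualOp hν a b c (fun ξ => ?_) hψ
  have h1 := hasDerivAt_piExp hν hX f ξ
  have h2 := hasDerivAt_integral_mul (memLp_exp_zpt hν ξ) hu'
  refine HasDerivAt.unique h2 ?_
  refine h1.congr_of_eventuallyEq (Filter.Eventually.of_forall fun t => ?_)
  exact hu t (zpt_mem_tube ξ)

theorem IsOrbit.unique {n : ℕ} {ν : ℝ} (hν : ((n : ℝ) - 1) / 2 < ν) {X : CMat2 n} {f : L2 n ν}
    {u v : ℝ → L2 n ν} (hu : IsOrbit X f u) (hv : IsOrbit X f v) : u = v :=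
  funext fun t => laplace_injective hν fun _ hz => (hu t hz).trans (hv t hz).symm

theorem IsOrbit.orbit_eq {n : ℕ} {ν : ℝ} (hν : ((n : ℝ) - 1) / 2 < ν) {X : CMat2 n} {f : L2 n ν}
    {u : ℝ → L2 n ν} (hu : IsOrbit X f u) : orbit X f = u :=
  IsOrbit.unique hν (Classical.epsilon_spec (p := IsOrbit X f) ⟨u, hu⟩) hu

theorem integral_test_mul_lamReal {n : ℕ} {ν : ℝ} (hν : ((n : ℝ) - 1) / 2 < ν)
    {a b c : CMat n} (hX : fromBlocks a b c (-aᵀ) ∈ gReal n) {f : L2 n ν}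
    (hf : IsSmoothVector f) {ψ : SymMat n → ℂ} (hψ : IsTest ψ) :
    ∫ x, ψ x * lamReal (fromBlocks a b c (-aᵀ)) f x ∂(mu n ν)
      = ∫ x, dualOp ν a b c ψ x * f x ∂(mu n ν) := by
  obtain ⟨u, hu, hsm⟩ := hf _ hX
  refine integral_test_mul_deriv_orbit hν hX hu ?_ hψ
  rw [lamReal, hu.orbit_eq hν]
  exact (hsm.differentiable (by simp) 0).hasDerivAt

/-! ### Orbits of the block diagonal elements -/

/-- A real matrix with complex entries. -/
abbrev toC {n : ℕ} (α : Matrix (Fin n) (Fin n) ℝ) : CMat n := α.map (fun r : ℝ => (r : ℂ))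

/-- The element `(α, 0; 0, -αᵗ)` of `𝔤`, acting on `T(Ω)` by linear maps. -/
abbrev diagElt {n : ℕ} (α : Matrix (Fin n) (Fin n) ℝ) : CMat2 n :=
  fromBlocks (toC α) 0 0 (-(toC α)ᵀ)

theorem diagElt_mem {n : ℕ} (α : Matrix (Fin n) (Fin n) ℝ) : diagElt α ∈ gReal n :=
  ⟨α, 0, 0, by simp, by simp, by
    ext i j
    rcases i with i | i <;> rcases j with j | j <;> simp⟩

section
open scoped Matrix.Norms.Operator

/-- Block diagonal matrices as a ring homomorphism. -/
def diagHom (n : ℕ) : CMat n × CMat n →+* CMat2 n where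
  toFun p := fromBlocks p.1 0 0 p.2
  map_one' := fromBlocks_one
  map_mul' p q := by simp [fromBlocks_multiply]
  map_zero' := fromBlocks_zero
  map_add' p q := by simp [fromBlocks_add]

theorem continuous_diagHom (n : ℕ) : Continuous (diagHom n) :=
  Continuous.matrix_fromBlocks continuous_fst continuous_const continuous_const continuous_snd

theorem expNeg_diagElt {n : ℕ} (α : Matrix (Fin n) (Fin n) ℝ) (t : ℝ) :
    expNeg (diagElt α) t
      = fromBlocks (toC (NormedSpace.exp (-(t • α)))) 0 0
          (toC (NormedSpace.exp (-(t • α))))⁻¹ᵀ := by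
  have hC : ∀ β : Matrix (Fin n) (Fin n) ℝ, toC (NormedSpace.exp β) = NormedSpace.exp (toC β) :=
    fun β => NormedSpace.map_exp (Complex.ofRealHom.mapMatrix :
      Matrix (Fin n) (Fin n) ℝ →+* CMat n)
      (Continuous.matrix_map continuous_id Complex.continuous_ofReal) β
  have h1 := NormedSpace.map_exp (diagHom n) (continuous_diagHom n)
    (toC (-(t • α)), (toC (t • α))ᵀ)
  have h2 : diagHom n (toC (-(t • α)), (toC (t • α))ᵀ) = t • (-(diagElt α)) := by
    show fromBlocks _ 0 0 _ = _
    ext i j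
    rcases i with i | i <;> rcases j with j | j <;> simp
  have h3 : (NormedSpace.exp (toC (-(t • α)), (toC (t • α))ᵀ) : CMat n × CMat n)
      = (toC (NormedSpace.exp (-(t • α))), (toC (NormedSpace.exp (-(t • α))))⁻¹ᵀ) := by
    refine Prod.ext ?_ ?_
    · exact (Prod.fst_exp _).trans (hC _).symm
    · have e : toC (t • α) = -toC (-(t • α)) := by ext i j; simp
      refine (Prod.snd_exp _).trans ?_
      simp only
      rw [hC, ← Matrix.exp_neg, ← e, ← Matrix.exp_transpose]
      rfl
  rw [expNeg_eq, ← h2]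
  exact h1.symm.trans (congrArg (diagHom n) h3)

end

/-- The matrix by which `exp(-tX)`, `X = (α, 0; 0, -αᵗ)`, acts: `z ↦ R z Rᵗ`. -/
def diagExp {n : ℕ} (α : Matrix (Fin n) (Fin n) ℝ) (t : ℝ) : Matrix (Fin n) (Fin n) ℝ :=
  NormedSpace.exp (-(t • α))

theorem isUnit_diagExp {n : ℕ} (α : Matrix (Fin n) (Fin n) ℝ) (t : ℝ) :
    IsUnit (diagExp α t) := Matrix.isUnit_exp _

theorem isUnit_toC {n : ℕ} {R : Matrix (Fin n) (Fin n) ℝ} (h : IsUnit R) : IsUnit (toC R) :=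
  h.map (Complex.ofRealHom.mapMatrix : Matrix (Fin n) (Fin n) ℝ →+* CMat n)

theorem denom_diagElt {n : ℕ} (α : Matrix (Fin n) (Fin n) ℝ) (t : ℝ) (z : CMat n) :
    denom (expNeg (diagElt α) t) z = (toC (diagExp α t))⁻¹ᵀ := by
  rw [expNeg_diagElt, denom, toBlocks_fromBlocks₂₁, toBlocks_fromBlocks₂₂, zero_mul, zero_add]
  rfl

theorem act_diagElt {n : ℕ} (α : Matrix (Fin n) (Fin n) ℝ) (t : ℝ) (z : CMat n) :
    act (expNeg (diagElt α) t) z = toC (diagExp α t) * z * (toC (diagExp α t))ᵀ := by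
  have h : IsUnit (toC (diagExp α t)).det :=
    (Matrix.isUnit_iff_isUnit_det _).1 (isUnit_toC (isUnit_diagExp α t))
  rw [act, denom_diagElt, ← Matrix.transpose_nonsing_inv, Matrix.nonsing_inv_nonsing_inv _ h,
    expNeg_diagElt, toBlocks_fromBlocks₁₁, toBlocks_fromBlocks₁₂, add_zero]
  rfl

theorem map_re_toC_mul {n : ℕ} (R : Matrix (Fin n) (Fin n) ℝ) (z : CMat n) :
    (toC R * z * (toC R)ᵀ).map Complex.re = R * z.map Complex.re * Rᵀ := by
  ext i j
  simp [Matrix.mul_apply]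

theorem act_diagElt_mem {n : ℕ} (α : Matrix (Fin n) (Fin n) ℝ) (t : ℝ) {z : CMat n}
    (hz : z ∈ tube n) : act (expNeg (diagElt α) t) z ∈ tube n := by
  rw [act_diagElt]
  refine ⟨?_, ?_⟩
  · rw [transpose_mul, transpose_mul, transpose_transpose, hz.1, Matrix.mul_assoc]
  · rw [map_re_toC_mul]
    exact hz.2.mul_mul_conjTranspose_same
      (Matrix.vecMul_injective_iff_isUnit.2 (isUnit_diagExp α t))

theorem diagExp_add {n : ℕ} (α : Matrix (Fin n) (Fin n) ℝ) (s t : ℝ) :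
    diagExp α (s + t) = diagExp α s * diagExp α t := by
  rw [diagExp, add_smul, neg_add, Matrix.exp_add_of_commute]
  · rfl
  · exact (((Commute.refl α).smul_left s).smul_right t).neg_left.neg_right

theorem toC_mul {n : ℕ} (R S : Matrix (Fin n) (Fin n) ℝ) : toC (R * S) = toC R * toC S :=
  Matrix.map_mul (f := Complex.ofRealHom)

theorem act_diagElt_add {n : ℕ} (α : Matrix (Fin n) (Fin n) ℝ) (s t : ℝ) (z : CMat n) :
    act (expNeg (diagElt α) (s + t)) z
      = act (expNeg (diagElt α) t) (act (expNeg (diagElt α) s) z) := by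
  rw [act_diagElt, act_diagElt, act_diagElt, add_comm, diagExp_add, toC_mul, transpose_mul]
  simp only [Matrix.mul_assoc]

theorem logDenom_diagElt {n : ℕ} (α : Matrix (Fin n) (Fin n) ℝ) (z w : CMat n) :
    logDenom (diagElt α) z = logDenom (diagElt α) w := by
  have h : IsLogDenom (diagElt α) z = IsLogDenom (diagElt α) w := by
    funext l
    simp only [IsLogDenom, denom_diagElt]
  rw [logDenom, h, logDenom]

theorem logDenom_diagElt_add {n : ℕ} (α : Matrix (Fin n) (Fin n) ℝ) (s t : ℝ) (z : CMat n) :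
    logDenom (diagElt α) z (s + t) = logDenom (diagElt α) z s + logDenom (diagElt α) z t := by
  rw [logDenom_diagElt α z (zpt 0)]
  obtain ⟨hc, h0, he⟩ := isLogDenom_logDenom (diagElt_mem α) (0 : Freq n)
  have := continuous_log_unique (l := fun t => logDenom (diagElt α) (zpt 0) (s + t))
    (m := fun t => logDenom (diagElt α) (zpt 0) s + logDenom (diagElt α) (zpt 0) t)
    (by fun_prop) (by fun_prop) (by simp [h0]) (fun t => by
      rw [Complex.exp_add, he, he, he]
      simp only [denom_diagElt]
      rw [add_comm, diagExp_add, toC_mul, Matrix.mul_inv_rev, transpose_mul, det_mul, mul_comm])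
  exact congrFun this t

/-- The orbit of a point of an orbit is a translate of the orbit: for the linear action of the
block diagonal elements the cocycle is multiplicative in `t` and does not depend on the point. -/
theorem IsOrbit.shift {n : ℕ} {ν : ℝ} {α : Matrix (Fin n) (Fin n) ℝ} {f : L2 n ν}
    {u : ℝ → L2 n ν} (hu : IsOrbit (diagElt α) f u) (s : ℝ) :
    IsOrbit (diagElt α) (u s) fun t => u (s + t) := by
  intro t z hz
  simp only
  rw [hu (s + t) hz, piExp, piExp, hu s (act_diagElt_mem α t hz), piExp, add_comm s t,
    act_diagElt_add, logDenom_diagElt_add, mul_add, Complex.exp_add, ← mul_assoc,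
    logDenom_diagElt α (act _ z) z]

/-! ### The transposed vector field -/

/-- The linear vector field `x ↦ xα + αᵗx` on `Sym(n, ℝ)`, as twice the symmetric part of `xα`. -/
def dirField {n : ℕ} (α : Matrix (Fin n) (Fin n) ℝ) : SymMat n →L[ℝ] SymMat n :=
  LinearMap.toContinuousLinearMap
    { toFun := fun x => symPart ((2 : ℝ) • (mat x * α))
      map_add' := fun x y => by
        have : mat (x + y) = mat x + mat y := rfl
        ext p
        induction p using Sym2.ind with
        | _ i j =>
          simp [symPart, this, add_mul]
          ring
      map_smul' := fun r x => by
        have : mat (r • x) = r • mat x := rfl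
        ext p
        induction p using Sym2.ind with
        | _ i j =>
          simp [symPart, this]
          ring }

theorem mat_dirField {n : ℕ} (α : Matrix (Fin n) (Fin n) ℝ) (x : SymMat n) :
    mat (dirField α x) = mat x * α + αᵀ * mat x := by
  have : mat (dirField α x) = mat (symPart ((2 : ℝ) • (mat x * α))) := rfl
  rw [this, mat_symPart, transpose_smul, transpose_mul, mat_transpose, ← smul_add, smul_smul]
  norm_num

theorem cmat_dirField {n : ℕ} (α : Matrix (Fin n) (Fin n) ℝ) (x : SymMat n) :
    cmat (dirField α x) = cmat x * toC α + (toC α)ᵀ * cmat x := by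
  rw [cmat, mat_dirField]
  ext i j
  simp [Matrix.mul_apply, cmat]

/-- The first order operator transposed to `λ_ν` of a block diagonal element. -/
def transOp {n : ℕ} (ν : ℝ) (α : Matrix (Fin n) (Fin n) ℝ) (ψ : SymMat n → ℂ) (x : SymMat n) : ℂ :=
  -((ν * α.trace : ℝ) : ℂ) * ψ x - fderiv ℝ ψ x (dirField α x)

theorem dualOp_diag {n : ℕ} (ν : ℝ) (α : Matrix (Fin n) (Fin n) ℝ) (ψ : SymMat n → ℂ) :
    dualOp ν (toC α) 0 0 ψ = transOp ν α ψ := by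
  funext x
  have h1 : (nabla (fun y => (0 : CMat n) * grad ψ y) x) = 0 := by
    ext i j
    simp [nabla, D]
  have h2 : (toC α).trace = ((α.trace : ℝ) : ℂ) := by simp [Matrix.trace]
  rw [dualOp, transOp, h1, ← trace_grad_mul, cmat_dirField, h2, trace_mul_comm (grad ψ x)]
  simp

theorem IsTest.transOp {n : ℕ} (ν : ℝ) (α : Matrix (Fin n) (Fin n) ℝ) {ψ : SymMat n → ℂ}
    (hψ : IsTest ψ) : IsTest (transOp ν α ψ) := by
  have h1 : ContDiff ℝ ∞ fun x => fderiv ℝ ψ x (dirField α x) :=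
    (hψ.1.fderiv_right (m := ∞) (by simp)).clm_apply (dirField α).contDiff
  have h2 : HasCompactSupport fun x => fderiv ℝ ψ x (dirField α x) :=
    (hψ.2.fderiv (𝕜 := ℝ)).mono fun x hx => by
      contrapose! hx
      simp only [Function.mem_support, not_not] at hx ⊢
      simp [hx]
  exact ⟨(contDiff_const.mul hψ.1).sub h1, hψ.2.mul_left.sub h2⟩

/-- Along the orbit of a block diagonal element every derivative in `t` is, weakly, given by the
first order operator `transOp`. -/
theorem integral_test_mul_iteratedDeriv_succ {n : ℕ} {ν : ℝ} (hν : ((n : ℝ) - 1) / 2 < ν)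
    {α : Matrix (Fin n) (Fin n) ℝ} {f : L2 n ν} {u : ℝ → L2 n ν}
    (hu : IsOrbit (diagElt α) f u) (hsm : ContDiff ℝ ∞ u) (j : ℕ) :
    ∀ (t : ℝ) {ψ : SymMat n → ℂ}, IsTest ψ →
      ∫ x, ψ x * iteratedDeriv (j + 1) u t x ∂(mu n ν)
        = ∫ x, transOp ν α ψ x * iteratedDeriv j u t x ∂(mu n ν) := by
  have hd : ∀ j t, HasDerivAt (iteratedDeriv j u) (iteratedDeriv (j + 1) u t) t := fun j t => by
    rw [iteratedDeriv_succ]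
    exact (hsm.differentiable_iteratedDeriv j
      (by exact_mod_cast ENat.natCast_lt_top j) t).hasDerivAt
  induction j with
  | zero =>
    intro t ψ hψ
    have hm : fromBlocks (toC α) 0 0 (-(toC α)ᵀ) ∈ gReal n := diagElt_mem α
    have h1 := hd 0 t
    rw [iteratedDeriv_zero] at h1
    have h2 : HasDerivAt (fun s => u (t + s)) (iteratedDeriv (0 + 1) u t) 0 := by
      have h3 := HasDerivAt.comp_const_add t (0 : ℝ) (by rw [add_zero]; exact h1)
      exact h3
    rw [integral_test_mul_deriv_orbit hν hm (hu.shift t) h2 hψ, dualOp_diag, iteratedDeriv_zero]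
  | succ j ih =>
    intro t ψ hψ
    have h1 := hasDerivAt_integral_mul (hψ.memLp hν) (hd (j + 1) t)
    have h2 := hasDerivAt_integral_mul ((hψ.transOp ν α).memLp hν) (hd j t)
    refine h1.unique (h2.congr_of_eventuallyEq (Filter.Eventually.of_forall fun s => ?_))
    exact ih s hψ

/-! ### Oscillatory integrals along an orbit -/

/-- The phase `B(ξ, x) = ∑ ξ_p x_p`, as a linear form in `x`. -/
def phase {n : ℕ} (ξ : Freq n) : SymMat n →L[ℝ] ℝ :=
  ∑ p, ξ p • ContinuousLinearMap.proj p

theorem phase_apply {n : ℕ} (ξ : Freq n) (x : SymMat n) : phase ξ x = ∑ p, ξ p * x p := by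
  simp [phase]

theorem phase_smul {n : ℕ} (r : ℝ) (ξ : Freq n) (x : SymMat n) :
    phase (r • ξ) x = r * phase ξ x := by
  simp [phase_apply, Finset.mul_sum, mul_assoc]

/-- The oscillating exponential `e^{-2πi B(ξ, x)}`. -/
def osc {n : ℕ} (ξ : Freq n) (x : SymMat n) : ℂ :=
  Complex.exp (((-2 * Real.pi * phase ξ x : ℝ) : ℂ) * Complex.I)

theorem norm_osc {n : ℕ} (ξ : Freq n) (x : SymMat n) : ‖osc ξ x‖ = 1 :=
  Complex.norm_exp_ofReal_mul_I _

theorem contDiff_osc {n : ℕ} (ξ : Freq n) : ContDiff ℝ ∞ (osc ξ) :=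
  ((Complex.ofRealCLM.contDiff.comp (contDiff_const.mul (phase ξ).contDiff)).mul
    contDiff_const).cexp

theorem fderiv_osc {n : ℕ} (ξ : Freq n) (x v : SymMat n) :
    fderiv ℝ (osc ξ) x v = osc ξ x * (((-2 * Real.pi * phase ξ v : ℝ) : ℂ) * Complex.I) := by
  have h1 : HasFDerivAt (osc ξ) (fderiv ℝ (osc ξ) x) x :=
    ((contDiff_osc ξ).differentiable (by simp)).differentiableAt.hasFDerivAt
  have h2 := h1.hasLineDerivAt v
  refine HasDerivAt.unique h2 ?_
  have e : ∀ t : ℝ, (((-2 * Real.pi * phase ξ (x + t • v) : ℝ) : ℂ) * Complex.I)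
      = ((-2 * Real.pi * phase ξ x : ℝ) : ℂ) * Complex.I
        + (t : ℂ) * (((-2 * Real.pi * phase ξ v : ℝ) : ℂ) * Complex.I) := by
    intro t
    rw [map_add, map_smul, smul_eq_mul]
    push_cast
    ring
  simp only [osc, e]
  have h3 := ((((hasDerivAt_id (0 : ℝ)).ofReal_comp).mul_const
    (((-2 * Real.pi * phase ξ v : ℝ) : ℂ) * Complex.I)).const_add
      (((-2 * Real.pi * phase ξ x : ℝ) : ℂ) * Complex.I)).cexp
  simpa using h3

theorem transOp_mul_osc {n : ℕ} (ν : ℝ) (α : Matrix (Fin n) (Fin n) ℝ) {η : SymMat n → ℂ}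
    (hη : ContDiff ℝ ∞ η) (ξ : Freq n) (x : SymMat n) :
    transOp ν α (fun y => η y * osc ξ y) x = transOp ν α η x * osc ξ x
      + 2 * Real.pi * Complex.I * (phase ξ (dirField α x) * η x * osc ξ x) := by
  have h := fderiv_fun_mul (𝕜 := ℝ) (hη.differentiable (by simp) x)
    ((contDiff_osc ξ).differentiable (by simp) x)
  rw [transOp, transOp, h]
  simp only [_root_.add_apply, _root_.smul_apply, smul_eq_mul, fderiv_osc]
  push_cast
  ring

/-- The amplitude produced by one integration by parts: the operator `transOp` in the first
variable. -/
theorem contDiff_transOp_left {n : ℕ} (ν : ℝ) (α : Matrix (Fin n) (Fin n) ℝ)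
    {η : SymMat n × Freq n → ℂ} (hη : ContDiff ℝ ∞ η) :
    ContDiff ℝ ∞ fun p : SymMat n × Freq n => transOp ν α (fun x => η (x, p.2)) p.1 := by
  have e : ∀ p : SymMat n × Freq n, fderiv ℝ (fun x => η (x, p.2)) p.1 (dirField α p.1)
      = fderiv ℝ η p (dirField α p.1, 0) := fun p => by
    have h1 : HasFDerivAt (fun x : SymMat n => (x, p.2))
      (ContinuousLinearMap.inl ℝ (SymMat n) (Freq n)) p.1 := hasFDerivAt_prodMk_left _ _
    have h2 : HasFDerivAt η (fderiv ℝ η p) (p.1, p.2) :=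
      (hη.differentiable (by simp) p).hasFDerivAt
    have h3 : HasFDerivAt (fun x => η (x, p.2)) _ p.1 := h2.comp p.1 h1
    rw [h3.fderiv]
    rfl
  simp only [transOp, e]
  refine (contDiff_const.mul hη).sub ((hη.fderiv_right (m := ∞) (by simp)).clm_apply ?_)
  exact ((dirField α).contDiff.comp contDiff_fst).prodMk contDiff_const

theorem tsupport_transOp_left {n : ℕ} (ν : ℝ) (α : Matrix (Fin n) (Fin n) ℝ)
    (η : SymMat n × Freq n → ℂ) :
    tsupport (fun p : SymMat n × Freq n => transOp ν α (fun x => η (x, p.2)) p.1)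
      ⊆ tsupport η := by
  refine closure_minimal (fun p hp => ?_) (isClosed_tsupport η)
  by_contra hn
  have h0 : η =ᶠ[nhds p] 0 := notMem_tsupport_iff_eventuallyEq.1 hn
  have h1 : (fun x => η (x, p.2)) =ᶠ[nhds p.1] fun _ => 0 := by
    have : Filter.Tendsto (fun x : SymMat n => (x, p.2)) (nhds p.1) (nhds p) :=
      (Continuous.prodMk_left p.2).tendsto p.1
    exact this.eventually h0
  apply hp
  simp only [transOp]
  rw [h1.fderiv_eq, h1.eq_of_nhds]
  simp

theorem isTest_left {n : ℕ} {η : SymMat n × Freq n → ℂ} (hη : ContDiff ℝ ∞ η)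
    (hc : HasCompactSupport η) (ξ : Freq n) : IsTest fun x => η (x, ξ) := by
  refine ⟨hη.comp (contDiff_id.prodMk contDiff_const), ?_⟩
  refine HasCompactSupport.intro (hc.image continuous_fst) fun x hx => ?_
  by_contra h
  exact hx ⟨(x, ξ), subset_tsupport _ h, rfl⟩

/-- Repeated integration by parts: if the phase is not stationary in the direction of the orbit on
the support of the amplitude, then the oscillatory integrals of all derivatives along the orbit
decay faster than any power of the frequency. -/
theorem oscillation_decay {n : ℕ} {ν : ℝ} (hν : ((n : ℝ) - 1) / 2 < ν)
    {α : Matrix (Fin n) (Fin n) ℝ} {F : ℕ → L2 n ν}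
    (hF : ∀ (j : ℕ) {ψ : SymMat n → ℂ}, IsTest ψ →
      ∫ x, ψ x * F (j + 1) x ∂(mu n ν) = ∫ x, transOp ν α ψ x * F j x ∂(mu n ν)) (k : ℕ) :
    ∀ (j : ℕ) {η : SymMat n × Freq n → ℂ}, ContDiff ℝ ∞ η → HasCompactSupport η →
      (∀ p ∈ tsupport η, phase p.2 (dirField α p.1) ≠ 0) →
      ∃ C : ℝ, ∀ (ξ : Freq n) (r : ℝ), 0 < r →
        r ^ k * ‖∫ x, η (x, ξ) * osc (r • ξ) x * F j x ∂(mu n ν)‖ ≤ C := by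
  induction k with
  | zero =>
    intro j η hη hc _
    have h1 : Continuous fun p : SymMat n × Freq n => η p * (Real.exp ((mat p.1).trace) : ℂ) :=
      hη.continuous.mul (Complex.continuous_ofReal.comp
        ((continuous_trace_mat n).comp continuous_fst).rexp)
    obtain ⟨C, hC⟩ := h1.bounded_above_of_compact_support hc.mul_right
    have hE : MemLp (fun x : SymMat n => ((Real.exp (-(1 * (mat x).trace)) : ℝ) : ℂ)) 2
        (mu n ν) := by
      refine memLp_of_norm_le_exp hν (δ := 1) (C := 1) ?_ one_pos fun x hx => ?_
      · exact (Complex.continuous_ofReal.comp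
          ((continuous_trace_mat n).const_mul 1).neg.rexp).aestronglyMeasurable
      · rw [Complex.norm_real, Real.norm_of_nonneg (Real.exp_nonneg _)]
        exact (one_mul _).ge
    refine ⟨∫ x, C * ‖((Real.exp (-(1 * (mat x).trace)) : ℝ) : ℂ) * F j x‖ ∂(mu n ν),
      fun ξ r _ => ?_⟩
    rw [pow_zero, one_mul]
    refine norm_integral_le_of_norm_le ((integrable_mul_L2 hE (F j)).norm.const_mul C)
      (Filter.Eventually.of_forall fun x => ?_)
    have h2 := hC (x, ξ)
    rw [norm_mul, Complex.norm_real, Real.norm_of_nonneg (Real.exp_nonneg _)] at h2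
    rw [norm_mul, norm_mul, norm_osc, mul_one, norm_mul, Complex.norm_real,
      Real.norm_of_nonneg (Real.exp_nonneg _), ← mul_assoc, one_mul]
    refine mul_le_mul_of_nonneg_right ?_ (norm_nonneg _)
    rwa [Real.exp_neg, ← div_eq_mul_inv, le_div_iff₀ (Real.exp_pos _)]
  | succ k ih =>
    intro j η hη hc hq
    set q : SymMat n × Freq n → ℂ := fun p => (phase p.2 (dirField α p.1) : ℂ) with hqd
    have hqs : ContDiff ℝ ∞ q := by
      have : ∀ p : SymMat n × Freq n, q p = ((∑ i, p.2 i * dirField α p.1 i : ℝ) : ℂ) :=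
        fun p => by rw [hqd]; simp only [phase_apply]
      rw [funext this]
      suffices hsum : ContDiff ℝ ∞ fun p : SymMat n × Freq n => ∑ i, p.2 i * dirField α p.1 i from
        Complex.ofRealCLM.contDiff.comp hsum
      refine ContDiff.sum fun i _ => ContDiff.mul ?_ ?_
      · exact ((PiLp.proj 2 (fun _ : Sym2 (Fin n) => ℝ) i : Freq n →L[ℝ] ℝ).contDiff).comp
          contDiff_snd
      · exact (contDiff_apply ℝ ℝ i).comp ((dirField α).contDiff.comp contDiff_fst)
    have hq' : ∀ p ∈ tsupport η, q p ≠ 0 := fun p hp => Complex.ofReal_ne_zero.2 (hq p hp)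
    -- the amplitude divided by the derivative of the phase
    set η₁ : SymMat n × Freq n → ℂ := fun p => η p / q p with hη₁d
    have hη₁ : ContDiff ℝ ∞ η₁ := by
      refine contDiff_iff_contDiffAt.2 fun p => ?_
      by_cases hp : p ∈ tsupport η
      · simp only [hη₁d, div_eq_mul_inv]
        exact hη.contDiffAt.mul (hqs.contDiffAt.inv (hq' p hp))
      · have h0 : η =ᶠ[nhds p] 0 := notMem_tsupport_iff_eventuallyEq.1 hp
        refine (contDiffAt_const (c := (0 : ℂ))).congr_of_eventuallyEq ?_
        filter_upwards [h0] with y hy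
        simp [hη₁d, hy]
    have hts : tsupport η₁ ⊆ tsupport η :=
      closure_mono fun p hp => by
        contrapose! hp
        simp only [Function.mem_support, not_not] at hp ⊢
        simp [hη₁d, hp]
    have hc₁ : HasCompactSupport η₁ := hc.of_isClosed_subset (isClosed_tsupport _) hts
    set η₂ : SymMat n × Freq n → ℂ := fun p => transOp ν α (fun x => η₁ (x, p.2)) p.1 with hη₂d
    have hη₂ : ContDiff ℝ ∞ η₂ := contDiff_transOp_left ν α hη₁
    have hts₂ : tsupport η₂ ⊆ tsupport η₁ := tsupport_transOp_left ν α η₁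
    have hc₂ : HasCompactSupport η₂ := hc₁.of_isClosed_subset (isClosed_tsupport _) hts₂
    obtain ⟨C₁, hC₁⟩ := ih (j + 1) hη₁ hc₁ fun p hp => hq p (hts hp)
    obtain ⟨C₂, hC₂⟩ := ih j hη₂ hc₂ fun p hp => hq p (hts (hts₂ hp))
    refine ⟨C₁ + C₂, fun ξ r hr => ?_⟩
    have hT₁ := isTest_left hη₁ hc₁ ξ
    have hT₂ := isTest_left hη₂ hc₂ ξ
    have hT := isTest_left hη hc ξ
    have hmul : ∀ {ψ : SymMat n → ℂ}, IsTest ψ → IsTest fun x => ψ x * osc (r • ξ) x :=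
      fun hψ => ⟨hψ.1.mul (contDiff_osc _), hψ.2.mul_right⟩
    have key := hF j (hmul hT₁)
    have e1 : ∀ x, transOp ν α (fun y => η₁ (y, ξ) * osc (r • ξ) y) x * F j x
        = η₂ (x, ξ) * osc (r • ξ) x * F j x
          + 2 * Real.pi * Complex.I * r * (η (x, ξ) * osc (r • ξ) x * F j x) := by
      intro x
      have e2 : q (x, ξ) * η₁ (x, ξ) = η (x, ξ) := by
        by_cases hp : (x, ξ) ∈ tsupport η
        · exact mul_div_cancel₀ _ (hq' _ hp)
        · simp [hη₁d, image_eq_zero_of_notMem_tsupport hp]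
      rw [transOp_mul_osc ν α hT₁.1, phase_smul, ← e2]
      simp only [hη₂d, hqd]
      push_cast
      ring
    simp only [e1] at key
    rw [integral_add, integral_const_mul] at key
    rotate_left
    · exact integrable_mul_L2 ((hmul hT₂).memLp hν) (F j)
    · exact (integrable_mul_L2 ((hmul hT).memLp hν) (F j)).const_mul _
    have h1 := hC₁ ξ r hr
    have h2 := hC₂ ξ r hr
    set I₁ := ∫ x, η₁ (x, ξ) * osc (r • ξ) x * F (j + 1) x ∂(mu n ν)
    set I₂ := ∫ x, η₂ (x, ξ) * osc (r • ξ) x * F j x ∂(mu n ν)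
    set I := ∫ x, η (x, ξ) * osc (r • ξ) x * F j x ∂(mu n ν)
    have h3 : 2 * Real.pi * Complex.I * r * I = I₁ - I₂ := by rw [key]; ring
    have h4 : 2 * Real.pi * r * ‖I‖ ≤ ‖I₁‖ + ‖I₂‖ := by
      have := norm_sub_le I₁ I₂
      rw [← h3] at this
      simpa [abs_of_pos hr, abs_of_pos Real.pi_pos] using this
    have h5 : r * ‖I‖ ≤ ‖I₁‖ + ‖I₂‖ := by
      refine le_trans ?_ h4
      have : (1 : ℝ) ≤ 2 * Real.pi := by have := Real.pi_gt_three; linarith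
      rw [mul_assoc]
      exact le_mul_of_one_le_left (by positivity) this
    calc r ^ (k + 1) * ‖I‖ = r ^ k * (r * ‖I‖) := by ring
      _ ≤ r ^ k * (‖I₁‖ + ‖I₂‖) := by gcongr
      _ ≤ C₁ + C₂ := by rw [mul_add]; exact add_le_add h1 h2

/-- The direction field of `ω = freqMat ξ` is not annihilated by the frequency `ξ`, since
`tr(ω(xω + ωx)) = 2 tr(ωxω) > 0`. -/
theorem phase_dirField_ne_zero {n : ℕ} {ξ : Freq n} (hξ : ξ ≠ 0) {x : SymMat n}
    (hx : x ∈ cone n) : phase ξ (dirField (mat (freqMat ξ)) x) ≠ 0 := by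
  set w := freqMat ξ with hw
  have htr : ∀ y : SymMat n, (mat w * mat y).trace = -(2 * Real.pi * phase ξ y) := fun y => by
    have := trace_freqMat_mul ξ y
    rw [← phase_apply] at this
    have h2 : ((mat w * mat y).trace : ℂ) = (cmat w * cmat y).trace := by
      simp [Matrix.trace, Matrix.mul_apply, cmat]
    rw [← h2] at this
    exact_mod_cast this
  have hw0 : w ≠ 0 := by
    intro h0
    have h1 := htr (WithLp.ofLp ξ)
    rw [h0, phase_apply] at h1
    have h2 : (mat (0 : SymMat n)) = 0 := rfl
    rw [h2, zero_mul, trace_zero] at h1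
    have h3 : ∑ p, ξ p * ξ p = 0 := by
      have : (2 * Real.pi) * ∑ p, ξ p * ξ p = 0 := by linarith
      exact (mul_eq_zero.1 this).resolve_left (by positivity)
    refine hξ ?_
    ext p
    have := (Finset.sum_eq_zero_iff_of_nonneg fun p _ => mul_self_nonneg (ξ p)).1 h3 p
      (Finset.mem_univ p)
    simpa using this
  have hpos : 0 < (mat w * mat x * mat w).trace := by
    have hq := (mem_cone_iff x).1 hx
    have e : (mat w * mat x * mat w).trace
        = ∑ k, ∑ i, ∑ j, w s(k, i) * x s(i, j) * w s(k, j) := by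
      simp only [Matrix.trace, Matrix.diag, Matrix.mul_apply, mat_apply, Finset.sum_mul]
      refine Finset.sum_congr rfl fun k _ => ?_
      rw [Finset.sum_comm]
      refine Finset.sum_congr rfl fun i _ => Finset.sum_congr rfl fun j _ => ?_
      rw [Sym2.eq_swap (a := j) (b := k)]
    rw [e]
    obtain ⟨p, hp⟩ := Function.ne_iff.1 hw0
    induction p using Sym2.ind with
    | _ k l =>
      refine Finset.sum_pos' (fun i _ => ?_) ⟨k, Finset.mem_univ k, ?_⟩
      · by_cases h0 : (fun j => w s(i, j)) = 0
        · have : ∀ j, w s(i, j) = 0 := fun j => congrFun h0 j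
          simp [this]
        · exact (hq _ h0).le
      · exact hq (fun j => w s(k, j)) fun h0 => hp (congrFun h0 l)
  intro h0
  have h1 := htr (dirField (mat w) x)
  rw [h0, mat_dirField, mat_transpose, mul_add, trace_add, ← Matrix.mul_assoc,
    trace_mul_comm (mat w) (mat w * mat x)] at h1
  linarith

/-- Near a frequency on the unit sphere the Fourier transform of a localized smooth vector decays
rapidly. -/
theorem local_decay {n : ℕ} {ν : ℝ} (hν : ((n : ℝ) - 1) / 2 < ν) {f : L2 n ν}
    (hf : IsSmoothVector f) {φ : SymMat n → ℂ} (hφ : IsTest φ) (hs : tsupport φ ⊆ cone n)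
    (k : ℕ) {ξ₀ : Freq n} (hξ₀ : ξ₀ ≠ 0) :
    ∃ U ∈ nhds ξ₀, ∃ C : ℝ, ∀ ξ ∈ U, ∀ r : ℝ, 0 < r →
      r ^ k * ‖∫ x, φ x * osc (r • ξ) x * f x ∂(mu n ν)‖ ≤ C := by
  set α := mat (freqMat ξ₀)
  obtain ⟨u, hu, hsm⟩ := hf _ (diagElt_mem α)
  have hu0 : u 0 = f := by
    refine laplace_injective hν fun z hz => ?_
    have hl : logDenom (diagElt α) z 0 = 0 := by
      rw [logDenom_diagElt α z (zpt 0)]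
      exact (isLogDenom_logDenom (diagElt_mem α) (0 : Freq n)).2.1
    rw [hu 0 hz, piExp, hl, act_expNeg_zero]
    simp
  have hcq : Continuous fun p : SymMat n × Freq n => phase p.2 (dirField α p.1) := by
    simp only [phase_apply]
    refine continuous_finsetSum _ fun i _ => Continuous.mul ?_ ?_
    · exact (PiLp.continuous_apply 2 _ i).comp continuous_snd
    · exact (continuous_apply i).comp ((dirField α).continuous.comp continuous_fst)
  have hopen : IsOpen {p : SymMat n × Freq n | phase p.2 (dirField α p.1) ≠ 0} :=
    isOpen_ne_fun hcq continuous_const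
  obtain ⟨V, W, -, hW, hV, hξW, hVW⟩ := generalized_tube_lemma (s := tsupport φ) (t := {ξ₀})
    hφ.2 isCompact_singleton hopen (by
      rintro ⟨x, ξ⟩ ⟨hx, hξ⟩
      rw [Set.mem_singleton_iff] at hξ
      subst hξ
      exact phase_dirField_ne_zero hξ₀ (hs hx))
  obtain ⟨ε, hε, hεW⟩ := Metric.isOpen_iff.1 hW ξ₀ (hξW rfl)
  let χ : ContDiffBump ξ₀ := ⟨ε / 4, ε / 2, by positivity, by linarith⟩
  set η : SymMat n × Freq n → ℂ := fun p => φ p.1 * (χ p.2 : ℂ) with hη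
  have hts : tsupport η ⊆ tsupport φ ×ˢ Metric.closedBall ξ₀ (ε / 2) := by
    refine closure_minimal (fun p hp => ?_) ((isClosed_tsupport φ).prod Metric.isClosed_closedBall)
    have h1 : φ p.1 ≠ 0 := fun h => hp (by simp [hη, h])
    have h2 : χ p.2 ≠ 0 := fun h => hp (by simp [hη, h])
    refine ⟨subset_tsupport _ h1, ?_⟩
    have : p.2 ∈ Function.support χ := h2
    rw [χ.support_eq] at this
    exact Metric.ball_subset_closedBall this
  obtain ⟨C, hC⟩ := oscillation_decay hν (F := fun j => iteratedDeriv j u 0)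
    (fun j _ hψ => integral_test_mul_iteratedDeriv_succ hν hu hsm j 0 hψ) k 0 (η := η)
    ((hφ.1.comp contDiff_fst).mul
      (Complex.ofRealCLM.contDiff.comp (χ.contDiff.comp contDiff_snd)))
    ((hφ.2.prod (isCompact_closedBall _ _)).of_isClosed_subset (isClosed_tsupport _) hts)
    fun p hp => hVW ⟨hV (hts hp).1, hεW (Metric.closedBall_subset_ball (by linarith) (hts hp).2)⟩
  refine ⟨Metric.closedBall ξ₀ (ε / 4), Metric.closedBall_mem_nhds _ (by positivity), C,
    fun ξ hξ r hr => ?_⟩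
  have h1 := hC ξ r hr
  have h2 : χ ξ = 1 := χ.one_of_mem_closedBall hξ
  simp only [hη, h2, Complex.ofReal_one, mul_one, iteratedDeriv_zero, hu0] at h1
  exact h1

/-- The Fourier transform of a localized smooth vector decays rapidly. -/
theorem fourier_decay {n : ℕ} {ν : ℝ} (hν : ((n : ℝ) - 1) / 2 < ν) {f : L2 n ν}
    (hf : IsSmoothVector f) {φ : SymMat n → ℂ} (hφ : IsTest φ) (hs : tsupport φ ⊆ cone n)
    (k : ℕ) : ∃ C : ℝ, ∀ ζ : Freq n,
      ‖ζ‖ ^ k * ‖∫ x, φ x * osc ζ x * f x ∂(mu n ν)‖ ≤ C := by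
  have hcomp : IsCompact (Metric.sphere (0 : Freq n) 1) := isCompact_sphere _ _
  obtain ⟨C, hC⟩ : ∃ C : ℝ, ∀ ξ ∈ Metric.sphere (0 : Freq n) 1, ∀ r : ℝ, 0 < r →
      r ^ k * ‖∫ x, φ x * osc (r • ξ) x * f x ∂(mu n ν)‖ ≤ C := by
    refine hcomp.induction_on (p := fun U => ∃ C : ℝ, ∀ ξ ∈ U, ∀ r : ℝ, 0 < r →
      r ^ k * ‖∫ x, φ x * osc (r • ξ) x * f x ∂(mu n ν)‖ ≤ C) ?_ ?_ ?_ ?_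
    · exact ⟨0, fun _ h => h.elim⟩
    · rintro s t hst ⟨C, hC⟩
      exact ⟨C, fun ξ hξ => hC ξ (hst hξ)⟩
    · rintro s t ⟨C, hC⟩ ⟨C', hC'⟩
      refine ⟨max C C', fun ξ hξ r hr => ?_⟩
      rcases hξ with hξ | hξ
      · exact (hC ξ hξ r hr).trans (le_max_left _ _)
      · exact (hC' ξ hξ r hr).trans (le_max_right _ _)
    · intro ξ hξ
      have h0 : ξ ≠ 0 := by
        rintro rfl
        simp at hξ
      obtain ⟨U, hU, h⟩ := local_decay hν hf hφ hs k h0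
      exact ⟨U, mem_nhdsWithin_of_mem_nhds hU, h⟩
  refine ⟨max C ‖∫ x, φ x * osc (0 : Freq n) x * f x ∂(mu n ν)‖, fun ζ => ?_⟩
  rcases eq_or_ne ζ 0 with rfl | hζ
  · refine le_trans ?_ (le_max_right _ _)
    refine mul_le_of_le_one_left (norm_nonneg _) ?_
    rw [norm_zero]
    exact pow_le_one₀ le_rfl zero_le_one
  · refine le_trans ?_ (le_max_left _ _)
    have hr : 0 < ‖ζ‖ := norm_pos_iff.2 hζ
    have := hC (‖ζ‖⁻¹ • ζ) (by simp [norm_smul, hr.ne']) ‖ζ‖ hr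
    rwa [smul_smul, mul_inv_cancel₀ hr.ne', one_smul] at this

/-! ### The smooth representative -/

/-- Fourier inversion almost everywhere, for integrable functions with integrable Fourier
transform. -/
theorem ae_eq_fourierInv_fourier {V : Type*} [NormedAddCommGroup V] [InnerProductSpace ℝ V]
    [FiniteDimensional ℝ V] [MeasurableSpace V] [BorelSpace V] {h : V → ℂ} (hh : Integrable h)
    (hF : Integrable (𝓕 h)) : ∀ᵐ v, h v = 𝓕⁻ (𝓕 h) v := by
  have hcont : Continuous (𝓕⁻ (𝓕 h)) := by
    rw [funext (Real.fourierInv_eq_fourier_neg (𝓕 h))]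
    refine Continuous.comp ?_ continuous_neg
    exact VectorFourier.fourierIntegral_continuous Real.continuous_fourierChar
      continuous_inner hF
  refine ae_eq_of_integral_contDiff_smul_eq hh.locallyIntegrable hcont.locallyIntegrable
    fun g hg hc => ?_
  set S : SchwartzMap V ℂ := HasCompactSupport.toSchwartzMap
    (f := fun v => (g v : ℂ)) (hc.comp_left Complex.ofReal_zero)
    (Complex.ofRealCLM.contDiff.comp hg) with hS
  set R : SchwartzMap V ℂ := 𝓕⁻ S with hR
  have hSR : 𝓕 (R : V → ℂ) = S := by
    rw [← SchwartzMap.fourier_coe, hR, FourierTransform.fourier_fourierInv_eq]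
  have hRS : 𝓕⁻ (S : V → ℂ) = R := by
    rw [← SchwartzMap.fourierInv_coe]
  have h1 : ∫ v, 𝓕 (R : V → ℂ) v • h v = ∫ v, R v • 𝓕 h v := by
    have := VectorFourier.integral_fourierIntegral_smul_eq_flip (μ := volume) (ν := volume)
      (L := innerₗ V) Real.continuous_fourierChar continuous_inner R.integrable hh
    rw [flip_innerₗ] at this
    exact this
  have h2 : ∫ v, 𝓕⁻ (S : V → ℂ) v • 𝓕 h v = ∫ v, S v • 𝓕⁻ (𝓕 h) v := by
    have := VectorFourier.integral_fourierIntegral_smul_eq_flip (μ := volume) (ν := volume)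
      (L := -innerₗ V) Real.continuous_fourierChar continuous_inner.neg S.integrable hF
    have hf : (-innerₗ V).flip = -innerₗ V := by
      ext v w
      simp [real_inner_comm]
    rw [hf] at this
    exact this
  rw [hSR] at h1
  rw [hRS] at h2
  have e : ∀ v, S v = (g v : ℂ) := fun v => rfl
  simp only [e, ← Complex.coe_smul] at h1 h2 ⊢
  rw [h1, h2]

/-- The density `det(x)^(ν - (n+1)/2)`, with complex values. -/
def dens {n : ℕ} (ν : ℝ) (x : SymMat n) : ℂ :=
  (((mat x).det ^ (ν - ((n : ℝ) + 1) / 2) : ℝ) : ℂ)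

theorem contDiffOn_dens (n : ℕ) (ν : ℝ) : ContDiffOn ℝ ∞ (dens ν) (cone n) := fun x hx => by
  have h : ContDiffAt ℝ ∞ (fun x : SymMat n => (mat x).det ^ (ν - ((n : ℝ) + 1) / 2)) x :=
    (contDiff_det_mat n).contDiffAt.rpow_const_of_ne (det_pos_of_mem_cone hx).ne'
  exact (Complex.ofRealCLM.contDiff.contDiffAt.comp x h).contDiffWithinAt

theorem dens_ne_zero {n : ℕ} {x : SymMat n} (hx : x ∈ cone n) (ν : ℝ) : dens ν x ≠ 0 :=
  Complex.ofReal_ne_zero.2 (Real.rpow_pos_of_pos (det_pos_of_mem_cone hx) _).ne'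

theorem integral_mu {n : ℕ} (ν : ℝ) (g : SymMat n → ℂ) :
    ∫ x, g x ∂(mu n ν) = ∫ x in cone n, dens ν x * g x := by
  rw [mu, integral_withDensity_eq_integral_toReal_smul (measurable_density n _)
    (Filter.Eventually.of_forall fun _ => ENNReal.ofReal_lt_top)]
  refine setIntegral_congr_fun (measurableSet_cone n) fun x hx => ?_
  rw [ENNReal.toReal_ofReal (Real.rpow_pos_of_pos (det_pos_of_mem_cone hx) _).le,
    Complex.real_smul, dens]

theorem integrable_mu_iff {n : ℕ} (ν : ℝ) (g : SymMat n → ℂ) :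
    Integrable g (mu n ν) ↔ IntegrableOn (fun x => dens ν x * g x) (cone n) := by
  rw [mu, integrable_withDensity_iff_integrable_smul' (measurable_density n _)
    (Filter.Eventually.of_forall fun _ => ENNReal.ofReal_lt_top)]
  refine integrableOn_congr_fun (fun x hx => ?_) (measurableSet_cone n)
  rw [ENNReal.toReal_ofReal (Real.rpow_pos_of_pos (det_pos_of_mem_cone hx) _).le,
    Complex.real_smul, dens]

theorem mu_absolutelyContinuous (n : ℕ) (ν : ℝ) :
    mu n ν ≪ (volume : Measure (SymMat n)).restrict (cone n) :=
  withDensity_absolutelyContinuous _ _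

/-- A localized smooth vector, times the density, agrees almost everywhere with a smooth function,
obtained by Fourier inversion. -/
theorem exists_contDiff_localized {n : ℕ} {ν : ℝ} (hν : ((n : ℝ) - 1) / 2 < ν) {f : L2 n ν}
    (hf : IsSmoothVector f) {φ : SymMat n → ℂ} (hφ : IsTest φ) (hs : tsupport φ ⊆ cone n) :
    ∃ h₀ : SymMat n → ℂ, ContDiff ℝ ∞ h₀ ∧
      ∀ᵐ x, x ∈ cone n → dens ν x * (φ x * f x) = h₀ x := by
  set H : SymMat n → ℂ := (cone n).indicator fun x => dens ν x * (φ x * f x) with hH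
  have hHi : Integrable H :=
    ((integrable_mu_iff ν _).1 (integrable_mul_L2 (hφ.memLp hν) f)).integrable_indicator
      (measurableSet_cone n)
  have hmp := PiLp.volume_preserving_ofLp (Sym2 (Fin n))
  have hemb : MeasurableEmbedding (@WithLp.ofLp 2 (Sym2 (Fin n) → ℝ)) :=
    (MeasurableEquiv.toLp 2 (Sym2 (Fin n) → ℝ)).symm.measurableEmbedding
  set h : Freq n → ℂ := fun v => H (WithLp.ofLp v) with hh
  have hhi : Integrable h := (hmp.integrable_comp_emb hemb).2 hHi
  have hFh : ∀ ζ : Freq n, 𝓕 h ζ = ∫ x, φ x * osc ζ x * f x ∂(mu n ν) := by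
    intro ζ
    rw [Real.fourier_eq', integral_mu, ← integral_indicator (measurableSet_cone n)]
    rw [← hmp.integral_comp hemb]
    refine integral_congr_ae (Filter.Eventually.of_forall fun v => ?_)
    have hin : inner ℝ v ζ = phase ζ (WithLp.ofLp v) := by
      simp [PiLp.inner_apply, phase_apply]
    simp only [hh, hH, hin, smul_eq_mul]
    by_cases hv : WithLp.ofLp v ∈ cone n
    · rw [Set.indicator_of_mem hv, Set.indicator_of_mem hv, osc]
      ring
    · rw [Set.indicator_of_notMem hv, Set.indicator_of_notMem hv, mul_zero]
  have hFc : Continuous (𝓕 h) :=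
    VectorFourier.fourierIntegral_continuous Real.continuous_fourierChar continuous_inner hhi
  have hpow : ∀ k : ℕ, Integrable fun ζ : Freq n => ‖ζ‖ ^ k * ‖𝓕 h ζ‖ := fun k => by
    obtain ⟨C₁, hC₁⟩ := fourier_decay hν hf hφ hs 0
    obtain ⟨C₂, hC₂⟩ := fourier_decay hν hf hφ hs
      (k + (volume : Measure (Freq n)).integrablePower)
    refine integrable_of_le_of_pow_mul_le (C₁ := C₁) (C₂ := C₂) (fun ζ => ?_) (fun ζ => ?_)
      hFc.aestronglyMeasurable
    · rw [hFh]
      simpa using hC₁ ζ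
    · rw [hFh]
      exact hC₂ ζ
  have hFi : Integrable (𝓕 h) := by
    have := hpow 0
    simp only [pow_zero, one_mul] at this
    exact (integrable_norm_iff hFc.aestronglyMeasurable).1 this
  have hsm : ContDiff ℝ ∞ (𝓕⁻ (𝓕 h)) := by
    rw [funext (Real.fourierInv_eq_fourier_neg (𝓕 h))]
    exact (Real.contDiff_fourier (N := ⊤) fun k _ => hpow k).comp contDiff_neg
  refine ⟨fun x => 𝓕⁻ (𝓕 h) (WithLp.toLp 2 x),
    hsm.comp (PiLp.continuousLinearEquiv 2 ℝ (fun _ : Sym2 (Fin n) => ℝ)).symm.contDiff, ?_⟩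
  have hae := (PiLp.volume_preserving_toLp (Sym2 (Fin n))).quasiMeasurePreserving.ae
    (ae_eq_fourierInv_fourier hhi hFi)
  filter_upwards [hae] with x hx hxc
  rw [← hx]
  simp only [hh, hH]
  rw [Set.indicator_of_mem hxc]

/-- A smooth vector is locally a smooth function. -/
theorem exists_local_representative {n : ℕ} {ν : ℝ} (hν : ((n : ℝ) - 1) / 2 < ν) {f : L2 n ν}
    (hf : IsSmoothVector f) {y : SymMat n} (hy : y ∈ cone n) :
    ∃ δ > 0, Metric.ball y δ ⊆ cone n ∧ ∃ g : SymMat n → ℂ,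
      ContDiffOn ℝ ∞ g (Metric.ball y δ) ∧ f =ᵐ[volume.restrict (Metric.ball y δ)] g := by
  obtain ⟨ε, hε, hεc⟩ := Metric.isOpen_iff.1 (isOpen_cone n) y hy
  let χ : ContDiffBump y := ⟨ε / 4, ε / 2, by positivity, by linarith⟩
  have hball : Metric.ball y (ε / 4) ⊆ cone n :=
    (Metric.ball_subset_ball (by linarith)).trans hεc
  have hts : tsupport (fun x => (χ x : ℂ)) ⊆ cone n := by
    refine (closure_mono ?_).trans (?_ : tsupport χ ⊆ cone n)
    · intro x hx h0
      exact hx (by simp [h0])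
    · rw [χ.tsupport_eq]
      exact (Metric.closedBall_subset_ball (by show ε / 2 < ε; linarith)).trans hεc
  obtain ⟨h₀, hsm, hae⟩ := exists_contDiff_localized hν hf (φ := fun x => (χ x : ℂ))
    ⟨Complex.ofRealCLM.contDiff.comp χ.contDiff,
      χ.hasCompactSupport.comp_left Complex.ofReal_zero⟩ hts
  refine ⟨ε / 4, by positivity, hball, fun x => h₀ x * (dens ν x)⁻¹, ?_, ?_⟩
  · intro x hx
    have := (contDiffOn_dens n ν).contDiffAt ((isOpen_cone n).mem_nhds (hball hx))
    exact (hsm.contDiffAt.mul (this.inv (dens_ne_zero (hball hx) ν))).contDiffWithinAt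
  · filter_upwards [ae_restrict_of_ae hae, ae_restrict_mem Metric.isOpen_ball.measurableSet]
      with x hx hxb
    have h1 : χ x = 1 := χ.one_of_mem_closedBall (Metric.ball_subset_closedBall hxb)
    rw [← hx (hball hxb), h1, Complex.ofReal_one, one_mul, mul_comm (dens ν x),
      mul_inv_cancel_right₀ (dens_ne_zero (hball hxb) ν)]

/-- A smooth vector has a smooth representative: the local ones agree on overlaps. -/
theorem exists_smooth_representative {n : ℕ} {ν : ℝ} (hν : ((n : ℝ) - 1) / 2 < ν) {f : L2 n ν}
    (hf : IsSmoothVector f) :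
    ∃ f₀ : SymMat n → ℂ, ContDiffOn ℝ ∞ f₀ (cone n) ∧ f =ᵐ[mu n ν] f₀ := by
  choose! δ hδ hball g hg hfg using fun (y : SymMat n) (hy : y ∈ cone n) =>
    exists_local_representative hν hf hy
  have hloc : ∀ y ∈ cone n, Set.EqOn (fun x => g x x) (g y) (Metric.ball y (δ y)) := by
    intro y hy x hx
    have hxc := hball y hy hx
    have hopen : IsOpen (Metric.ball y (δ y) ∩ Metric.ball x (δ x)) :=
      Metric.isOpen_ball.inter Metric.isOpen_ball
    have h1 : g x =ᵐ[volume.restrict (Metric.ball y (δ y) ∩ Metric.ball x (δ x))] g y :=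
      ((hfg x hxc).filter_mono
        (ae_mono (Measure.restrict_mono Set.inter_subset_right le_rfl))).symm.trans
        ((hfg y hy).filter_mono (ae_mono (Measure.restrict_mono Set.inter_subset_left le_rfl)))
    exact Measure.eqOn_open_of_ae_eq h1 hopen
      ((hg x hxc).continuousOn.mono Set.inter_subset_right)
      ((hg y hy).continuousOn.mono Set.inter_subset_left) ⟨hx, Metric.mem_ball_self (hδ x hxc)⟩
  refine ⟨fun x => g x x, fun y hy => ?_, ?_⟩
  · have hn : Metric.ball y (δ y) ∈ nhds y := Metric.ball_mem_nhds y (hδ y hy)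
    refine (((hg y hy).contDiffAt hn).congr_of_eventuallyEq ?_).contDiffWithinAt
    filter_upwards [hn] with x hx using hloc y hy hx
  · refine (mu_absolutelyContinuous n ν).ae_le ?_
    refine (ae_restrict_iff' (measurableSet_cone n)).2 (ae_iff.2 ?_)
    refine measure_null_of_locally_null _ fun y hy => ?_
    have hyc : y ∈ cone n := by
      by_contra h
      exact hy fun h' => (h h').elim
    have h1 := ae_iff.1 ((ae_restrict_iff' Metric.isOpen_ball.measurableSet).1 (hfg y hyc))
    refine ⟨_, inter_mem_nhdsWithin _ (Metric.ball_mem_nhds y (hδ y hyc)), measure_mono_null ?_ h1⟩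
    rintro x ⟨hx, hxb⟩ h2
    refine hx fun _ => ?_
    rw [h2 hxb]
    exact (hloc y hyc hxb).symm

/-! ### Integration by parts on the cone -/

theorem IsTest.contDiffOn_mul {n : ℕ} {h ψ : SymMat n → ℂ} (hψ : IsTest ψ)
    (hs : tsupport ψ ⊆ cone n) (hh : ContDiffOn ℝ ∞ h (cone n)) : IsTest fun x => h x * ψ x := by
  refine ⟨contDiff_iff_contDiffAt.2 fun x => ?_, hψ.2.mul_left⟩
  by_cases hx : x ∈ tsupport ψ
  · exact (hh.contDiffAt ((isOpen_cone n).mem_nhds (hs hx))).mul hψ.1.contDiffAt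
  · refine (contDiffAt_const (c := (0 : ℂ))).congr_of_eventuallyEq ?_
    filter_upwards [notMem_tsupport_iff_eventuallyEq.1 hx] with y hy
    simp [hy]

theorem tsupport_mul_left {n : ℕ} (h ψ : SymMat n → ℂ) :
    tsupport (fun x => h x * ψ x) ⊆ tsupport ψ :=
  closure_mono fun x hx h0 => hx (by simp [h0])

theorem contDiffOn_fderiv {n : ℕ} {h : SymMat n → ℂ} (hh : ContDiffOn ℝ ∞ h (cone n))
    {v : SymMat n → SymMat n} (hv : ContDiff ℝ ∞ v) :
    ContDiffOn ℝ ∞ (fun x => fderiv ℝ h x (v x)) (cone n) :=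
  (hh.fderiv_of_isOpen (isOpen_cone n) (by simp)).clm_apply hv.contDiffOn

theorem IsTest.integrable {n : ℕ} {ψ : SymMat n → ℂ} (hψ : IsTest ψ) : Integrable ψ :=
  hψ.1.continuous.integrable_of_hasCompactSupport hψ.2

theorem integrable_contDiffOn_mul {n : ℕ} (ν : ℝ) {h ψ : SymMat n → ℂ}
    (hh : ContDiffOn ℝ ∞ h (cone n)) (hψ : IsTest ψ) (hs : tsupport ψ ⊆ cone n) :
    Integrable (fun x => h x * ψ x) (mu n ν) := by
  rw [integrable_mu_iff]
  refine Integrable.integrableOn ?_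
  have := (hψ.contDiffOn_mul hs ((contDiffOn_dens n ν).mul hh)).integrable
  refine this.congr (Filter.Eventually.of_forall fun x => ?_)
  simp only [mul_assoc]

theorem IsTest.fderiv_apply {n : ℕ} {ψ : SymMat n → ℂ} (hψ : IsTest ψ)
    {v : SymMat n → SymMat n} (hv : ContDiff ℝ ∞ v) : IsTest fun x => fderiv ℝ ψ x (v x) :=
  ⟨(hψ.1.fderiv_right (m := ∞) (by simp)).clm_apply hv,
    (hψ.2.fderiv (𝕜 := ℝ)).mono fun x hx h0 => hx (by simp [h0])⟩

theorem tsupport_fderiv_apply {n : ℕ} (ψ : SymMat n → ℂ) (v : SymMat n → SymMat n) :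
    tsupport (fun x => fderiv ℝ ψ x (v x)) ⊆ tsupport ψ :=
  Set.Subset.trans (closure_mono fun x hx (h0 : fderiv ℝ ψ x = 0) => hx (by simp [h0]))
    (tsupport_fderiv_subset ℝ)

/-- The derivative of a power of the determinant along the vector field `xα + αᵗx`. -/
theorem fderiv_dens_dirField {n : ℕ} (ν : ℝ) (α : Matrix (Fin n) (Fin n) ℝ) {x : SymMat n}
    (hx : x ∈ cone n) : fderiv ℝ (dens ν) x (dirField α x)
      = (((2 * ν - (n + 1)) * α.trace : ℝ) : ℂ) * dens ν x := by
  set v := dirField α x with hv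
  -- `det(x + tv) = det x · det(1 + tM)` with `M = x⁻¹v`, and `tr M = 2 tr α`
  have hdet : IsUnit (mat x).det := (det_pos_of_mem_cone hx).ne'.isUnit
  set M := (mat x)⁻¹ * mat v with hM
  have htr : M.trace = 2 * α.trace := by
    rw [hM, hv, mat_dirField, mul_add, ← Matrix.mul_assoc, Matrix.nonsing_inv_mul _ hdet, one_mul,
      trace_add, trace_mul_comm, Matrix.mul_assoc, Matrix.mul_nonsing_inv _ hdet, mul_one,
      trace_transpose]
    ring
  have hγ : HasDerivAt (fun t : ℝ => (1 : CMat n) + t • toC M) (toC M) 0 := by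
    refine hasDerivAt_matrix fun i j => ?_
    have := (((hasDerivAt_id (0 : ℝ)).ofReal_comp).mul_const (toC M i j)).const_add
      ((1 : CMat n) i j)
    simpa using this
  have h1 := hasDerivAt_det hγ (by simp)
  have h2 : HasDerivAt (fun t : ℝ => (mat (x + t • v)).det) ((mat x).det * (2 * α.trace)) 0 := by
    have h3 := Complex.reCLM.hasFDerivAt.comp_hasDerivAt (0 : ℝ) h1
    have h4 := h3.const_mul (mat x).det
    have e1 : Complex.reCLM (toC M).trace = 2 * α.trace := by
      rw [← htr]
      simp [Matrix.trace]
    rw [e1] at h4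
    refine h4.congr_of_eventuallyEq (Filter.Eventually.of_forall fun t => ?_)
    have e2 : mat (x + t • v) = mat x * (1 + t • M) := by
      have : mat (x + t • v) = mat x + t • mat v := rfl
      rw [this, hM, mul_add, mul_one, mul_smul_comm, ← Matrix.mul_assoc,
        Matrix.mul_nonsing_inv _ hdet, one_mul]
    have e3 : (1 : CMat n) + t • toC M = toC (1 + t • M) := by
      ext i j
      by_cases h : i = j <;> simp [h]
    have e4 : (toC (1 + t • M)).det = (((1 + t • M).det : ℝ) : ℂ) :=
      (RingHom.map_det Complex.ofRealHom (1 + t • M)).symm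
    simp only [Function.comp_apply, e3, e4]
    rw [e2, det_mul, Complex.reCLM_apply, Complex.ofReal_re]
  have h5 := (h2.rpow_const (p := ν - ((n : ℝ) + 1) / 2)
    (Or.inl (by simpa using (det_pos_of_mem_cone hx).ne'))).ofReal_comp
  have h6 := ((((contDiffOn_dens n ν).contDiffAt ((isOpen_cone n).mem_nhds hx)).differentiableAt
    (by simp)).hasFDerivAt).hasLineDerivAt v
  refine (HasDerivAt.unique h6 h5).trans ?_
  rw [zero_smul, add_zero, Real.rpow_sub_one (det_pos_of_mem_cone hx).ne', dens]
  rw [← Complex.ofReal_mul]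
  congr 1
  field_simp [(det_pos_of_mem_cone hx).ne']

/-- The divergence of the vector field `xα + αᵗx` is `(n + 1) tr α`. -/
theorem integral_fderiv_dirField {n : ℕ} (α : Matrix (Fin n) (Fin n) ℝ) {G : SymMat n → ℂ}
    (hG : IsTest G) :
    ∫ x, fderiv ℝ G x (dirField α x) = -((((n : ℝ) + 1) * α.trace : ℝ) : ℂ) * ∫ x, G x := by
  set L : Fin n → Fin n → SymMat n →L[ℝ] ℂ := fun i j =>
    Complex.ofRealCLM.comp ((ContinuousLinearMap.proj s(j, i)).comp (dirField α)) with hL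
  have e : ∀ x, fderiv ℝ G x (dirField α x)
      = ∑ i, ∑ j, L i j x * fderiv ℝ G x (symPart (Matrix.single i j 1)) := by
    intro x
    conv_lhs => rw [← symPart_sum (dirField α x)]
    simp [hL, mat_apply]
  have hT : ∀ i j, IsTest fun x => L i j x * fderiv ℝ G x (symPart (Matrix.single i j 1)) :=
    fun i j => by
      have := hG.fderiv_apply (v := fun _ => symPart (Matrix.single i j 1)) contDiff_const
      exact ⟨(L i j).contDiff.mul this.1, this.2.mul_left⟩
  have hi : ∀ i j, ∫ x, L i j x * fderiv ℝ G x (symPart (Matrix.single i j 1))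
      = -(L i j (symPart (Matrix.single i j 1)) * ∫ x, G x) := by
    intro i j
    rw [integral_mul_fderiv_eq_neg_fderiv_mul_of_integrable]
    · simp only [ContinuousLinearMap.fderiv]
      rw [integral_const_mul]
    · simp only [ContinuousLinearMap.fderiv]
      exact hG.integrable.const_mul _
    · exact (hT i j).integrable
    · have : IsTest fun x => L i j x * G x := ⟨(L i j).contDiff.mul hG.1, hG.2.mul_left⟩
      exact this.integrable
    · exact fun x _ => (L i j).differentiableAt
    · exact fun x _ => hG.1.differentiable (by simp) x
  simp only [e]
  rw [integral_finsetSum _ fun i _ => integrable_finsetSum _ fun j _ => (hT i j).integrable]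
  have e2 : ∀ i, ∫ x, ∑ j, L i j x * fderiv ℝ G x (symPart (Matrix.single i j 1))
      = ∑ j, -(L i j (symPart (Matrix.single i j 1)) * ∫ x, G x) := fun i => by
    rw [integral_finsetSum _ fun j _ => (hT i j).integrable]
    exact Finset.sum_congr rfl fun j _ => hi i j
  simp only [e2, Finset.sum_neg_distrib, ← Finset.sum_mul]
  rw [neg_mul]
  congr 2
  have e3 : ∀ i j, L i j (symPart (Matrix.single i j 1))
      = (((if i = j then α i i else 0) + (α i i + α j j) / 2 : ℝ) : ℂ) := by
    intro i j
    have h1 : L i j (symPart (Matrix.single i j 1))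
        = (mat (dirField α (symPart (Matrix.single i j 1))) j i : ℝ) := rfl
    rw [h1, mat_dirField, mat_symPart]
    congr 1
    by_cases h : i = j
    · subst h
      have hs : (1 / 2 : ℝ) • (Matrix.single i i (1 : ℝ) + (Matrix.single i i (1 : ℝ))ᵀ)
          = Matrix.single i i 1 := by
        rw [transpose_single, ← two_smul ℝ, smul_smul]
        norm_num
      rw [hs]
      simp
    · simp [Matrix.add_apply, Matrix.mul_apply, Matrix.single_apply, h, Ne.symm h]
      ring
  simp only [e3, ← Complex.ofReal_sum]
  congr 1
  simp only [Finset.sum_add_distrib, Finset.sum_ite_eq, Finset.mem_univ, if_true,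
    ← Finset.sum_div, Finset.sum_const, Finset.card_univ, Fintype.card_fin, nsmul_eq_mul,
    Matrix.trace, Matrix.diag, ← Finset.mul_sum]
  ring

/-- Integration by parts with respect to `μ_ν` along the vector field `xα + αᵗx`. -/
theorem integral_mul_fderiv_dirField {n : ℕ} (ν : ℝ) (α : Matrix (Fin n) (Fin n) ℝ)
    {g ψ : SymMat n → ℂ} (hg : ContDiffOn ℝ ∞ g (cone n)) (hψ : IsTest ψ)
    (hs : tsupport ψ ⊆ cone n) :
    ∫ x, g x * fderiv ℝ ψ x (dirField α x) ∂(mu n ν)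
      = -∫ x, (fderiv ℝ g x (dirField α x) + ((2 * ν * α.trace : ℝ) : ℂ) * g x) * ψ x
          ∂(mu n ν) := by
  have hV : ContDiff ℝ ∞ (dirField α) := (dirField α).contDiff
  have hw := contDiffOn_dens n ν
  have hG := hψ.contDiffOn_mul hs (hw.mul hg)
  have h1 := integral_fderiv_dirField α hG
  have hts := tsupport_mul_left (fun x => dens ν x * g x) ψ
  rw [← setIntegral_eq_integral_of_forall_compl_eq_zero (s := cone n) (f := fun x => _ * ψ x),
    ← setIntegral_eq_integral_of_forall_compl_eq_zero (s := cone n)] at h1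
  rotate_left
  · intro x hx
    rw [image_eq_zero_of_notMem_tsupport fun h => hx (hs (hts (tsupport_fderiv_apply _ _ h)))]
  · intro x hx
    rw [image_eq_zero_of_notMem_tsupport fun h => hx (hs h), mul_zero]
  rw [integral_mu, integral_mu, eq_neg_iff_add_eq_zero, ← integral_add]
  rotate_left
  · have := integrable_contDiffOn_mul ν hg (hψ.fderiv_apply hV)
      ((tsupport_fderiv_apply _ _).trans hs)
    exact (integrable_mu_iff ν _).1 this
  · have := integrable_contDiffOn_mul ν
      ((contDiffOn_fderiv hg hV).add
        ((contDiffOn_const (c := ((2 * ν * α.trace : ℝ) : ℂ))).mul hg))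
      hψ hs
    exact (integrable_mu_iff ν _).1 this
  rw [neg_mul, eq_neg_iff_add_eq_zero, ← integral_const_mul, ← integral_add] at h1
  rotate_left
  · exact (hG.fderiv_apply hV).integrable.integrableOn
  · exact (hG.integrable.const_mul _).integrableOn
  rw [← h1]
  refine setIntegral_congr_fun (measurableSet_cone n) fun x hx => ?_
  have hn := (isOpen_cone n).mem_nhds hx
  have d1 := (hw.contDiffAt hn).differentiableAt (by simp)
  have d2 := (hg.contDiffAt hn).differentiableAt (by simp)
  have d3 := hψ.1.differentiable (by simp) x
  rw [fderiv_fun_mul (d1.fun_mul d2) d3, fderiv_fun_mul d1 d2]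
  simp only [_root_.add_apply, _root_.smul_apply, smul_eq_mul, fderiv_dens_dirField ν α hx]
  push_cast
  ring

/-- The basic integration by parts formula, `∑_j x_{ij} D_{jk}` having transpose
`-(∑_j x_{ij} D_{jk} + ν δ_{ik})` with respect to `μ_ν`. -/
theorem integral_mul_euler {n : ℕ} (ν : ℝ) (i k : Fin n)
    {g ψ : SymMat n → ℂ} (hg : ContDiffOn ℝ ∞ g (cone n)) (hψ : IsTest ψ)
    (hs : tsupport ψ ⊆ cone n) :
    ∫ x, g x * ∑ j, cmat x i j * D j k ψ x ∂(mu n ν)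
      = -∫ x, (∑ j, cmat x i j * D j k g x + (if i = k then (ν : ℂ) else 0) * g x) * ψ x
          ∂(mu n ν) := by
  have e : ∀ (h : SymMat n → ℂ) (x : SymMat n), ∑ j, cmat x i j * D j k h x
      = 1 / 2 * fderiv ℝ h x (dirField (Matrix.single i k 1) x) := by
    intro h x
    have e1 : dirField (Matrix.single i k 1) x
        = ∑ j, (2 * mat x i j) • symPart (Matrix.single j k (1 : ℝ)) := by
      ext p
      induction p using Sym2.ind with
      | _ a b =>
        have h1 : dirField (Matrix.single i k 1) x s(a, b)
          = mat (dirField (Matrix.single i k 1) x) a b := rfl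
        rw [h1, mat_dirField]
        simp [symPart, Finset.sum_apply, Matrix.single_apply, Matrix.mul_apply, ite_and, mat_apply,
          mul_add, add_div, Finset.sum_add_distrib]
        simp only [ite_div, zero_div, mul_ite, mul_zero, Finset.sum_ite_eq', Finset.mem_univ,
          if_true]
        rw [Sym2.eq_swap (a := a) (b := i)]
        split_ifs <;> ring
    rw [e1, map_sum, Finset.mul_sum]
    refine Finset.sum_congr rfl fun j _ => ?_
    rw [map_smul, D, Complex.real_smul]
    have : cmat x i j = (mat x i j : ℂ) := rfl
    rw [this]
    push_cast
    ring
  have h1 := integral_mul_fderiv_dirField ν (Matrix.single i k 1) hg hψ hs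
  have e2 : (Matrix.single i k (1 : ℝ)).trace = if i = k then 1 else 0 := by
    by_cases h : i = k <;> simp [h]
  have e3 : (if i = k then (ν : ℂ) else 0)
      = 1 / 2 * ((2 * ν * (Matrix.single i k (1 : ℝ)).trace : ℝ) : ℂ) := by
    rw [e2]; split_ifs <;> simp
  simp only [e, e3, mul_left_comm (_ : ℂ) (1 / 2 : ℂ), mul_assoc (1 / 2 : ℂ), ← mul_add]
  rw [integral_const_mul, integral_const_mul, h1, mul_neg]

/-! ### The transpose of the weak form -/

/-- The differential operator
`tr[νa + bx + (xa + aᵗx - νc)∇ - x∇c∇]` attached to `(a, b; c, -aᵗ)`. -/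
def diffOp {n : ℕ} (ν : ℝ) (a b c : CMat n) (g : SymMat n → ℂ) (x : SymMat n) : ℂ :=
  (ν * a.trace + (b * cmat x).trace) * g x
    + ((cmat x * a + aᵀ * cmat x - (ν : ℂ) • c) * grad g x).trace
    - (cmat x * nabla (fun y => c * grad g y) x).trace

/-- The entries `∑_j x_{ij} D_{jk}` of the matrix `x∇`. -/
def euler {n : ℕ} (i k : Fin n) (g : SymMat n → ℂ) (x : SymMat n) : ℂ :=
  ∑ j, cmat x i j * D j k g x

theorem D_comm {n : ℕ} (i j : Fin n) (g : SymMat n → ℂ) : D i j g = D j i g := by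
  have : symPart (Matrix.single i j (1 : ℝ)) = symPart (Matrix.single j i 1) := by
    ext p
    induction p using Sym2.ind with
    | _ c d =>
      simp only [symPart, Matrix.single_apply, Sym2.lift_mk]
      rw [add_comm]
      simp only [and_comm]
  funext x
  rw [D, this, D]

theorem cmat_comm {n : ℕ} (x : SymMat n) (i j : Fin n) : cmat x i j = cmat x j i := by
  rw [cmat_apply, cmat_apply, Sym2.eq_swap]

theorem trace_first_order {n : ℕ} (a : CMat n) (g : SymMat n → ℂ) (x : SymMat n) :
    ((cmat x * a + aᵀ * cmat x) * grad g x).trace = 2 * ∑ i, ∑ k, a i k * euler i k g x := by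
  have hg : (grad g x)ᵀ = grad g x := by
    ext i j
    exact congrFun (D_comm j i g) x
  have h1 : (cmat x * a * grad g x).trace = (aᵀ * cmat x * grad g x).trace := by
    rw [← trace_transpose, transpose_mul, transpose_mul, hg, cmat_transpose, trace_mul_comm]
  have h2 : (aᵀ * cmat x * grad g x).trace = ∑ i, ∑ k, a i k * euler i k g x := by
    rw [Matrix.mul_assoc, Finset.sum_comm]
    simp only [Matrix.trace, Matrix.diag, Matrix.mul_apply, transpose_apply, euler, grad,
      Matrix.of_apply]
  rw [add_mul, trace_add, h1, h2, two_mul]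

theorem trace_const_mul_grad {n : ℕ} (c : CMat n) (g : SymMat n → ℂ) (x : SymMat n) :
    (c * grad g x).trace = ∑ k, ∑ l, c k l * D l k g x := trace_mul_grad c g x

theorem trace_second_order {n : ℕ} (c : CMat n) {g : SymMat n → ℂ} {x : SymMat n}
    (hg : ∀ i j, DifferentiableAt ℝ (D i j g) x) :
    (cmat x * nabla (fun y => c * grad g y) x).trace
      = ∑ k, ∑ l, c k l * ∑ i, euler i k (D l i g) x := by
  rw [trace_mul_nabla _ _ hg]
  simp only [euler, Finset.mul_sum]
  rw [Finset.sum_congr rfl fun i _ => Finset.sum_comm, Finset.sum_comm]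
  refine Finset.sum_congr rfl fun k _ => ?_
  rw [Finset.sum_congr rfl fun i _ => Finset.sum_comm, Finset.sum_comm]
  refine Finset.sum_congr rfl fun l _ => Finset.sum_congr rfl fun i _ =>
    Finset.sum_congr rfl fun j _ => ?_
  ring

theorem dualOp_eq {n : ℕ} (ν : ℝ) (a b c : CMat n) {ψ : SymMat n → ℂ} (hψ : ContDiff ℝ ∞ ψ)
    (x : SymMat n) :
    dualOp ν a b c ψ x = ((b * cmat x).trace - ν * a.trace) * ψ x
      - 2 * ∑ i, ∑ k, a i k * euler i k ψ x - ν * ∑ k, ∑ l, c k l * D l k ψ x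
      - ∑ k, ∑ l, c k l * ∑ i, euler i k (D l i ψ) x := by
  rw [dualOp, add_mul, trace_add, trace_first_order, smul_mul_assoc, trace_smul,
    trace_const_mul_grad, trace_second_order c fun i j =>
      (contDiff_D hψ i j).differentiable (by simp) x, smul_eq_mul]
  ring

theorem diffOp_eq {n : ℕ} (ν : ℝ) (a b : CMat n) {c : CMat n} (hc : cᵀ = c) {g : SymMat n → ℂ}
    {x : SymMat n} (hg : ∀ i j, DifferentiableAt ℝ (D i j g) x) :
    diffOp ν a b c g x = (ν * a.trace + (b * cmat x).trace) * g x
      + 2 * ∑ i, ∑ k, a i k * euler i k g x - ν * ∑ k, ∑ l, c k l * D l k g x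
      - ∑ k, ∑ l, c k l * ∑ j, euler j l (D j k g) x := by
  rw [diffOp, sub_mul, trace_sub, trace_first_order, smul_mul_assoc, trace_smul,
    trace_const_mul_grad, trace_second_order c hg, smul_eq_mul]
  have h : ∑ k, ∑ l, c k l * ∑ i, euler i k (D l i g) x
      = ∑ k, ∑ l, c k l * ∑ j, euler j l (D j k g) x := by
    rw [Finset.sum_comm]
    refine Finset.sum_congr rfl fun k _ => Finset.sum_congr rfl fun l _ => ?_
    have : c l k = c k l := by rw [← hc, transpose_apply, hc]
    rw [this]
    congr 1
    exact Finset.sum_congr rfl fun i _ => by rw [D_comm]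
  rw [h]
  ring

theorem contDiffOn_D {n : ℕ} {g : SymMat n → ℂ} (hg : ContDiffOn ℝ ∞ g (cone n)) (i j : Fin n) :
    ContDiffOn ℝ ∞ (D i j g) (cone n) :=
  contDiffOn_fderiv hg (v := fun _ => symPart (Matrix.single i j 1)) contDiff_const

theorem contDiff_cmat {n : ℕ} (i j : Fin n) : ContDiff ℝ ∞ fun x : SymMat n => cmat x i j :=
  Complex.ofRealCLM.contDiff.comp (contDiff_apply ℝ ℝ s(i, j))

theorem contDiffOn_euler {n : ℕ} {g : SymMat n → ℂ} (hg : ContDiffOn ℝ ∞ g (cone n))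
    (i k : Fin n) : ContDiffOn ℝ ∞ (euler i k g) (cone n) :=
  ContDiffOn.sum fun j _ => (contDiff_cmat i j).contDiffOn.mul (contDiffOn_D hg j k)

theorem IsTest.D {n : ℕ} {ψ : SymMat n → ℂ} (hψ : IsTest ψ) (i j : Fin n) :
    IsTest (D i j ψ) :=
  hψ.fderiv_apply (v := fun _ => symPart (Matrix.single i j 1)) contDiff_const

theorem tsupport_D {n : ℕ} (ψ : SymMat n → ℂ) (i j : Fin n) :
    tsupport (D i j ψ) ⊆ tsupport ψ :=
  tsupport_fderiv_apply ψ fun _ => symPart (Matrix.single i j 1)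

theorem differentiableAt_D {n : ℕ} {g : SymMat n → ℂ} (hg : ContDiffOn ℝ ∞ g (cone n))
    {x : SymMat n} (hx : x ∈ cone n) (i j : Fin n) : DifferentiableAt ℝ (D i j g) x :=
  ((contDiffOn_D hg i j).contDiffAt ((isOpen_cone n).mem_nhds hx)).differentiableAt (by simp)

theorem contDiffOn_diffOp {n : ℕ} (ν : ℝ) (a b : CMat n) {c : CMat n} (hc : cᵀ = c)
    {g : SymMat n → ℂ} (hg : ContDiffOn ℝ ∞ g (cone n)) :
    ContDiffOn ℝ ∞ (diffOp ν a b c g) (cone n) := by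
  refine ContDiffOn.congr ?_ fun x hx => diffOp_eq ν a b hc (differentiableAt_D hg hx)
  have hb : ContDiff ℝ ∞ fun x : SymMat n => (b * cmat x).trace := by
    simp only [trace_mul_cmat]
    exact ContDiff.sum fun i _ => ContDiff.sum fun j _ => contDiff_const.mul (contDiff_cmat i j)
  refine ContDiffOn.sub (ContDiffOn.sub (ContDiffOn.add ?_ ?_) ?_) ?_
  · exact (contDiff_const.add hb).contDiffOn.mul hg
  · exact contDiffOn_const.mul (ContDiffOn.sum fun i _ => ContDiffOn.sum fun k _ =>
      contDiffOn_const.mul (contDiffOn_euler hg i k))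
  · exact contDiffOn_const.mul (ContDiffOn.sum fun i _ => ContDiffOn.sum fun k _ =>
      contDiffOn_const.mul (contDiffOn_D hg k i))
  · exact ContDiffOn.sum fun i _ => ContDiffOn.sum fun k _ =>
      contDiffOn_const.mul (ContDiffOn.sum fun j _ => contDiffOn_euler (contDiffOn_D hg j i) j k)

/-- The integrand of the basic integration by parts formula. -/
def eulerForm {n : ℕ} (ν : ℝ) (i k : Fin n) (g ψ : SymMat n → ℂ) (x : SymMat n) : ℂ :=
  g x * euler i k ψ x + (euler i k g x + (if i = k then (ν : ℂ) else 0) * g x) * ψ x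

theorem integral_eulerForm {n : ℕ} (ν : ℝ) (i k : Fin n)
    {g ψ : SymMat n → ℂ} (hg : ContDiffOn ℝ ∞ g (cone n)) (hψ : IsTest ψ)
    (hs : tsupport ψ ⊆ cone n) :
    Integrable (eulerForm ν i k g ψ) (mu n ν) ∧ ∫ x, eulerForm ν i k g ψ x ∂(mu n ν) = 0 := by
  have h1 : Integrable (fun x => g x * euler i k ψ x) (mu n ν) := by
    have : ∀ j, Integrable (fun x => g x * cmat x i j * D j k ψ x) (mu n ν) := fun j =>
      integrable_contDiffOn_mul ν (hg.mul (contDiff_cmat i j).contDiffOn) (hψ.D j k)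
        ((tsupport_D ψ j k).trans hs)
    refine (integrable_finsetSum Finset.univ fun j _ => this j).congr
      (Filter.Eventually.of_forall fun x => ?_)
    simp only [euler, Finset.mul_sum, mul_assoc]
  have h2 : Integrable (fun x => (euler i k g x + (if i = k then (ν : ℂ) else 0) * g x) * ψ x)
      (mu n ν) :=
    integrable_contDiffOn_mul ν ((contDiffOn_euler hg i k).add (contDiffOn_const.mul hg)) hψ hs
  refine ⟨h1.add h2, ?_⟩
  simp only [eulerForm]
  rw [integral_add h1 h2]
  simp only [euler]
  rw [integral_mul_euler ν i k hg hψ hs, neg_add_cancel]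

/-- Applied to `g`, `D_{li}ψ` and to `D_{jk}g`, `ψ`, the integration by parts formula produces the
same terms with one derivative on each factor; in the difference they cancel. -/
theorem eulerForm_cross {n : ℕ} (ν : ℝ) (k l : Fin n) (g ψ : SymMat n → ℂ) (x : SymMat n) :
    ∑ i, eulerForm ν i k g (D l i ψ) x - ∑ j, eulerForm ν j l (D j k g) ψ x
      = g x * ∑ i, euler i k (D l i ψ) x + ν * (g x * D l k ψ x)
        - (∑ j, euler j l (D j k g) x) * ψ x - ν * (D l k g x * ψ x) := by
  have h1 : ∑ i, euler i k g x * D l i ψ x = ∑ j, D j k g x * euler j l ψ x := by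
    simp only [euler, Finset.sum_mul, Finset.mul_sum]
    rw [Finset.sum_comm]
    refine Finset.sum_congr rfl fun j _ => Finset.sum_congr rfl fun i _ => ?_
    rw [cmat_comm, D_comm l i]
    ring
  simp only [eulerForm, add_mul, Finset.sum_add_distrib, ite_mul, zero_mul, Finset.sum_ite_eq',
    Finset.mem_univ, if_true, h1, ← Finset.mul_sum, ← Finset.sum_mul]
  ring

/-- The defect of transposition is a combination of integrands with vanishing integral. -/
theorem dualOp_sub_diffOp {n : ℕ} (ν : ℝ) (a b : CMat n) {c : CMat n} (hc : cᵀ = c)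
    {g ψ : SymMat n → ℂ} (hg : ContDiffOn ℝ ∞ g (cone n)) (hψ : ContDiff ℝ ∞ ψ)
    {x : SymMat n} (hx : x ∈ cone n) :
    g x * dualOp ν a b c ψ x - diffOp ν a b c g x * ψ x
      = ∑ i, ∑ k, (-2 * a i k) * eulerForm ν i k g ψ x
        - ∑ k, ∑ l, c k l * (∑ i, eulerForm ν i k g (D l i ψ) x
            - ∑ j, eulerForm ν j l (D j k g) ψ x) := by
  rw [dualOp_eq ν a b c hψ, diffOp_eq ν a b hc (differentiableAt_D hg hx)]
  simp only [eulerForm_cross]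
  have h1 : ∑ i, ∑ k, (-2 * a i k) * eulerForm ν i k g ψ x
      = -2 * (g x * (∑ i, ∑ k, a i k * euler i k ψ x)
        + (∑ i, ∑ k, a i k * euler i k g x) * ψ x + ν * a.trace * (g x * ψ x)) := by
    have h2 : ν * a.trace * (g x * ψ x)
        = ∑ i, ∑ k, a i k * ((if i = k then (ν : ℂ) else 0) * (g x * ψ x)) := by
      simp [Matrix.trace, Finset.mul_sum, mul_comm, mul_left_comm]
    rw [h2]
    simp only [eulerForm, Finset.mul_sum, Finset.sum_mul, ← Finset.sum_add_distrib]
    refine Finset.sum_congr rfl fun i _ => Finset.sum_congr rfl fun k _ => ?_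
    ring
  have h3 : ∑ k, ∑ l, c k l * (g x * ∑ i, euler i k (D l i ψ) x + ν * (g x * D l k ψ x)
        - (∑ j, euler j l (D j k g) x) * ψ x - ν * (D l k g x * ψ x))
      = g x * (∑ k, ∑ l, c k l * ∑ i, euler i k (D l i ψ) x)
        + ν * (g x * (∑ k, ∑ l, c k l * D l k ψ x))
        - (∑ k, ∑ l, c k l * ∑ j, euler j l (D j k g) x) * ψ x
        - ν * ((∑ k, ∑ l, c k l * D l k g x) * ψ x) := by
    rw [Finset.mul_sum, Finset.mul_sum, Finset.mul_sum, Finset.sum_mul, Finset.sum_mul,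
      Finset.mul_sum, ← Finset.sum_add_distrib, ← Finset.sum_sub_distrib,
      ← Finset.sum_sub_distrib]
    refine Finset.sum_congr rfl fun k _ => ?_
    rw [Finset.mul_sum, Finset.mul_sum, Finset.mul_sum, Finset.sum_mul, Finset.sum_mul,
      Finset.mul_sum, ← Finset.sum_add_distrib, ← Finset.sum_sub_distrib,
      ← Finset.sum_sub_distrib]
    refine Finset.sum_congr rfl fun l _ => ?_
    ring
  rw [h1, h3]
  ring

/-- `diffOp` is the transpose of `dualOp` with respect to `μ_ν`. -/
theorem integral_mul_dualOp {n : ℕ} (ν : ℝ) (a b : CMat n) {c : CMat n} (hc : cᵀ = c)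
    {g ψ : SymMat n → ℂ} (hg : ContDiffOn ℝ ∞ g (cone n)) (hψ : IsTest ψ)
    (hs : tsupport ψ ⊆ cone n) :
    ∫ x, (g x * dualOp ν a b c ψ x - diffOp ν a b c g x * ψ x) ∂(mu n ν) = 0 := by
  rw [integral_congr_ae (g := fun x => ∑ i, ∑ k, (-2 * a i k) * eulerForm ν i k g ψ x
        - ∑ k, ∑ l, c k l * (∑ i, eulerForm ν i k g (D l i ψ) x
            - ∑ j, eulerForm ν j l (D j k g) ψ x)) (by
    filter_upwards [ae_mem_cone n ν] with x hx using dualOp_sub_diffOp ν a b hc hg hψ.1 hx)]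
  have h1 : ∀ i k, Integrable (fun x => (-2 * a i k) * eulerForm ν i k g ψ x) (mu n ν) ∧
      ∫ x, (-2 * a i k) * eulerForm ν i k g ψ x ∂(mu n ν) = 0 := fun i k => by
    obtain ⟨h, h'⟩ := integral_eulerForm ν i k hg hψ hs
    exact ⟨h.const_mul _, by rw [integral_const_mul, h', mul_zero]⟩
  have h2 : ∀ i k l, Integrable (eulerForm ν i k g (D l i ψ)) (mu n ν) ∧
      ∫ x, eulerForm ν i k g (D l i ψ) x ∂(mu n ν) = 0 := fun i k l =>
    integral_eulerForm ν i k hg (hψ.D l i) ((tsupport_D ψ l i).trans hs)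
  have h3 : ∀ j k l, Integrable (eulerForm ν j l (D j k g) ψ) (mu n ν) ∧
      ∫ x, eulerForm ν j l (D j k g) ψ x ∂(mu n ν) = 0 := fun j k l =>
    integral_eulerForm ν j l (contDiffOn_D hg j k) hψ hs
  have hsum : ∀ {F : Fin n → SymMat n → ℂ}, (∀ i, Integrable (F i) (mu n ν) ∧
      ∫ x, F i x ∂(mu n ν) = 0) → Integrable (fun x => ∑ i, F i x) (mu n ν) ∧
      ∫ x, ∑ i, F i x ∂(mu n ν) = 0 := fun {F} h =>
    ⟨integrable_finsetSum _ fun i _ => (h i).1, by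
      rw [integral_finsetSum _ fun i _ => (h i).1]
      exact Finset.sum_eq_zero fun i _ => (h i).2⟩
  have h4 := hsum fun i => hsum fun k => h1 i k
  have h5 : ∀ k l, Integrable (fun x => c k l * (∑ i, eulerForm ν i k g (D l i ψ) x
            - ∑ j, eulerForm ν j l (D j k g) ψ x)) (mu n ν) ∧
      ∫ x, c k l * (∑ i, eulerForm ν i k g (D l i ψ) x
            - ∑ j, eulerForm ν j l (D j k g) ψ x) ∂(mu n ν) = 0 := fun k l => by
    obtain ⟨p, p'⟩ := hsum fun i => h2 i k l
    obtain ⟨q, q'⟩ := hsum fun j => h3 j k l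
    exact ⟨(p.sub q).const_mul _, by rw [integral_const_mul, integral_sub p q, p', q']; simp⟩
  have h6 := hsum fun k => hsum fun l => h5 k l
  rw [integral_sub h4.1 h6.1, h4.2, h6.2, sub_zero]

/-! ### The derived representation of the complexified Lie algebra -/

theorem dualOp_add_smul {n : ℕ} (ν : ℝ) (a b c a' b' c' : CMat n) (w : ℂ) {ψ : SymMat n → ℂ}
    (hψ : ContDiff ℝ ∞ ψ) (x : SymMat n) :
    dualOp ν (a + w • a') (b + w • b') (c + w • c') ψ x
      = dualOp ν a b c ψ x + w * dualOp ν a' b' c' ψ x := by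
  have h1 : ∀ (p q : CMat n) (r : Fin n → Fin n → ℂ), ∑ i, ∑ k, (p + w • q) i k * r i k
      = ∑ i, ∑ k, p i k * r i k + w * ∑ i, ∑ k, q i k * r i k := fun p q r => by
    simp only [Matrix.add_apply, Matrix.smul_apply, smul_eq_mul, add_mul, Finset.sum_add_distrib,
      Finset.mul_sum, mul_assoc]
  rw [dualOp_eq ν _ _ _ hψ, dualOp_eq ν _ _ _ hψ, dualOp_eq ν _ _ _ hψ, h1, h1, h1, add_mul,
    trace_add, trace_add, smul_mul_assoc, trace_smul, trace_smul, smul_eq_mul, smul_eq_mul]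
  ring

theorem isTest_dualOp {n : ℕ} (ν : ℝ) (a b c : CMat n) {ψ : SymMat n → ℂ} (hψ : IsTest ψ) :
    IsTest (dualOp ν a b c ψ) := by
  have hb : ContDiff ℝ ∞ fun x : SymMat n => (b * cmat x).trace := by
    simp only [trace_mul_cmat]
    exact ContDiff.sum fun i _ => ContDiff.sum fun j _ => contDiff_const.mul (contDiff_cmat i j)
  have he : ∀ {φ : SymMat n → ℂ} (i k : Fin n), ContDiff ℝ ∞ φ → ContDiff ℝ ∞ (euler i k φ) :=
    fun i k h => ContDiff.sum fun j _ => (contDiff_cmat i j).mul (contDiff_D h j k)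
  refine ⟨?_, HasCompactSupport.intro hψ.2 fun x hx => ?_⟩
  · rw [funext (dualOp_eq ν a b c hψ.1)]
    refine ContDiff.sub (ContDiff.sub (ContDiff.sub ?_ ?_) ?_) ?_
    · exact (hb.sub contDiff_const).mul hψ.1
    · exact contDiff_const.mul (ContDiff.sum fun i _ => ContDiff.sum fun k _ =>
        contDiff_const.mul (he i k hψ.1))
    · exact contDiff_const.mul (ContDiff.sum fun i _ => ContDiff.sum fun k _ =>
        contDiff_const.mul (contDiff_D hψ.1 k i))
    · exact ContDiff.sum fun i _ => ContDiff.sum fun k _ =>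
        contDiff_const.mul (ContDiff.sum fun j _ => he j i (contDiff_D hψ.1 k j))
  · have h1 : ∀ i j, x ∉ tsupport (D i j ψ) := fun i j h => hx (tsupport_D ψ i j h)
    have h2 : ∀ i j, D i j ψ x = 0 := fun i j => image_eq_zero_of_notMem_tsupport (h1 i j)
    have h3 : ∀ i j k l, D i j (D k l ψ) x = 0 := fun i j k l =>
      image_eq_zero_of_notMem_tsupport fun h => h1 k l (tsupport_D _ i j h)
    rw [dualOp_eq ν a b c hψ.1]
    simp [euler, h2, h3, image_eq_zero_of_notMem_tsupport hx]

theorem partOne_fromBlocks {n : ℕ} (a b c : CMat n) :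
    partOne (fromBlocks a b c (-aᵀ)) = fromBlocks (a.map fun w => (w.re : ℂ))
      (b.map fun w => Complex.I * w.im) (c.map fun w => Complex.I * w.im)
      (-(a.map fun w => (w.re : ℂ))ᵀ) := by
  ext i j
  rcases i with i | i <;> rcases j with j | j <;> simp [partOne]

theorem partTwo_fromBlocks {n : ℕ} (a b c : CMat n) :
    partTwo (fromBlocks a b c (-aᵀ)) = fromBlocks (a.map fun w => (w.im : ℂ))
      (b.map fun w => -Complex.I * w.re) (c.map fun w => -Complex.I * w.re)
      (-(a.map fun w => (w.im : ℂ))ᵀ) := by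
  ext i j
  rcases i with i | i <;> rcases j with j | j <;> simp [partTwo]

/-- The weak form of the derived representation of `𝔤_ℂ`. -/
theorem integral_test_mul_lam {n : ℕ} {ν : ℝ} (hν : ((n : ℝ) - 1) / 2 < ν) (a : CMat n)
    {b c : CMat n} (hb : bᵀ = b) (hc : cᵀ = c) {f : L2 n ν} (hf : IsSmoothVector f)
    {ψ : SymMat n → ℂ} (hψ : IsTest ψ) :
    ∫ x, ψ x * lam (fromBlocks a b c (-aᵀ)) f x ∂(mu n ν)
      = ∫ x, dualOp ν a b c ψ x * f x ∂(mu n ν) := by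
  have hm := hψ.memLp hν
  have h1 := partOne_mem a b c hb hc
  have h2 := partTwo_mem a b c hb hc
  rw [← pairing_apply hm, lam, map_add, map_smul, pairing_apply, pairing_apply]
  rw [partOne_fromBlocks] at h1 ⊢
  rw [partTwo_fromBlocks] at h2 ⊢
  rw [integral_test_mul_lamReal hν h1 hf hψ, integral_test_mul_lamReal hν h2 hf hψ, smul_eq_mul,
    ← integral_const_mul, ← integral_add]
  · refine integral_congr_ae (Filter.Eventually.of_forall fun x => ?_)
    have ha : a = a.map (fun w => (w.re : ℂ)) + Complex.I • a.map fun w => (w.im : ℂ) := by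
      ext i j; simp [Complex.ext_iff]
    have hb' : b = b.map (fun w => Complex.I * (w.im : ℂ))
        + Complex.I • b.map fun w => -Complex.I * (w.re : ℂ) := by
      ext i j; simp [Complex.ext_iff]
    have hc' : c = c.map (fun w => Complex.I * (w.im : ℂ))
        + Complex.I • c.map fun w => -Complex.I * (w.re : ℂ) := by
      ext i j; simp [Complex.ext_iff]
    simp only
    conv_rhs => rw [ha, hb', hc', dualOp_add_smul ν _ _ _ _ _ _ _ hψ.1]
    ring
  · exact integrable_mul_L2 ((isTest_dualOp ν _ _ _ hψ).memLp hν) f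
  · exact (integrable_mul_L2 ((isTest_dualOp ν _ _ _ hψ).memLp hν) f).const_mul _

theorem isLocallyFiniteMeasure_mu {n : ℕ} {ν : ℝ} (hν : ((n : ℝ) - 1) / 2 < ν) :
    IsLocallyFiniteMeasure (mu n ν) := by
  have h1 := (integrable_exp_neg_trace hν one_pos).locallyIntegrable.continuous_smul
    (g := fun x : SymMat n => Real.exp ((mat x).trace)) (continuous_trace_mat n).rexp
  refine ⟨fun x => ?_⟩
  obtain ⟨s, hs, hi⟩ := h1 x
  refine ⟨s, hs, ?_⟩
  have h2 : IntegrableOn (fun _ : SymMat n => (1 : ℝ)) s (mu n ν) :=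
    hi.congr (Filter.Eventually.of_forall fun y => by
      simp [← Real.exp_add])
  exact ((integrableOn_const_iff (by simp)).1 h2).resolve_left (by simp)

/-- The derived representation acts on the smooth representative by `diffOp`. -/
theorem lam_ae_eq_diffOp {n : ℕ} {ν : ℝ} (hν : ((n : ℝ) - 1) / 2 < ν) (a : CMat n)
    {b c : CMat n} (hb : bᵀ = b) (hc : cᵀ = c) {f : L2 n ν} (hf : IsSmoothVector f)
    {f₀ : SymMat n → ℂ} (hf₀ : ContDiffOn ℝ ∞ f₀ (cone n)) (hff₀ : f =ᵐ[mu n ν] f₀) :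
    lam (fromBlocks a b c (-aᵀ)) f =ᵐ[mu n ν] diffOp ν a b c f₀ := by
  have := isLocallyFiniteMeasure_mu hν
  have hQ := contDiffOn_diffOp ν a b hc hf₀
  have key := (isOpen_cone n).ae_eq_zero_of_integral_contDiff_smul_eq_zero (μ := mu n ν)
    (f := fun x => lam (fromBlocks a b c (-aᵀ)) f x - diffOp ν a b c f₀ x)
    (((locallyIntegrable_L2 hν _).locallyIntegrableOn _).sub
      (hQ.continuousOn.locallyIntegrableOn (measurableSet_cone n))) fun g hg hgc hgs => ?_
  · filter_upwards [key, ae_mem_cone n ν] with x hx hxc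
    exact sub_eq_zero.1 (hx hxc)
  · set ψ : SymMat n → ℂ := fun x => (g x : ℂ) with hψd
    have hψ : IsTest ψ := ⟨Complex.ofRealCLM.contDiff.comp hg, hgc.comp_left Complex.ofReal_zero⟩
    have hs : tsupport ψ ⊆ cone n :=
      Set.Subset.trans (closure_mono fun x hx (h0 : g x = 0) => hx (by simp [hψd, h0])) hgs
    have h1 := integral_test_mul_lam hν a hb hc hf hψ
    have h2 := integral_mul_dualOp ν a b hc hf₀ hψ hs
    have i1 := integrable_mul_L2 (hψ.memLp hν) (lam (fromBlocks a b c (-aᵀ)) f)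
    have i2 := integrable_contDiffOn_mul ν hQ hψ hs
    have i3 : Integrable (fun x => f₀ x * dualOp ν a b c ψ x) (mu n ν) := by
      refine (integrable_mul_L2 ((isTest_dualOp ν a b c hψ).memLp hν) f).congr ?_
      filter_upwards [hff₀] with x hx
      rw [hx, mul_comm]
    rw [integral_sub i3 i2, sub_eq_zero] at h2
    have h3 : ∫ x, dualOp ν a b c ψ x * f x ∂(mu n ν)
        = ∫ x, f₀ x * dualOp ν a b c ψ x ∂(mu n ν) := by
      refine integral_congr_ae ?_
      filter_upwards [hff₀] with x hx
      rw [hx, mul_comm]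
    rw [integral_congr_ae (g := fun x => ψ x * lam (fromBlocks a b c (-aᵀ)) f x
      - diffOp ν a b c f₀ x * ψ x) (Filter.Eventually.of_forall fun x => by
        simp only [Complex.real_smul, hψd]; ring), integral_sub i1 i2, h1, h3, h2, sub_self]

end SymCone

end

theorem theorem5p2 (n : ℕ) (hn : 1 ≤ n) (ν : ℝ) (hν : ((n : ℝ) - 1) / 2 < ν)
    (f : L2 n ν) (hf : IsSmoothVector f) :
    ∃ f₀ : SymMat n → ℂ, ContDiffOn ℝ ∞ f₀ (cone n) ∧ f =ᵐ[mu n ν] f₀ ∧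
      (∀ a b : CMat n, aᵀ = -a → bᵀ = b →
        lam (fromBlocks a b b a) f =ᵐ[mu n ν] fun x =>
          (b * cmat x).trace * f₀ x
            + ((cmat x * a - a * cmat x - (ν : ℂ) • b) * grad f₀ x).trace
            - (cmat x * nabla (fun y => b * grad f₀ y) x).trace) ∧
      (∀ a : CMat n, aᵀ = a →
        lam (fromBlocks a a (-a) (-a)) f =ᵐ[mu n ν] fun x =>
          ((ν : ℂ) • a + a * cmat x).trace * f₀ x
            + ((a * cmat x + cmat x * a + (ν : ℂ) • a) * grad f₀ x).trace
            + (cmat x * nabla (fun y => a * grad f₀ y) x).trace) ∧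
      (∀ a : CMat n, aᵀ = a →
        lam (fromBlocks a (-a) a (-a)) f =ᵐ[mu n ν] fun x =>
          ((ν : ℂ) • a - a * cmat x).trace * f₀ x
            + ((a * cmat x + cmat x * a - (ν : ℂ) • a) * grad f₀ x).trace
            - (cmat x * nabla (fun y => a * grad f₀ y) x).trace) := by
  obtain ⟨f₀, hf₀, hff₀⟩ := exists_smooth_representative hν hf
  refine ⟨f₀, hf₀, hff₀, fun a b ha hb => ?_, fun a ha => ?_, fun a ha => ?_⟩
  · have h := lam_ae_eq_diffOp hν a hb hb hf hf₀ hff₀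
    have ha0 : a.trace = 0 := by
      have := congrArg Matrix.trace ha
      rw [Matrix.trace_transpose, Matrix.trace_neg] at this
      exact self_eq_neg.1 this
    rw [ha, neg_neg] at h
    filter_upwards [h] with x hx
    rw [hx, diffOp, ha0, ha, mul_zero, zero_add, neg_mul, ← sub_eq_add_neg]
  · have h := lam_ae_eq_diffOp hν a (b := a) (c := -a) ha (by rw [Matrix.transpose_neg, ha])
      hf hf₀ hff₀
    rw [ha] at h
    filter_upwards [h] with x hx
    have hn : nabla (fun y => -a * grad f₀ y) x = -nabla (fun y => a * grad f₀ y) x := by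
      ext i j
      simp [nabla, D, fderiv_fun_neg]
    rw [hx, diffOp, hn, ha, Matrix.trace_add, Matrix.trace_smul, smul_eq_mul, smul_neg, sub_neg_eq_add,
      add_comm (cmat x * a), mul_neg, Matrix.trace_neg, sub_neg_eq_add]
  · have h := lam_ae_eq_diffOp hν a (b := -a) (c := a) (by rw [Matrix.transpose_neg, ha]) ha
      hf hf₀ hff₀
    rw [ha] at h
    filter_upwards [h] with x hx
    rw [hx, diffOp, ha, Matrix.trace_sub, Matrix.trace_smul, smul_eq_mul, neg_mul, Matrix.trace_neg,
      ← sub_eq_add_neg, add_comm (cmat x * a)]
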